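/- **Setting.** Let $A(m)\in\mathbb{C}$ ($m\ge 1$) be the coefficients of an $L$-function $L(s)$ of degree $d\ge 1$ without poles, in the following sense. (i) $L(s)=\sum_{m\ge1}A(m)m^{-s}$, absolutely convergent for $\Re(s)>1$. (ii) For $\Re(s)>1$, $L(s)=\prod_p L_p(s)$ with $L_p(s)=\sum_{k\ge0}A(p^k)p^{-ks}$, and for every prime $p$ there are $\alpha_1(p),\dots,\alpha_d(p)\in\mathbb{C}$ (possibly zero) with $L_p(s)=\prod_{i=1}^d(1-\alpha_i(p)p^{-s})^{-1}$. (iii) $L$ extends to an entire function of finite order, and for some $Q>0$, $\mu_1,\dots,\mu_d\in\mathbb{C}$ and $|\varepsilon(L)|=1$, putting $\gamma(s)=Q^s\prod_{j=1}^d\Gamma\left(\frac{s+\mu_j}{2}\right)$, one has $\gamma(s)L(s)=\varepsilon(L)\,\gamma(1-s)L(1-s)$ as meromorphic functions. (iv) For every $\varepsilon>0$, $\sum_{m\le X}|A(m)|^2\ll_\varepsilon X^{1+\varepsilon}$ for all $X\ge1$. Let $\theta\ge0$ be such that $L(\tfrac12+it)\ll_\varepsilon(1+|t|)^{\theta+\varepsilon}$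 for all $t\in\mathbb{R}$ and every $\varepsilon>0$. Let $0<\delta<1$ and $M=X^\delta$, and put $$\Sigma(x)=\sum_{\substack{mk\in[x,x+H]\\ M<m\le 2M\\ (m,k)=1}}A(mk),$$ the sum running over pairs of positive integers $m,k$. **Second moment bound.** For all constants $c_1,c_2>0$ there is a constant $K$, depending only on the $L$-function, $\theta$, $\delta$, $c_1$ and $c_2$, such that for all $X\ge1$ and all $H$ with $c_1X^{6\delta}\le H\le c_2X^{1-6\delta}$, $$\int_X^{2X}|\Sigma(x)|^2\,dx\le K\left(H^2X^{1-\delta^2}+X^{2\theta(1+\delta)+6\delta}H^{2-2\theta}\right).$$ **Consequence.** Let $h=1+\delta-\frac1{2\theta}+\frac{6\delta+2\delta^2}{2\theta}$ if $\theta\ge\frac12$ and $h=6\delta$ if $\theta<\frac12$, and suppose that $h\le1-6\delta$. Then there is $X_0$, depending only on the $L$-function, $\theta$ and $\delta$, such that for all $X\ge X_0$ and all $C\ge1$, with $H=X^h$, the inequality $|\Sigma(x)|<CHX^{-\delta^2/2}$ holds for a set of $x\in[X,2X]$ of Lebesgue measure at least $(1-C^{-2})X$. -/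

import Mathlib

/-- The local factor `L_p(s) = ∑_{k ≥ 0} A(p^k) p^{-ks}` at `p`. -/
noncomputable def localFactor (A : ℕ → ℂ) (p : ℕ) (s : ℂ) : ℂ :=
  ∑' k : ℕ, A (p ^ k) / ((p ^ k : ℕ) : ℂ) ^ s

/-- The gamma factor `Q^s ∏_j Γ((s + μ_j)/2)` of a functional equation. -/
noncomputable def gammaFactor {d : ℕ} (Q : ℝ) (μ : Fin d → ℂ) (s : ℂ) : ℂ :=
  (Q : ℂ) ^ s * ∏ j, Complex.Gamma ((s + μ j) / 2)

/-- `s` is not a pole of `∏_j Γ((s + μ_j)/2)`. -/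
def GammaRegular {d : ℕ} (μ : Fin d → ℂ) (s : ℂ) : Prop :=
  ∀ (j : Fin d) (n : ℕ), (s + μ j) / 2 ≠ -(n : ℂ)

/-- `L` is an `L`-function of degree `d` without poles, with coefficients `A(m)`, `m ≥ 1`
(the value `A 0` plays no role). -/
structure IsLFunction (A : ℕ → ℂ) (L : ℂ → ℂ) (d : ℕ) : Prop where
  /-- the degree is positive -/
  degree_pos : 1 ≤ d
  /-- Dirichlet series: `L(s) = ∑_{m ≥ 1} A(m) m^{-s}` for `Re s > 1`, absolutely convergent -/
  dirichlet_series : ∀ s : ℂ, 1 < s.re → LSeriesHasSum A s (L s)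
  /-- Euler product: `L(s) = ∏_p L_p(s)` for `Re s > 1` -/
  euler_product : ∀ s : ℂ, 1 < s.re →
    HasProd (fun p : Nat.Primes => localFactor A (p : ℕ) s) (L s)
  /-- each local factor is the inverse of a polynomial in `p^{-s}` of degree at most `d`
  with constant term `1`: `L_p(s) = ∏_{i ≤ d} (1 - α_i(p) p^{-s})^{-1}` -/
  local_polynomial : ∀ p : ℕ, p.Prime → ∃ α : Fin d → ℂ, ∀ s : ℂ, 1 < s.re →
    (∏ i, (1 - α i * (p : ℂ) ^ (-s))) * localFactor A p s = 1
  /-- analytic continuation to the whole plane, without poles -/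
  entire : Differentiable ℂ L
  /-- the continuation has finite order -/
  finite_order : ∃ a C : ℝ, ∀ s : ℂ, ‖L s‖ ≤ C * Real.exp (‖s‖ ^ a)
  /-- functional equation, an identity of meromorphic functions -/
  functional_equation : ∃ (Q : ℝ) (μ : Fin d → ℂ) (w : ℂ), 0 < Q ∧ ‖w‖ = 1 ∧
    ∀ s : ℂ, GammaRegular μ s → GammaRegular μ (1 - s) →
      gammaFactor Q μ s * L s = w * gammaFactor Q μ (1 - s) * L (1 - s)
  /-- Rankin-Selberg bound: `∑_{m ≤ X} |A(m)|² ≪_ε X^{1+ε}` -/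
  rankin_selberg : ∀ ε : ℝ, 0 < ε → ∃ C : ℝ, ∀ X : ℝ, 1 ≤ X →
    ∑ m ∈ Finset.Icc 1 ⌊X⌋₊, ‖A m‖ ^ 2 ≤ C * X ^ (1 + ε)

/-- `θ ≥ 0` is a (sub)convexity exponent of `L`: `L(1/2 + it) ≪_ε (1 + |t|)^{θ+ε}`. -/
def IsSubconvexityExponent (L : ℂ → ℂ) (θ : ℝ) : Prop :=
  0 ≤ θ ∧ ∀ ε : ℝ, 0 < ε → ∃ C : ℝ, ∀ t : ℝ,
    ‖L (1 / 2 + (t : ℂ) * Complex.I)‖ ≤ C * (1 + |t|) ^ (θ + ε)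

/-- The short sum of `A(mk)` over pairs of coprime positive integers `m`, `k` with
`M < m ≤ 2M` and `x ≤ mk ≤ x + H` (for `M ≥ 0` and `x > 0`). -/
noncomputable def shortSum (A : ℕ → ℂ) (M H x : ℝ) : ℂ :=
  ∑ m ∈ Finset.Ioc ⌊M⌋₊ ⌊2 * M⌋₊,
    ∑ k ∈ (Finset.Icc 1 ⌊x + H⌋₊).filter (fun k : ℕ =>
      x ≤ (m : ℝ) * (k : ℝ) ∧ (m : ℝ) * (k : ℝ) ≤ x + H ∧ Nat.Coprime m k), A (m * k)

/-- The exponent `h` of the interval length `H = X^h` that balances the second moment bound. -/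
noncomputable def lengthExponent (θ δ : ℝ) : ℝ :=
  if 1 / 2 ≤ θ then 1 + δ - 1 / (2 * θ) + (6 * δ + 2 * δ ^ 2) / (2 * θ) else 6 * δ

/-!
`Σ(x)` sums `A(mk)` over the window `[x, x + H]`. The jump of a truncated power `(ν / y)^c` with
`c = X / H` replaces Perron's formula for the indicator function of the window, and by Parseval the
mean square of `Σ` over `[X, 2X]` is at most about `X²` times the integral of `|F|²` against the
Cauchy weight `1 / ((c + 1/2)² + t²)`, where `F(t) = ∑ A(m) A(k) (mk)^(-1/2 - it)` over coprime `m`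
and `k`. Möbius inversion and Cauchy–Schwarz remove the coprimality condition: for each `e` the sums
over the multiples `m` and `k` of `e` are then separate Dirichlet polynomials.

Where the short polynomials over `m ∼ X^δ` are small, the mean value theorem for the long sum over
`k` suffices. Elsewhere the sum over `k`, smoothly cut off and with the coprimality kept in an Euler
factor, is an integral of `L` on the line `Re s = 1/2` and hence obeys the subconvexity bound, while
the mean value theorem for a high power of the short polynomials shows that they are large only on a
small set.
-/

section ArithmeticFunctions

theorem add_one_le_pow_rpow {x ε : ℝ} (hx : 0 ≤ x) (h : 2 ≤ x ^ ε) (a : ℕ) :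
    (a + 1 : ℝ) ≤ (x ^ a) ^ ε := by
  calc (a + 1 : ℝ) ≤ 2 ^ a := by exact_mod_cast Nat.lt_two_pow_self
    _ ≤ (x ^ ε) ^ a := by gcongr
    _ = (x ^ a) ^ ε := Real.rpow_pow_comm hx ε a

theorem add_one_le_mul_pow_rpow {x ε : ℝ} (hx : 2 ≤ x) (hε : 0 < ε) (a : ℕ) :
    (a + 1 : ℝ) ≤ max 1 (1 / (ε * Real.log 2)) * (x ^ a) ^ ε := by
  set C := max 1 (1 / (ε * Real.log 2))
  have hlog : 0 < ε * Real.log 2 := mul_pos hε (Real.log_pos one_lt_two)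
  have one_le : 1 ≤ C * (ε * Real.log 2) := (div_le_iff₀ hlog).mp (le_max_right _ _)
  have linear_le : 1 + a * (ε * Real.log 2) ≤ (x ^ a) ^ ε :=
    calc 1 + a * (ε * Real.log 2) ≤ Real.exp (a * (ε * Real.log 2)) := by
          rw [add_comm]; exact Real.add_one_le_exp _
      _ = ((2 : ℝ) ^ a) ^ ε := by
          rw [Real.rpow_def_of_pos (by positivity), Real.log_pow]; ring_nf
      _ ≤ (x ^ a) ^ ε := by gcongr
  calc (a + 1 : ℝ) ≤ C * 1 + a * (C * (ε * Real.log 2)) := by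
        nlinarith [le_max_left 1 (1 / (ε * Real.log 2)), Nat.cast_nonneg (α := ℝ) a]
    _ = C * (1 + a * (ε * Real.log 2)) := by ring
    _ ≤ C * (x ^ a) ^ ε := by gcongr

theorem exists_card_divisors_le_mul_rpow {ε : ℝ} (hε : 0 < ε) :
    ∃ C : ℝ, 1 ≤ C ∧ ∀ n : ℕ, n ≠ 0 → (n.divisors.card : ℝ) ≤ C * (n : ℝ) ^ ε := by
  set C₁ : ℝ := max 1 (1 / (ε * Real.log 2))
  have one_le_C₁ : 1 ≤ C₁ := le_max_left _ _
  obtain ⟨P, hP⟩ := exists_nat_ge ((2 : ℝ) ^ (1 / ε))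
  -- only the primes below `2 ^ (1 / ε)` cost more than `(p ^ a) ^ ε`
  have local_le (p a : ℕ) (hp : p.Prime) :
      (a + 1 : ℝ) ≤ (if p < P then C₁ else 1) * ((p : ℝ) ^ a) ^ ε := by
    split_ifs with hpP
    · exact add_one_le_mul_pow_rpow (by exact_mod_cast hp.two_le) hε a
    · rw [one_mul]
      refine add_one_le_pow_rpow p.cast_nonneg ?_ a
      calc (2 : ℝ) = ((2 : ℝ) ^ (1 / ε)) ^ ε := by
            rw [← Real.rpow_mul zero_le_two, one_div_mul_cancel hε.ne', Real.rpow_one]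
        _ ≤ (p : ℝ) ^ ε := by
            gcongr
            exact hP.trans (by exact_mod_cast not_lt.mp hpP)
  refine ⟨C₁ ^ P, one_le_pow₀ one_le_C₁, fun n hn => ?_⟩
  calc (n.divisors.card : ℝ) = ∏ p ∈ n.primeFactors, ((n.factorization p : ℝ) + 1) := by
        rw [Nat.card_divisors hn]; push_cast; rfl
    _ ≤ ∏ p ∈ n.primeFactors, ((if p < P then C₁ else 1) * ((p : ℝ) ^ n.factorization p) ^ ε) :=
        Finset.prod_le_prod (fun _ _ => by positivity)
          fun p hp => local_le p _ (Nat.prime_of_mem_primeFactors hp)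
    _ = C₁ ^ (n.primeFactors.filter (· < P)).card * (n : ℝ) ^ ε := by
        rw [Finset.prod_mul_distrib, Real.finsetProd_rpow _ _ (fun _ _ => by positivity),
          Finset.prod_ite, Finset.prod_const_one, mul_one, Finset.prod_const]
        congr 2
        exact_mod_cast Nat.prod_factorization_pow_eq_self hn
    _ ≤ C₁ ^ P * (n : ℝ) ^ ε := by
        gcongr
        simpa using Finset.card_le_card (t := Finset.range P) fun p hp =>
          Finset.mem_range.mpr (Finset.mem_filter.mp hp).2

theorem exists_card_divisors_pow_le_mul_rpow (k : ℕ) {ε : ℝ} (hε : 0 < ε) :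
    ∃ C : ℝ, 1 ≤ C ∧ ∀ n : ℕ, n ≠ 0 → (n.divisors.card : ℝ) ^ k ≤ C * (n : ℝ) ^ ε := by
  obtain ⟨C, hC, h⟩ := exists_card_divisors_le_mul_rpow (ε := ε / (k + 1)) (by positivity)
  refine ⟨C ^ k, one_le_pow₀ hC, fun n hn => ?_⟩
  have one_le_n : (1 : ℝ) ≤ n := by exact_mod_cast Nat.one_le_iff_ne_zero.mpr hn
  calc (n.divisors.card : ℝ) ^ k ≤ (C * (n : ℝ) ^ (ε / (k + 1))) ^ k := by gcongr; exact h n hn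
    _ = C ^ k * (n : ℝ) ^ (ε / (k + 1) * k) := by
        rw [mul_pow, Real.rpow_mul (by positivity), Real.rpow_natCast]
    _ ≤ C ^ k * (n : ℝ) ^ ε := by
        gcongr
        rw [div_mul_eq_mul_div, div_le_iff₀ (by positivity)]
        nlinarith

theorem two_pow_card_primeFactors_le_card_divisors {m : ℕ} (hm : m ≠ 0) :
    2 ^ m.primeFactors.card ≤ m.divisors.card := by
  rw [Nat.card_divisors hm, ← Finset.prod_const]
  refine Finset.prod_le_prod' fun p hp => Nat.succ_le_succ ?_
  exact Nat.one_le_iff_ne_zero.mpr (Finsupp.mem_support_iff.mp hp)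

theorem exists_two_pow_mul_card_primeFactors_le (d : ℕ) {ε : ℝ} (hε : 0 < ε) :
    ∃ C : ℝ, 1 ≤ C ∧ ∀ m : ℕ, m ≠ 0 →
      (2 : ℝ) ^ (d * m.primeFactors.card) ≤ C * (m : ℝ) ^ ε := by
  obtain ⟨C, hC, h⟩ := exists_card_divisors_pow_le_mul_rpow d hε
  refine ⟨C, hC, fun m hm => le_trans ?_ (h m hm)⟩
  rw [mul_comm, pow_mul]
  gcongr
  exact_mod_cast two_pow_card_primeFactors_le_card_divisors hm

end ArithmeticFunctions

section MultiplicativeExtension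

/-- The multiplicative function with the same values as `A` at the prime powers: Euler products are
expanded for it, and the coefficients of an Euler product are compared with it. -/
noncomputable def multExtension (A : ℕ → ℂ) (n : ℕ) : ℂ :=
  n.factorization.prod fun p k => A (p ^ k)

variable {A : ℕ → ℂ}

theorem multExtension_one : multExtension A 1 = 1 := by simp [multExtension]

theorem multExtension_prime_pow (h1 : A 1 = 1) {p : ℕ} (hp : p.Prime) (k : ℕ) :
    multExtension A (p ^ k) = A (p ^ k) := by
  rw [multExtension, hp.factorization_pow, Finsupp.prod_single_index (by simpa using h1)]

theorem multExtension_mul {m n : ℕ} (h : m.Coprime n) :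
    multExtension A (m * n) = multExtension A m * multExtension A n := by
  rw [multExtension, Nat.factorization_mul_of_coprime h,
    Finsupp.prod_add_index_of_disjoint h.disjoint_primeFactors]
  rfl

theorem LSeries_term_mul {f : ℕ → ℂ} (s : ℂ) {m n : ℕ} (hf : f (m * n) = f m * f n) :
    LSeries.term f s (m * n) = LSeries.term f s m * LSeries.term f s n := by
  rcases eq_or_ne m 0 with rfl | hm
  · simp
  rcases eq_or_ne n 0 with rfl | hn
  · simp
  rw [LSeries.term_of_ne_zero (mul_ne_zero hm hn), LSeries.term_of_ne_zero hm,
    LSeries.term_of_ne_zero hn, hf, Nat.cast_mul, Complex.natCast_mul_natCast_cpow]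
  ring

theorem LSeries_term_multExtension_prime_pow (h1 : A 1 = 1) (s : ℂ) {p : ℕ} (hp : p.Prime)
    (k : ℕ) : LSeries.term (multExtension A) s (p ^ k) = LSeries.term A s (p ^ k) := by
  rw [LSeries.term_of_ne_zero (pow_ne_zero _ hp.ne_zero),
    LSeries.term_of_ne_zero (pow_ne_zero _ hp.ne_zero), multExtension_prime_pow h1 hp]

theorem summable_prime_pow {f : ℕ → ℝ}
    (hf : Summable fun x : Nat.Primes × ℕ => f ((x.1 : ℕ) ^ (x.2 + 1))) {p : ℕ} (hp : p.Prime) :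
    Summable fun k => f (p ^ k) :=
  (summable_nat_add_iff (f := fun k => f (p ^ k)) 1).mp (hf.prod_factor ⟨p, hp⟩)

theorem prod_tsum_prime_pow_le_exp {f : ℕ → ℝ} (hf0 : ∀ n, 0 ≤ f n) (hf1 : f 1 = 1)
    (hf : Summable fun x : Nat.Primes × ℕ => f ((x.1 : ℕ) ^ (x.2 + 1))) (S : Finset ℕ) :
    ∏ p ∈ S with p.Prime, ∑' k, f (p ^ k) ≤
      Real.exp (∑' x : Nat.Primes × ℕ, f ((x.1 : ℕ) ^ (x.2 + 1))) := by
  have tsum_eq (p : Nat.Primes) : ∑' k, f (p ^ k) = 1 + ∑' k, f (p ^ (k + 1)) := by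
    rw [(summable_prime_pow hf p.2).tsum_eq_zero_add, pow_zero, hf1]
  calc ∏ p ∈ S with p.Prime, ∑' k, f (p ^ k)
      = ∏ p ∈ S.subtype Nat.Prime, (1 + ∑' k, f ((p : ℕ) ^ (k + 1))) := by
        rw [← Finset.subtype_map, Finset.prod_map]
        exact Finset.prod_congr rfl fun p _ => tsum_eq p
    _ ≤ Real.exp (∑ p ∈ S.subtype Nat.Prime, ∑' k, f ((p : ℕ) ^ (k + 1))) :=
        Real.prod_one_add_le_exp_sum _ fun _ => tsum_nonneg fun _ => hf0 _
    _ ≤ Real.exp (∑' x : Nat.Primes × ℕ, f ((x.1 : ℕ) ^ (x.2 + 1))) := by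
        rw [hf.tsum_prod]
        gcongr
        exact Summable.sum_le_tsum (f := fun p : Nat.Primes => ∑' k, f ((p : ℕ) ^ (k + 1)))
          _ (fun _ _ => tsum_nonneg fun _ => hf0 _) hf.prod

theorem summable_of_coprime_mul_of_summable_prime_pow {f : ℕ → ℝ} (hf0 : ∀ n, 0 ≤ f n)
    (hzero : f 0 = 0) (hf1 : f 1 = 1) (hmul : ∀ {m n : ℕ}, m.Coprime n → f (m * n) = f m * f n)
    (hf : Summable fun x : Nat.Primes × ℕ => f ((x.1 : ℕ) ^ (x.2 + 1))) : Summable f := by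
  have summable_pow {p : ℕ} (hp : p.Prime) : Summable fun k => ‖f (p ^ k)‖ := by
    simpa only [Real.norm_of_nonneg (hf0 _)] using summable_prime_pow hf hp
  refine summable_of_sum_le
    (c := Real.exp (∑' x : Nat.Primes × ℕ, f ((x.1 : ℕ) ^ (x.2 + 1)))) hf0 fun u => ?_
  set N := u.sup id + 1
  have mem_factoredNumbers : ∀ n ∈ u.filter (f · ≠ 0), n ∈ Nat.factoredNumbers (.range N) := by
    intro n hn
    obtain ⟨hnu, hfn⟩ := Finset.mem_filter.mp hn
    refine ⟨fun h => hfn (h ▸ hzero), fun p hp => Finset.mem_range.mpr ?_⟩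
    exact (Nat.le_of_mem_primeFactorsList hp).trans_lt
      (Nat.lt_succ_of_le (Finset.le_sup (f := id) hnu))
  obtain ⟨-, hasSum⟩ := EulerProduct.summable_and_hasSum_factoredNumbers_prod_filter_prime_tsum
    hf1 hmul summable_pow (Finset.range N)
  calc ∑ n ∈ u, f n = ∑ n ∈ u with f n ≠ 0, f n := (Finset.sum_filter_ne_zero u).symm
    _ ≤ ∑' n : Nat.factoredNumbers (.range N), f n := by
        rw [← Finset.sum_subtype_of_mem f mem_factoredNumbers]
        exact hasSum.summable.sum_le_tsum _ fun _ _ => hf0 _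
    _ ≤ _ := hasSum.tsum_eq.trans_le (prod_tsum_prime_pow_le_exp hf0 hf1 hf _)

theorem lseriesSummable_multExtension (h1 : A 1 = 1) {s : ℂ} (hs : LSeriesSummable A s) :
    LSeriesSummable (multExtension A) s := by
  rw [LSeriesSummable, ← summable_norm_iff]
  have injective : Function.Injective fun x : Nat.Primes × ℕ => (x.1 : ℕ) ^ (x.2 + 1) :=
    Subtype.val_injective.comp Nat.Primes.prodNatEquiv.injective
  refine summable_of_coprime_mul_of_summable_prime_pow (fun _ => norm_nonneg _) (by simp)
    (by simp [LSeries.term, multExtension_one])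
    (fun h => by rw [LSeries_term_mul s (multExtension_mul h), norm_mul]) ?_
  refine (hs.norm.comp_injective injective).congr fun x => ?_
  rw [Function.comp_apply, LSeries_term_multExtension_prime_pow h1 s x.1.2]

end MultiplicativeExtension

/-- `L` is entire of finite order and has, for `Re s > 1`, an Euler product of degree at most `d`
whose coefficients `A(m)` are bounded in mean square by `m^ε`: an `L`-function without poles, except
that no functional equation is required. Imprimitive Dirichlet `L`-functions are examples. -/
structure IsEntireEulerProduct (A : ℕ → ℂ) (L : ℂ → ℂ) (d : ℕ) : Prop where
  dirichlet_series : ∀ s : ℂ, 1 < s.re → LSeriesHasSum A s (L s)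
  euler_product : ∀ s : ℂ, 1 < s.re →
    HasProd (fun p : Nat.Primes => localFactor A (p : ℕ) s) (L s)
  local_polynomial : ∀ p : ℕ, p.Prime → ∃ α : Fin d → ℂ, ∀ s : ℂ, 1 < s.re →
    (∏ i, (1 - α i * (p : ℂ) ^ (-s))) * localFactor A p s = 1
  entire : Differentiable ℂ L
  finite_order : ∃ a C : ℝ, ∀ s : ℂ, ‖L s‖ ≤ C * Real.exp (‖s‖ ^ a)
  rankin_selberg : ∀ ε : ℝ, 0 < ε → ∃ C : ℝ, ∀ X : ℝ, 1 ≤ X →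
    ∑ m ∈ Finset.Icc 1 ⌊X⌋₊, ‖A m‖ ^ 2 ≤ C * X ^ (1 + ε)

theorem IsLFunction.isEntireEulerProduct {A : ℕ → ℂ} {L : ℂ → ℂ} {d : ℕ} (hL : IsLFunction A L d) :
    IsEntireEulerProduct A L d where
  dirichlet_series := hL.dirichlet_series
  euler_product := hL.euler_product
  local_polynomial := hL.local_polynomial
  entire := hL.entire
  finite_order := hL.finite_order
  rankin_selberg := hL.rankin_selberg

section LocalFactors

open Filter Topology

theorem differentiableOn_tsum_mul_pow {a : ℕ → ℂ} {ρ : ℝ}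
    (ha : ∀ r, 0 ≤ r → r < ρ → Summable fun k => ‖a k‖ * r ^ k) :
    DifferentiableOn ℂ (fun z => ∑' k, a k * z ^ k) (Metric.ball 0 ρ) := by
  intro z hz
  obtain ⟨r, hzr, hrρ⟩ := exists_between (mem_ball_zero_iff.mp hz)
  have hz' : z ∈ Metric.ball 0 r := mem_ball_zero_iff.mpr hzr
  have differentiableOn := Complex.differentiableOn_tsum_of_summable_norm
    (F := fun k z => a k * z ^ k) (ha r ((norm_nonneg z).trans hzr.le) hrρ)
    (fun k => by fun_prop) Metric.isOpen_ball fun k w hw => by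
      rw [norm_mul, norm_pow]
      gcongr
      exact (mem_ball_zero_iff.mp hw).le
  exact ((differentiableOn z hz').differentiableAt
    (Metric.isOpen_ball.mem_nhds hz')).differentiableWithinAt

theorem exists_natCast_cpow_neg_eq {p : ℕ} (hp : 1 < p) {z : ℂ} (hz0 : z ≠ 0)
    (hz : ‖z‖ < 1 / p) : ∃ s : ℂ, 1 < s.re ∧ (p : ℂ) ^ (-s) = z := by
  have log_pos : 0 < Real.log p := Real.log_pos (by exact_mod_cast hp)
  refine ⟨-(Complex.log z / Real.log p), ?_, ?_⟩
  · rw [Complex.neg_re, Complex.div_ofReal_re, Complex.log_re, lt_neg, div_lt_iff₀ log_pos]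
    calc Real.log ‖z‖ < Real.log (1 / p) := Real.log_lt_log (norm_pos_iff.mpr hz0) hz
      _ = -1 * Real.log p := by rw [one_div, Real.log_inv, neg_one_mul]
  · rw [neg_neg, Complex.cpow_def_of_ne_zero (by exact_mod_cast (zero_lt_one.trans hp).ne'),
      ← Complex.natCast_log, mul_div_cancel₀ _ (by exact_mod_cast log_pos.ne'),
      Complex.exp_log hz0]

theorem localFactor_eq_tsum_mul_pow (A : ℕ → ℂ) (p : ℕ) (s : ℂ) :
    localFactor A p s = ∑' k : ℕ, A (p ^ k) * ((p : ℂ) ^ (-s)) ^ k := by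
  refine tsum_congr fun k => ?_
  rw [Nat.cast_pow, Complex.cpow_neg, inv_pow, div_eq_mul_inv, ← Complex.natCast_cpow_natCast_mul,
    mul_comm (k : ℂ), Complex.cpow_mul_nat]

theorem tsum_term_prime_pow (A : ℕ → ℂ) {p : ℕ} (hp : p.Prime) (s : ℂ) :
    ∑' k : ℕ, LSeries.term A s (p ^ k) = localFactor A p s :=
  tsum_congr fun k => by rw [LSeries.term_of_ne_zero (pow_ne_zero _ hp.ne_zero)]

/-- The inverse local factor `∏ᵢ (1 - αᵢ p^{-s})` of an Euler product at `p`. -/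
noncomputable def eulerPoly {d : ℕ} (α : Fin d → ℂ) (p : ℕ) (s : ℂ) : ℂ :=
  ∏ i, (1 - α i * (p : ℂ) ^ (-s))

theorem differentiable_eulerPoly {d : ℕ} (α : Fin d → ℂ) {p : ℕ} (hp : p ≠ 0) :
    Differentiable ℂ (eulerPoly α p) :=
  Differentiable.fun_finsetProd fun i _ => (differentiable_const _).sub
    ((differentiable_const _).mul (differentiable_neg.const_cpow (.inl (by exact_mod_cast hp))))

theorem norm_eulerPoly_le {d : ℕ} {α : Fin d → ℂ} {p : ℕ} (hp : 0 < p) (hα : ∀ i, ‖α i‖ ≤ √p)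
    {s : ℂ} (hs : 1 / 2 ≤ s.re) : ‖eulerPoly α p s‖ ≤ 2 ^ d := by
  have norm_cpow_le : ‖(p : ℂ) ^ (-s)‖ ≤ (√p)⁻¹ := by
    rw [Complex.norm_natCast_cpow_of_pos hp, Real.sqrt_eq_rpow, ← Real.rpow_neg p.cast_nonneg]
    exact Real.rpow_le_rpow_of_exponent_le (by exact_mod_cast hp) (by simpa using hs)
  have norm_factor_le (i : Fin d) : ‖1 - α i * (p : ℂ) ^ (-s)‖ ≤ 2 :=
    calc ‖1 - α i * (p : ℂ) ^ (-s)‖ ≤ ‖(1 : ℂ)‖ + ‖α i‖ * ‖(p : ℂ) ^ (-s)‖ := by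
          rw [← norm_mul]; exact norm_sub_le _ _
      _ ≤ 1 + √p * (√p)⁻¹ := by rw [norm_one]; gcongr; exact hα i
      _ = 2 := by rw [mul_inv_cancel₀ (by positivity)]; norm_num
  rw [eulerPoly, norm_prod]
  simpa using Finset.prod_le_prod (s := Finset.univ) (fun i _ => norm_nonneg _)
    fun i _ => norm_factor_le i

end LocalFactors

namespace IsEntireEulerProduct

open Filter Topology

variable {A : ℕ → ℂ} {L : ℂ → ℂ} {d : ℕ}

theorem lseriesSummable (hL : IsEntireEulerProduct A L d) {s : ℂ} (hs : 1 < s.re) :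
    LSeriesSummable A s :=
  (hL.dirichlet_series s hs).LSeriesSummable

theorem exists_norm_coeff_sq_le (hL : IsEntireEulerProduct A L d) {ε : ℝ} (hε : 0 < ε) :
    ∃ C : ℝ, 0 ≤ C ∧ ∀ n : ℕ, n ≠ 0 → ‖A n‖ ^ 2 ≤ C * (n : ℝ) ^ (1 + ε) := by
  obtain ⟨C, hC⟩ := hL.rankin_selberg ε hε
  have norm_sq_le (n : ℕ) (hn : n ≠ 0) : ‖A n‖ ^ 2 ≤ C * (n : ℝ) ^ (1 + ε) := by
    have one_le_n : 1 ≤ n := Nat.one_le_iff_ne_zero.mpr hn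
    calc ‖A n‖ ^ 2 ≤ ∑ m ∈ Finset.Icc 1 ⌊(n : ℝ)⌋₊, ‖A m‖ ^ 2 :=
          Finset.single_le_sum (f := fun m => ‖A m‖ ^ 2) (fun _ _ => by positivity)
            (by simpa using one_le_n)
      _ ≤ C * (n : ℝ) ^ (1 + ε) := hC n (by exact_mod_cast one_le_n)
  exact ⟨C, by simpa using (sq_nonneg ‖A 1‖).trans (norm_sq_le 1 one_ne_zero), norm_sq_le⟩

theorem summable_norm_coeff_prime_pow_mul_pow (hL : IsEntireEulerProduct A L d) {p : ℕ}
    (hp : p.Prime) {r : ℝ} (hr0 : 0 ≤ r) (hr : r * √p < 1) :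
    Summable fun k : ℕ => ‖A (p ^ k)‖ * r ^ k := by
  have hp0 : (0 : ℝ) < p := by exact_mod_cast hp.pos
  obtain ⟨ε, hε, ratio_lt_one⟩ : ∃ ε : ℝ, 0 < ε ∧ r * (p : ℝ) ^ ((1 + ε) / 2) < 1 := by
    have continuous : Continuous fun ε : ℝ => r * (p : ℝ) ^ ((1 + ε) / 2) :=
      continuous_const.mul (continuous_const.rpow (by fun_prop) fun _ => .inl hp0.ne')
    have eventually_lt : ∀ᶠ ε in 𝓝[>] (0 : ℝ), r * (p : ℝ) ^ ((1 + ε) / 2) < 1 := by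
      refine (continuous.tendsto 0).mono_left nhdsWithin_le_nhds |>.eventually_lt_const ?_
      simpa [Real.sqrt_eq_rpow] using hr
    obtain ⟨ε, hlt, hε⟩ := (eventually_lt.and self_mem_nhdsWithin).exists
    exact ⟨ε, hε, hlt⟩
  obtain ⟨C, hC, hA⟩ := hL.exists_norm_coeff_sq_le hε
  have norm_coeff_le (k : ℕ) : ‖A (p ^ k)‖ ≤ √C * ((p : ℝ) ^ ((1 + ε) / 2)) ^ k := by
    refine abs_le_of_sq_le_sq' ?_ (by positivity) |>.2
    refine (hA (p ^ k) (pow_ne_zero _ hp.ne_zero)).trans_eq ?_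
    rw [mul_pow, Real.sq_sqrt hC, Nat.cast_pow, pow_right_comm, ← Real.rpow_mul_natCast hp0.le,
      Nat.cast_ofNat, div_mul_cancel₀ _ two_ne_zero, Real.rpow_pow_comm hp0.le]
  refine .of_nonneg_of_le (fun k => by positivity) (fun k => ?_)
    ((summable_geometric_of_lt_one (by positivity) ratio_lt_one).mul_left √C)
  calc ‖A (p ^ k)‖ * r ^ k ≤ √C * ((p : ℝ) ^ ((1 + ε) / 2)) ^ k * r ^ k := by
        gcongr; exact norm_coeff_le k
    _ = √C * (r * (p : ℝ) ^ ((1 + ε) / 2)) ^ k := by rw [mul_pow]; ring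

/-- The mean-square bound on the coefficients extends the local identity, known for `|z| < 1 / p`,
to the disc `|z| < p^{-1/2}`. -/
theorem prod_one_sub_mul_mul_tsum_eq_one (hL : IsEntireEulerProduct A L d) {p : ℕ} (hp : p.Prime)
    {α : Fin d → ℂ} (hα : ∀ s : ℂ, 1 < s.re → eulerPoly α p s * localFactor A p s = 1) {z : ℂ}
    (hz : ‖z‖ < (√p)⁻¹) : (∏ i, (1 - α i * z)) * ∑' k, A (p ^ k) * z ^ k = 1 := by
  have hp0 : (0 : ℝ) < p := by exact_mod_cast hp.pos
  have differentiableOn : DifferentiableOn ℂ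
      (fun z => (∏ i, (1 - α i * z)) * ∑' k, A (p ^ k) * z ^ k) (Metric.ball 0 (√p)⁻¹) := by
    refine DifferentiableOn.mul (by fun_prop) (differentiableOn_tsum_mul_pow fun r hr0 hr => ?_)
    exact hL.summable_norm_coeff_prime_pow_mul_pow hp hr0
      ((lt_inv_mul_iff₀' (by positivity)).mp (by simpa using hr))
  refine (differentiableOn.analyticOnNhd Metric.isOpen_ball).eqOn_of_preconnected_of_frequently_eq
    (analyticOnNhd_const (v := (1 : ℂ))) (convex_ball _ _).isPreconnected
    (Metric.mem_ball_self (by positivity)) (Eventually.frequently ?_) (mem_ball_zero_iff.mpr hz)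
  filter_upwards [nhdsWithin_le_nhds (Metric.ball_mem_nhds (0 : ℂ) (one_div_pos.mpr hp0)),
    self_mem_nhdsWithin] with w hw hw0
  obtain ⟨s, hs, rfl⟩ := exists_natCast_cpow_neg_eq hp.one_lt hw0 (mem_ball_zero_iff.mp hw)
  rw [← localFactor_eq_tsum_mul_pow]
  exact hα s hs

theorem map_one (hL : IsEntireEulerProduct A L d) : A 1 = 1 := by
  obtain ⟨α, hα⟩ := hL.local_polynomial 2 Nat.prime_two
  have := hL.prod_one_sub_mul_mul_tsum_eq_one Nat.prime_two hα (z := 0) (by simp)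
  rw [tsum_eq_single 0 fun k hk => by simp [hk]] at this
  simpa using this

theorem exists_norm_le_sqrt (hL : IsEntireEulerProduct A L d) {p : ℕ} (hp : p.Prime) :
    ∃ α : Fin d → ℂ, (∀ i, ‖α i‖ ≤ √p) ∧
      ∀ s : ℂ, 1 < s.re → eulerPoly α p s * localFactor A p s = 1 := by
  obtain ⟨α, hα⟩ := hL.local_polynomial p hp
  refine ⟨α, fun i => not_lt.mp fun hlt => ?_, hα⟩
  have hp0 : (0 : ℝ) < p := by exact_mod_cast hp.pos
  have hαi : α i ≠ 0 := norm_pos_iff.mp (lt_of_le_of_lt (by positivity) hlt)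
  -- otherwise `1 / αᵢ` lies in the disc where the product of the two factors is `1`
  have prod_eq_one := hL.prod_one_sub_mul_mul_tsum_eq_one hp hα (z := (α i)⁻¹) (by
    rw [norm_inv]; gcongr)
  have prod_eq_zero : ∏ j, (1 - α j * (α i)⁻¹) = 0 :=
    Finset.prod_eq_zero (Finset.mem_univ i) (by rw [mul_inv_cancel₀ hαi, sub_self])
  simp [prod_eq_zero] at prod_eq_one

end IsEntireEulerProduct

section CoprimeSeries

/-- The coefficients of `A` at the integers coprime to `m`. -/
noncomputable def coprimePart (A : ℕ → ℂ) (m k : ℕ) : ℂ := if k.Coprime m then A k else 0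

theorem coprimePart_of_coprime (A : ℕ → ℂ) {m k : ℕ} (h : k.Coprime m) :
    coprimePart A m k = A k := if_pos h

theorem coprimePart_of_not_coprime (A : ℕ → ℂ) {m k : ℕ} (h : ¬ k.Coprime m) :
    coprimePart A m k = 0 := if_neg h

theorem norm_coprimePart_le (A : ℕ → ℂ) (m k : ℕ) : ‖coprimePart A m k‖ ≤ ‖A k‖ := by
  unfold coprimePart
  split_ifs <;> simp

theorem coprimePart_mul {A : ℕ → ℂ} {a b : ℕ} (h : A (a * b) = A a * A b) (m : ℕ) :
    coprimePart A m (a * b) = coprimePart A m a * coprimePart A m b := by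
  simp only [coprimePart, Nat.coprime_mul_iff_left, h, ite_and]
  split_ifs <;> simp

theorem tsum_term_coprimePart_prime_pow {A : ℕ → ℂ} (h1 : A 1 = 1) {m : ℕ} (hm : m ≠ 0) {p : ℕ}
    (hp : p.Prime) (s : ℂ) : ∑' k, LSeries.term (coprimePart A m) s (p ^ k) =
      if p ∈ m.primeFactors then 1 else localFactor A p s := by
  split_ifs with hpm
  · rw [tsum_eq_single 0 fun k hk => ?_]
    · simp [LSeries.term, coprimePart, h1]
    · have : ¬ (p ^ k).Coprime m := by
        rw [Nat.coprime_pow_left_iff (Nat.pos_of_ne_zero hk), hp.coprime_iff_not_dvd, not_not]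
        exact Nat.dvd_of_mem_primeFactors hpm
      simp [LSeries.term, coprimePart_of_not_coprime A this]
  · have coprime : p.Coprime m :=
      hp.coprime_iff_not_dvd.mpr fun h => hpm (Nat.mem_primeFactors.mpr ⟨hp, h, hm⟩)
    rw [← tsum_term_prime_pow A hp]
    refine tsum_congr fun k => ?_
    simp only [LSeries.term, coprimePart_of_coprime A (coprime.pow_left k)]

theorem hasProd_ite_mem_primeFactors (m : ℕ) (q : ℕ → ℂ) :
    HasProd (fun p : Nat.Primes => if (p : ℕ) ∈ m.primeFactors then q p else 1)
      (∏ p ∈ m.primeFactors, q p) := by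
  have prod_eq : ∏ p ∈ m.primeFactors.subtype Nat.Prime,
      (if (p : ℕ) ∈ m.primeFactors then q p else 1) = ∏ p ∈ m.primeFactors, q p := by
    rw [← Finset.prod_subtype_of_mem q fun p hp => Nat.prime_of_mem_primeFactors hp]
    exact Finset.prod_congr rfl fun p hp => if_pos (Finset.mem_subtype.mp hp)
  rw [← prod_eq]
  exact hasProd_prod_of_ne_finset_one (f := fun p : Nat.Primes => if (p : ℕ) ∈ m.primeFactors
    then q p else 1) fun p hp => if_neg fun h => hp (Finset.mem_subtype.mpr h)

namespace IsEntireEulerProduct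

open Filter

variable {A : ℕ → ℂ} {L : ℂ → ℂ} {d : ℕ}

theorem lseries_multExtension_eq (hL : IsEntireEulerProduct A L d) {s : ℂ} (hs : 1 < s.re) :
    LSeries (multExtension A) s = LSeries A s := by
  have summable := lseriesSummable_multExtension hL.map_one (hL.lseriesSummable hs)
  have eulerProduct := EulerProduct.eulerProduct_hasProd (f := LSeries.term (multExtension A) s)
    (by simp [LSeries.term, multExtension_one])
    (fun h => LSeries_term_mul s (multExtension_mul h)) summable.norm (by simp)
  have localFactor_eq (p : Nat.Primes) :
      ∑' k, LSeries.term (multExtension A) s (p ^ k) = localFactor A p s := by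
    simp only [LSeries_term_multExtension_prime_pow hL.map_one s p.2, tsum_term_prime_pow A p.2]
  simp only [localFactor_eq] at eulerProduct
  rw [(hL.dirichlet_series s hs).LSeries_eq]
  exact eulerProduct.unique (hL.euler_product s hs)

theorem eq_multExtension (hL : IsEntireEulerProduct A L d) {n : ℕ} (hn : n ≠ 0) :
    A n = multExtension A n := by
  have summable := hL.lseriesSummable (s := 2) (by norm_num)
  refine LSeries.eq_of_LSeries_eventually_eq
    (summable.abscissaOfAbsConv_le.trans_lt (EReal.coe_lt_top _))
    ((lseriesSummable_multExtension hL.map_one summable).abscissaOfAbsConv_le.trans_lt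
      (EReal.coe_lt_top _)) ?_ hn
  filter_upwards [eventually_gt_atTop 1] with x hx
  exact (hL.lseries_multExtension_eq (by simpa using hx)).symm

theorem map_mul_of_coprime (hL : IsEntireEulerProduct A L d) {m n : ℕ} (h : m.Coprime n)
    (hm : m ≠ 0) (hn : n ≠ 0) : A (m * n) = A m * A n := by
  rw [hL.eq_multExtension (mul_ne_zero hm hn), hL.eq_multExtension hm, hL.eq_multExtension hn,
    multExtension_mul h]

theorem lseriesSummable_coprimePart (hL : IsEntireEulerProduct A L d) (m : ℕ) {s : ℂ}
    (hs : 1 < s.re) : LSeriesSummable (coprimePart A m) s :=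
  (hL.lseriesSummable hs).norm.of_norm_bounded fun k =>
    LSeries.norm_term_le s (norm_coprimePart_le A m k)

theorem hasSum_coprimePart (hL : IsEntireEulerProduct A L d) {m : ℕ} (hm : m ≠ 0)
    {α : ℕ → Fin d → ℂ}
    (hα : ∀ p : ℕ, p.Prime → ∀ s : ℂ, 1 < s.re → eulerPoly (α p) p s * localFactor A p s = 1)
    {s : ℂ} (hs : 1 < s.re) :
    LSeriesHasSum (coprimePart A m) s (L s * ∏ p ∈ m.primeFactors, eulerPoly (α p) p s) := by
  have summable := hL.lseriesSummable_coprimePart m hs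
  have map_mul {a b : ℕ} (hab : a.Coprime b) : LSeries.term (coprimePart A m) s (a * b) =
      LSeries.term (coprimePart A m) s a * LSeries.term (coprimePart A m) s b := by
    rcases eq_or_ne a 0 with rfl | ha
    · simp
    rcases eq_or_ne b 0 with rfl | hb
    · simp
    exact LSeries_term_mul s (coprimePart_mul (hL.map_mul_of_coprime hab ha hb) m)
  have eulerProduct := EulerProduct.eulerProduct_hasProd (f := LSeries.term (coprimePart A m) s)
    (by simp [LSeries.term, coprimePart, hL.map_one]) map_mul summable.norm (by simp)
  have localFactor_eq (p : Nat.Primes) : ∑' k, LSeries.term (coprimePart A m) s (p ^ k) =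
      localFactor A p s * if (p : ℕ) ∈ m.primeFactors then eulerPoly (α p) p s else 1 := by
    rw [tsum_term_coprimePart_prime_pow hL.map_one hm p.2]
    split_ifs
    · rw [mul_comm, hα p p.2 s hs]
    · rw [mul_one]
  simp only [localFactor_eq] at eulerProduct
  rw [← eulerProduct.unique ((hL.euler_product s hs).mul
    (hasProd_ite_mem_primeFactors m fun p => eulerPoly (α p) p s))]
  exact summable.LSeriesHasSum

theorem exists_hasSum_coprimePart (hL : IsEntireEulerProduct A L d) {m : ℕ} (hm : m ≠ 0) :
    ∃ g : ℂ → ℂ, Differentiable ℂ g ∧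
      (∀ s : ℂ, 1 / 2 ≤ s.re → ‖g s‖ ≤ 2 ^ (d * m.primeFactors.card)) ∧
      ∀ s : ℂ, 1 < s.re → LSeriesHasSum (coprimePart A m) s (L s * g s) := by
  choose! α norm_α_le hα using fun (p : ℕ) (hp : p.Prime) => hL.exists_norm_le_sqrt hp
  refine ⟨fun s => ∏ p ∈ m.primeFactors, eulerPoly (α p) p s, ?_, fun s hs => ?_,
    fun s hs => hL.hasSum_coprimePart hm hα hs⟩
  · exact Differentiable.fun_finsetProd fun p hp =>
      differentiable_eulerPoly (α p) (Nat.prime_of_mem_primeFactors hp).ne_zero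
  · rw [norm_prod, pow_mul, ← Finset.prod_const]
    refine Finset.prod_le_prod (fun _ _ => norm_nonneg _) fun p hp => ?_
    have hp := Nat.prime_of_mem_primeFactors hp
    exact norm_eulerPoly_le hp.pos (norm_α_le p hp) hs

end IsEntireEulerProduct

end CoprimeSeries

namespace IsEntireEulerProduct

open Filter

variable {A : ℕ → ℂ} {L : ℂ → ℂ} {d : ℕ}

theorem summable_norm_sq_div_rpow (hL : IsEntireEulerProduct A L d) {σ : ℝ} (hσ : 1 < σ) :
    Summable fun n : ℕ => ‖A n‖ ^ 2 / (n : ℝ) ^ σ := by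
  obtain ⟨C, hC⟩ := hL.rankin_selberg ((σ - 1) / 2) (by linarith)
  have summable : LSeriesSummable (fun n => ((‖A n‖ ^ 2 : ℝ) : ℂ)) (σ : ℂ) := by
    refine LSeriesSummable_of_sum_norm_bigO_and_nonneg (r := 1 + (σ - 1) / 2)
      (f := fun n => ‖A n‖ ^ 2) (Asymptotics.IsBigO.of_bound C ?_) (fun _ => by positivity)
      (by linarith) (by rw [Complex.ofReal_re]; linarith)
    filter_upwards [eventually_ge_atTop 1] with n hn
    rw [Real.norm_of_nonneg (Finset.sum_nonneg fun _ _ => by positivity),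
      Real.norm_of_nonneg (by positivity)]
    simpa using hC n (by exact_mod_cast hn)
  refine (summable_nat_add_iff 1).mp (((summable_nat_add_iff 1).mpr summable.norm).congr
    fun n => ?_)
  rw [LSeries.term_of_ne_zero n.succ_ne_zero, norm_div, Complex.norm_real,
    Real.norm_of_nonneg (by positivity), Complex.norm_natCast_cpow_of_pos n.succ_pos,
    Complex.ofReal_re]

theorem exists_sum_card_divisors_mul_norm_sq_div_le (hL : IsEntireEulerProduct A L d) {ε : ℝ}
    (hε : 0 < ε) : ∃ C : ℝ, 1 ≤ C ∧ ∀ N : ℕ, 1 ≤ N →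
      ∑ n ∈ Finset.Icc 1 N, (n.divisors.card : ℝ) * (‖A n‖ ^ 2 / n) ≤ C * (N : ℝ) ^ ε := by
  obtain ⟨C, hC, card_le⟩ := exists_card_divisors_le_mul_rpow (half_pos hε)
  have summable := hL.summable_norm_sq_div_rpow (σ := 1 + ε / 2) (by linarith)
  set S := ∑' n : ℕ, ‖A n‖ ^ 2 / (n : ℝ) ^ (1 + ε / 2)
  refine ⟨max 1 (C * S), le_max_left _ _, fun N hN => ?_⟩
  calc ∑ n ∈ Finset.Icc 1 N, (n.divisors.card : ℝ) * (‖A n‖ ^ 2 / n)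
      ≤ ∑ n ∈ Finset.Icc 1 N, C * (N : ℝ) ^ ε * (‖A n‖ ^ 2 / (n : ℝ) ^ (1 + ε / 2)) := by
        refine Finset.sum_le_sum fun n hn => ?_
        obtain ⟨one_le_n, n_le_N⟩ := Finset.mem_Icc.mp hn
        have hn0 : (0 : ℝ) < n := by exact_mod_cast one_le_n
        calc (n.divisors.card : ℝ) * (‖A n‖ ^ 2 / n)
            ≤ C * (n : ℝ) ^ (ε / 2) * (‖A n‖ ^ 2 / n) := by gcongr; exact card_le n (by omega)
          _ = C * (n : ℝ) ^ ε * (‖A n‖ ^ 2 / (n : ℝ) ^ (1 + ε / 2)) := by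
              rw [Real.rpow_add hn0, Real.rpow_one, ← add_halves ε, Real.rpow_add hn0, add_halves]
              field_simp
          _ ≤ C * (N : ℝ) ^ ε * (‖A n‖ ^ 2 / (n : ℝ) ^ (1 + ε / 2)) := by gcongr
    _ ≤ C * (N : ℝ) ^ ε * S := by
        rw [← Finset.mul_sum]
        gcongr
        exact summable.sum_le_tsum _ fun _ _ => by positivity
    _ = C * S * (N : ℝ) ^ ε := by ring
    _ ≤ max 1 (C * S) * (N : ℝ) ^ ε := by gcongr; exact le_max_right _ _

end IsEntireEulerProduct

section CauchyWeight

open MeasureTheory Complex FourierTransform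

theorem integral_cexp_mul_of_fourier_eq {f g : ℝ → ℂ} (hc : Continuous f) (hf : Integrable f)
    (hg : Integrable g) (h : ∀ w : ℝ, ∫ v : ℝ, cexp (-(w * v * I)) * f v = g w) (v : ℝ) :
    ∫ w : ℝ, cexp (w * v * I) * g w = 2 * Real.pi * f v := by
  have two_pi_ne : 2 * Real.pi ≠ 0 := by positivity
  have fourier_eq : 𝓕 f = fun w => g (w * (2 * Real.pi)) := by
    funext w
    rw [Real.fourier_real_eq_integral_exp_smul, ← h]
    refine integral_congr_ae (.of_forall fun x => ?_)
    simp only [smul_eq_mul]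
    congr 2
    push_cast; ring
  have inversion : ∫ w : ℝ, cexp ((w * (2 * Real.pi) : ℝ) * v * I) * g (w * (2 * Real.pi)) =
      f v := by
    have fourierInv_eq := congrFun (hc.fourierInv_fourier_eq hf
      (fourier_eq ▸ hg.comp_mul_right' two_pi_ne)) v
    rw [Real.fourierInv_eq', fourier_eq] at fourierInv_eq
    rw [← fourierInv_eq]
    refine integral_congr_ae (.of_forall fun w => ?_)
    simp only [smul_eq_mul, RCLike.inner_apply, conj_trivial]
    congr 2
    push_cast; ring
  have rescale := Measure.integral_comp_mul_right (fun w : ℝ => cexp (w * v * I) * g w)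
    (2 * Real.pi)
  rw [abs_of_pos (by positivity), real_smul, ofReal_inv, inversion] at rescale
  rw [rescale, ← ofReal_ofNat, ← ofReal_mul, mul_inv_cancel_left₀ (ofReal_ne_zero.mpr two_pi_ne)]

theorem cexp_mul_exp_neg_mul_abs_of_nonpos (a w : ℝ) {v : ℝ} (hv : v ≤ 0) :
    cexp (-(w * v * I)) * ((Real.exp (-a * |v|) : ℝ) : ℂ) = cexp ((a - w * I) * v) := by
  rw [abs_of_nonpos hv, ofReal_exp, ← Complex.exp_add]
  congr 1; push_cast; ring

theorem cexp_mul_exp_neg_mul_abs_of_nonneg (a w : ℝ) {v : ℝ} (hv : 0 ≤ v) :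
    cexp (-(w * v * I)) * ((Real.exp (-a * |v|) : ℝ) : ℂ) = cexp ((-a - w * I) * v) := by
  rw [abs_of_nonneg hv, ofReal_exp, ← Complex.exp_add]
  congr 1; push_cast; ring

variable {a : ℝ} (ha : 0 < a)
include ha

theorem integrable_cexp_mul_exp_neg_mul_abs (w : ℝ) :
    Integrable fun v : ℝ => cexp (-(w * v * I)) * ((Real.exp (-a * |v|) : ℝ) : ℂ) := by
  rw [← integrableOn_univ, ← Set.Iic_union_Ioi (a := (0 : ℝ))]
  refine IntegrableOn.union ?_ ?_
  · exact (integrableOn_exp_mul_complex_Iic (a := a - w * I) (by simpa using ha) 0).congr_fun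
      (fun v hv => (cexp_mul_exp_neg_mul_abs_of_nonpos a w hv).symm) measurableSet_Iic
  · exact (integrableOn_exp_mul_complex_Ioi (a := -a - w * I) (by simpa using ha) 0).congr_fun
      (fun v hv => (cexp_mul_exp_neg_mul_abs_of_nonneg a w (le_of_lt hv)).symm) measurableSet_Ioi

theorem integral_cexp_mul_exp_neg_mul_abs (w : ℝ) :
    ∫ v : ℝ, cexp (-(w * v * I)) * ((Real.exp (-a * |v|) : ℝ) : ℂ) =
      ((2 * a / (a ^ 2 + w ^ 2) : ℝ) : ℂ) := by
  have integrable := integrable_cexp_mul_exp_neg_mul_abs ha w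
  rw [← setIntegral_univ, ← Set.Iic_union_Ioi (a := (0 : ℝ)), setIntegral_union (by simp)
    measurableSet_Ioi integrable.integrableOn integrable.integrableOn,
    setIntegral_congr_fun measurableSet_Iic fun v hv => cexp_mul_exp_neg_mul_abs_of_nonpos a w hv,
    setIntegral_congr_fun measurableSet_Ioi
      fun v hv => cexp_mul_exp_neg_mul_abs_of_nonneg a w (le_of_lt hv),
    integral_exp_mul_complex_Iic (a := a - w * I) (by simpa using ha),
    integral_exp_mul_complex_Ioi (a := -a - w * I) (by simpa using ha),
    ofReal_zero, mul_zero, mul_zero, Complex.exp_zero, neg_div, ← div_neg]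
  have sub_ne : (a : ℂ) - w * I ≠ 0 := fun h => ha.ne' (by simpa using congrArg re h)
  have add_ne : (a : ℂ) + w * I ≠ 0 := fun h => ha.ne' (by simpa using congrArg re h)
  have mul_eq : ((a : ℂ) - w * I) * (a + w * I) = a ^ 2 + w ^ 2 := by
    ring_nf; rw [I_sq]; ring
  rw [show -(-(a : ℂ) - w * I) = a + w * I by ring, one_div_add_one_div sub_ne add_ne, mul_eq]
  push_cast
  ring

theorem integrable_inv_sq_add_sq : Integrable fun t : ℝ => 1 / (a ^ 2 + t ^ 2) := by
  refine ((integrable_inv_one_add_sq.comp_div ha.ne').const_mul (1 / a ^ 2)).congr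
    (.of_forall fun t => ?_)
  simp only
  field_simp

theorem integrable_div_sq_add_sq {f : ℝ → ℂ} (hf : Continuous f) {C : ℝ}
    (hC : ∀ t, ‖f t‖ ≤ C) : Integrable fun t : ℝ => f t / ((a ^ 2 + t ^ 2 : ℝ) : ℂ) := by
  refine ((integrable_inv_sq_add_sq ha).const_mul C).mono' ?_ (.of_forall fun t => ?_)
  · exact (hf.div (by fun_prop) fun t =>
      ofReal_ne_zero.mpr (by positivity)).aestronglyMeasurable
  · rw [norm_div, norm_real, Real.norm_of_nonneg (by positivity), mul_one_div]
    gcongr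
    exact hC t

theorem integral_cexp_div_sq_add_sq (y : ℝ) :
    ∫ t : ℝ, cexp (t * y * I) / ((a ^ 2 + t ^ 2 : ℝ) : ℂ) =
      ((Real.pi / a * Real.exp (-a * |y|) : ℝ) : ℂ) := by
  have integrable : Integrable fun w : ℝ => ((2 * a / (a ^ 2 + w ^ 2) : ℝ) : ℂ) := by
    exact (((integrable_inv_sq_add_sq ha).const_mul (2 * a)).congr
      (.of_forall fun w => mul_one_div _ _)).ofReal
  have inversion := integral_cexp_mul_of_fourier_eq
    (f := fun v => ((Real.exp (-a * |v|) : ℝ) : ℂ)) (by fun_prop)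
    (by simpa using integrable_cexp_mul_exp_neg_mul_abs ha 0) integrable
    (integral_cexp_mul_exp_neg_mul_abs ha) y
  have ha' : (a : ℂ) ≠ 0 := ofReal_ne_zero.mpr ha.ne'
  calc ∫ t : ℝ, cexp (t * y * I) / ((a ^ 2 + t ^ 2 : ℝ) : ℂ)
      = 1 / (2 * a) * ∫ t : ℝ, cexp (t * y * I) * ((2 * a / (a ^ 2 + t ^ 2) : ℝ) : ℂ) := by
        rw [← integral_const_mul]
        refine integral_congr_ae (.of_forall fun t => ?_)
        simp only
        push_cast
        field_simp
    _ = ((Real.pi / a * Real.exp (-a * |y|) : ℝ) : ℂ) := by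
        rw [inversion]
        push_cast
        field_simp

theorem integral_norm_sq_expPoly_div {ι : Type*} (s : Finset ι) (b : ι → ℂ) (l : ι → ℝ) :
    ((∫ t : ℝ, ‖∑ i ∈ s, b i * cexp (-(t * l i * I))‖ ^ 2 / (a ^ 2 + t ^ 2) : ℝ) : ℂ) =
      ∑ i ∈ s, ∑ j ∈ s, b i * (starRingEnd ℂ) (b j) *
        ((Real.pi / a * Real.exp (-a * |l i - l j|) : ℝ) : ℂ) := by
  have integrable (i j : ι) : Integrable fun t : ℝ => b i * (starRingEnd ℂ) (b j) *
      (cexp (t * (l j - l i : ℝ) * I) / ((a ^ 2 + t ^ 2 : ℝ) : ℂ)) := by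
    refine Integrable.const_mul (integrable_div_sq_add_sq ha (C := 1) (by fun_prop) fun t => ?_) _
    rw [← ofReal_mul, norm_exp_ofReal_mul_I]
  have expand (t : ℝ) :
      ((‖∑ i ∈ s, b i * cexp (-(t * l i * I))‖ ^ 2 / (a ^ 2 + t ^ 2) : ℝ) : ℂ) =
      ∑ i ∈ s, ∑ j ∈ s, b i * (starRingEnd ℂ) (b j) *
        (cexp (t * (l j - l i : ℝ) * I) / ((a ^ 2 + t ^ 2 : ℝ) : ℂ)) := by
    rw [ofReal_div, ofReal_pow, ← mul_conj', map_sum, Finset.sum_mul_sum]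
    simp only [Finset.sum_div]
    refine Finset.sum_congr rfl fun i _ => Finset.sum_congr rfl fun j _ => ?_
    have exp_eq : cexp (t * (l j - l i : ℝ) * I) =
        cexp (-(t * l i * I)) * (starRingEnd ℂ) (cexp (-(t * l j * I))) := by
      rw [← exp_conj, ← Complex.exp_add]
      simp only [map_neg, map_mul, conj_ofReal, conj_I]
      congr 1; push_cast; ring
    rw [map_mul, exp_eq]
    ring
  rw [← integral_complex_ofReal]
  simp_rw [expand]
  rw [integral_finsetSum _ fun i _ => integrable_finsetSum _ fun j _ => integrable i j]
  refine Finset.sum_congr rfl fun i _ => ?_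
  rw [integral_finsetSum _ fun j _ => integrable i j]
  refine Finset.sum_congr rfl fun j _ => ?_
  rw [integral_const_mul, integral_cexp_div_sq_add_sq ha, abs_sub_comm]

end CauchyWeight

section MeanValue

open MeasureTheory Complex

variable {r : ℝ} (hr : 0 < r)
include hr

theorem sum_exp_neg_mul_Icc_le (n : ℕ) :
    ∑ h ∈ Finset.Icc 1 n, Real.exp (-r * h) ≤ 1 / r := by
  suffices key : ∑ h ∈ Finset.Icc 1 n, Real.exp (-r * h) ≤ (1 - Real.exp (-r * n)) / r from
    key.trans (by gcongr; linarith [Real.exp_pos (-r * n)])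
  induction n with
  | zero => simp
  | succ n ih =>
    have exp_eq : Real.exp (-r * n) = Real.exp (-r * (n + 1 : ℕ)) * Real.exp r := by
      rw [← Real.exp_add]; congr 1; push_cast; ring
    rw [Finset.sum_Icc_succ_top (by omega)]
    calc _ ≤ (1 - Real.exp (-r * n)) / r + Real.exp (-r * (n + 1 : ℕ)) := by gcongr
      _ ≤ (1 - Real.exp (-r * (n + 1 : ℕ))) / r := by
        rw [div_add' _ _ _ hr.ne', exp_eq]
        gcongr
        nlinarith [Real.add_one_le_exp r, Real.exp_pos (-r * (n + 1 : ℕ))]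

theorem sum_exp_neg_mul_le_of_injOn {ι : Type*} (S : Finset ι) (f : ι → ℝ) (g : ι → ℕ)
    (hg : Set.InjOn g S) (h0 : ∀ i ∈ S, g i ≠ 0) (hf : ∀ i ∈ S, f i = g i) :
    ∑ i ∈ S, Real.exp (-r * f i) ≤ 1 / r := by
  classical
  calc ∑ i ∈ S, Real.exp (-r * f i) = ∑ h ∈ S.image g, Real.exp (-r * h) := by
        rw [Finset.sum_image hg]
        exact Finset.sum_congr rfl fun i hi => by rw [hf i hi]
    _ ≤ ∑ h ∈ Finset.Icc 1 (S.sup g), Real.exp (-r * h) := by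
        refine Finset.sum_le_sum_of_subset_of_nonneg (fun h hh => ?_) fun _ _ _ => by positivity
        obtain ⟨i, hi, rfl⟩ := Finset.mem_image.mp hh
        exact Finset.mem_Icc.mpr ⟨Nat.pos_of_ne_zero (h0 i hi), Finset.le_sup hi⟩
    _ ≤ 1 / r := sum_exp_neg_mul_Icc_le hr _

theorem sum_exp_neg_mul_abs_sub_le (S : Finset ℕ) (m : ℕ) :
    ∑ n ∈ S, Real.exp (-r * |(m : ℝ) - n|) ≤ 1 + 2 / r := by
  have above : ∑ n ∈ S with m < n, Real.exp (-r * |(m : ℝ) - n|) ≤ 1 / r := by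
    refine sum_exp_neg_mul_le_of_injOn hr _ _ (fun n => n - m) (fun a ha b hb hab => ?_)
      (fun n hn => ?_) fun n hn => ?_
    · simp only [Finset.coe_filter, Set.mem_ofPred_eq] at ha hb hab; omega
    · have := (Finset.mem_filter.mp hn).2; omega
    · have hn := (Finset.mem_filter.mp hn).2.le
      rw [Nat.cast_sub hn, abs_sub_comm, abs_of_nonneg (sub_nonneg.mpr (Nat.cast_le.mpr hn))]
  have below : ∑ n ∈ S with n < m, Real.exp (-r * |(m : ℝ) - n|) ≤ 1 / r := by
    refine sum_exp_neg_mul_le_of_injOn hr _ _ (fun n => m - n) (fun a ha b hb hab => ?_)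
      (fun n hn => ?_) fun n hn => ?_
    · simp only [Finset.coe_filter, Set.mem_ofPred_eq] at ha hb hab; omega
    · have := (Finset.mem_filter.mp hn).2; omega
    · have hn := (Finset.mem_filter.mp hn).2.le
      rw [Nat.cast_sub hn, abs_of_nonneg (sub_nonneg.mpr (Nat.cast_le.mpr hn))]
  have diagonal : ∑ n ∈ S with n = m, Real.exp (-r * |(m : ℝ) - n|) ≤ 1 := by
    rw [Finset.sum_filter, Finset.sum_ite_eq']
    split_ifs <;> simp
  have split : ∑ n ∈ S, Real.exp (-r * |(m : ℝ) - n|) =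
      ∑ n ∈ S with m < n, Real.exp (-r * |(m : ℝ) - n|) +
      (∑ n ∈ S with n < m, Real.exp (-r * |(m : ℝ) - n|) +
        ∑ n ∈ S with n = m, Real.exp (-r * |(m : ℝ) - n|)) := by
    simp only [Finset.sum_filter, ← Finset.sum_add_distrib]
    refine Finset.sum_congr rfl fun n _ => ?_
    rcases lt_trichotomy n m with h | rfl | h
    · simp [h, h.not_gt, h.ne]
    · simp
    · simp [h, h.not_gt, h.ne']
  calc _ ≤ 1 / r + (1 / r + 1) := by rw [split]; gcongr
    _ = 1 + 2 / r := by ring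

omit hr in
theorem abs_sub_div_le_abs_log_sub_log {x y N : ℝ} (hx : 0 < x) (hy : 0 < y) (hxN : x ≤ N)
    (hyN : y ≤ N) : |x - y| / N ≤ |Real.log x - Real.log y| := by
  wlog h : y ≤ x generalizing x y
  · rw [abs_sub_comm, abs_sub_comm (Real.log x)]
    exact this hy hx hyN hxN (le_of_not_ge h)
  rw [abs_of_nonneg (by linarith), abs_of_nonneg (by linarith [Real.log_le_log hy h]),
    ← Real.log_div hx.ne' hy.ne']
  calc (x - y) / N ≤ (x - y) / x := div_le_div_of_nonneg_left (by linarith) hx hxN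
    _ = 1 - (x / y)⁻¹ := by rw [inv_div]; field_simp
    _ ≤ Real.log (x / y) := Real.one_sub_inv_le_log_of_pos (by positivity)

theorem sum_exp_neg_mul_abs_log_sub_log_le {ι : Type*} (s : Finset ι) (ν : ι → ℕ) {N : ℕ}
    (hν : ∀ i ∈ s, 1 ≤ ν i ∧ ν i ≤ N) {D : ℝ}
    (hD : ∀ n ∈ Finset.Icc 1 N, ((s.filter fun i => ν i = n).card : ℝ) ≤ D) {i : ι} (hi : i ∈ s) :
    ∑ j ∈ s, Real.exp (-r * |Real.log (ν i) - Real.log (ν j)|) ≤ D * (1 + 2 * N / r) := by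
  have one_le_N : 1 ≤ N := (hν i hi).1.trans (hν i hi).2
  have hN : (0 : ℝ) < N := by exact_mod_cast one_le_N
  have hD0 : 0 ≤ D := (Nat.cast_nonneg _).trans (hD 1 (Finset.mem_Icc.mpr ⟨le_rfl, one_le_N⟩))
  have cast_bounds {j : ι} (hj : j ∈ s) : (0 : ℝ) < ν j ∧ (ν j : ℝ) ≤ N :=
    ⟨Nat.cast_pos.mpr (hν j hj).1, Nat.cast_le.mpr (hν j hj).2⟩
  calc ∑ j ∈ s, Real.exp (-r * |Real.log (ν i) - Real.log (ν j)|)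
      ≤ ∑ j ∈ s, Real.exp (-(r / N) * |(ν i : ℝ) - ν j|) := by
        refine Finset.sum_le_sum fun j hj => Real.exp_le_exp.mpr ?_
        have log_gap := abs_sub_div_le_abs_log_sub_log (cast_bounds hi).1 (cast_bounds hj).1
          (cast_bounds hi).2 (cast_bounds hj).2
        calc -r * |Real.log (ν i) - Real.log (ν j)| ≤ -r * (|(ν i : ℝ) - ν j| / N) := by
              rw [neg_mul, neg_mul]; gcongr
          _ = -(r / N) * |(ν i : ℝ) - ν j| := by ring
    _ = ∑ n ∈ Finset.Icc 1 N, ∑ j ∈ s with ν j = n,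
          Real.exp (-(r / N) * |(ν i : ℝ) - ν j|) :=
        (Finset.sum_fiberwise_of_maps_to (fun j hj => Finset.mem_Icc.mpr (hν j hj)) _).symm
    _ ≤ ∑ n ∈ Finset.Icc 1 N, D * Real.exp (-(r / N) * |(ν i : ℝ) - n|) := by
        refine Finset.sum_le_sum fun n hn => ?_
        rw [Finset.sum_congr rfl fun j hj => by rw [(Finset.mem_filter.mp hj).2],
          Finset.sum_const, nsmul_eq_mul]
        gcongr
        exact hD n hn
    _ ≤ D * (1 + 2 / (r / N)) := by
        rw [← Finset.mul_sum]
        gcongr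
        exact sum_exp_neg_mul_abs_sub_le (div_pos hr hN) _ (ν i)
    _ = D * (1 + 2 * N / r) := by rw [div_div_eq_mul_div]

omit hr in
theorem sum_sum_norm_mul_norm_mul_le {ι : Type*} (s : Finset ι) (b : ι → ℂ) {E : ι → ι → ℝ}
    (hE : ∀ i j, 0 ≤ E i j) (symm : ∀ i j, E i j = E j i) {B : ℝ}
    (hB : ∀ i ∈ s, ∑ j ∈ s, E i j ≤ B) :
    ∑ i ∈ s, ∑ j ∈ s, ‖b i‖ * ‖b j‖ * E i j ≤ B * ∑ i ∈ s, ‖b i‖ ^ 2 := by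
  have swap : ∑ i ∈ s, ∑ j ∈ s, ‖b j‖ ^ 2 * E i j = ∑ i ∈ s, ∑ j ∈ s, ‖b i‖ ^ 2 * E i j := by
    rw [Finset.sum_comm]
    simp_rw [symm]
  calc ∑ i ∈ s, ∑ j ∈ s, ‖b i‖ * ‖b j‖ * E i j
      ≤ ∑ i ∈ s, ∑ j ∈ s, (‖b i‖ ^ 2 * E i j + ‖b j‖ ^ 2 * E i j) / 2 := by
        gcongr with i _ j _
        nlinarith [mul_nonneg (sq_nonneg (‖b i‖ - ‖b j‖)) (hE i j)]
    _ = ∑ i ∈ s, ‖b i‖ ^ 2 * ∑ j ∈ s, E i j := by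
        simp_rw [← Finset.sum_div, Finset.sum_add_distrib, swap, add_self_div_two, Finset.mul_sum]
    _ ≤ ∑ i ∈ s, ‖b i‖ ^ 2 * B := by gcongr with i hi; exact hB i hi
    _ = B * ∑ i ∈ s, ‖b i‖ ^ 2 := by rw [← Finset.sum_mul, mul_comm]

theorem integral_norm_sq_dirichletPoly_div_le {ι : Type*} (s : Finset ι) (b : ι → ℂ) (ν : ι → ℕ)
    {N : ℕ} (hν : ∀ i ∈ s, 1 ≤ ν i ∧ ν i ≤ N) {D : ℝ}
    (hD : ∀ n ∈ Finset.Icc 1 N, ((s.filter fun i => ν i = n).card : ℝ) ≤ D) :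
    ∫ t : ℝ, ‖∑ i ∈ s, b i * cexp (-(t * Real.log (ν i) * I))‖ ^ 2 / (r ^ 2 + t ^ 2) ≤
      Real.pi / r * (D * (1 + 2 * N / r)) * ∑ i ∈ s, ‖b i‖ ^ 2 := by
  calc _ ≤ ‖((∫ t : ℝ, ‖∑ i ∈ s, b i * cexp (-(t * Real.log (ν i) * I))‖ ^ 2 /
          (r ^ 2 + t ^ 2) : ℝ) : ℂ)‖ := by rw [norm_real]; exact Real.le_norm_self _
    _ ≤ ∑ i ∈ s, ∑ j ∈ s, ‖b i * (starRingEnd ℂ) (b j) *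
          ((Real.pi / r * Real.exp (-r * |Real.log (ν i) - Real.log (ν j)|) : ℝ) : ℂ)‖ := by
        rw [integral_norm_sq_expPoly_div hr s b fun i => Real.log (ν i)]
        exact (norm_sum_le _ _).trans (Finset.sum_le_sum fun i _ => norm_sum_le _ _)
    _ = Real.pi / r * ∑ i ∈ s, ∑ j ∈ s, ‖b i‖ * ‖b j‖ *
          Real.exp (-r * |Real.log (ν i) - Real.log (ν j)|) := by
        simp only [Finset.mul_sum]
        refine Finset.sum_congr rfl fun i _ => Finset.sum_congr rfl fun j _ => ?_
        rw [norm_mul, norm_mul, RCLike.norm_conj, norm_real, Real.norm_of_nonneg (by positivity)]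
        ring
    _ ≤ Real.pi / r * (D * (1 + 2 * N / r) * ∑ i ∈ s, ‖b i‖ ^ 2) := by
        gcongr
        exact sum_sum_norm_mul_norm_mul_le s b (fun _ _ => by positivity)
          (fun i j => by rw [abs_sub_comm])
          fun i hi => sum_exp_neg_mul_abs_log_sub_log_le hr s ν hν hD hi
    _ = _ := by ring

end MeanValue

section TruncatedPowers

open MeasureTheory Complex

/-- The truncated power `(ν / y) ^ c` for `ν ≤ y`, and `0` for `y < ν`. It plays the role of the
indicator function of `ν ≤ y` in Perron's formula. -/
noncomputable def truncPow (c ν y : ℝ) : ℝ := if ν ≤ y then (ν / y) ^ c else 0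

theorem truncPow_of_le (c : ℝ) {ν y : ℝ} (h : ν ≤ y) : truncPow c ν y = (ν / y) ^ c := if_pos h

theorem truncPow_of_lt (c : ℝ) {ν y : ℝ} (h : y < ν) : truncPow c ν y = 0 := if_neg h.not_ge

theorem measurable_truncPow (c ν : ℝ) : Measurable (truncPow c ν) := by
  unfold truncPow
  exact Measurable.ite measurableSet_Ici (by fun_prop) measurable_const

theorem truncPow_nonneg (c : ℝ) {ν : ℝ} (hν : 0 < ν) (y : ℝ) : 0 ≤ truncPow c ν y := by
  rcases le_or_gt ν y with h | h
  · rw [truncPow_of_le c h]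
    exact Real.rpow_nonneg (div_nonneg hν.le (hν.le.trans h)) c
  · rw [truncPow_of_lt c h]

variable {c : ℝ} (hc : 0 < c)
include hc

theorem truncPow_le_one {ν : ℝ} (hν : 0 < ν) (y : ℝ) : truncPow c ν y ≤ 1 := by
  rcases le_or_gt ν y with h | h
  · rw [truncPow_of_le c h]
    have hy : 0 < y := hν.trans_le h
    exact Real.rpow_le_one (by positivity) ((div_le_one hy).mpr h) hc.le
  · rw [truncPow_of_lt c h]
    exact zero_le_one

theorem integral_div_rpow_div {ν a b : ℝ} (hν : 0 < ν) (ha : 0 < a) (hab : a ≤ b) :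
    ∫ y in a..b, (ν / y) ^ c / y = ((ν / a) ^ c - (ν / b) ^ c) / c := by
  have pos {y : ℝ} (hy : y ∈ Set.uIcc a b) : 0 < y := by
    rw [Set.uIcc_of_le hab] at hy; exact ha.trans_le hy.1
  have primitive : ∀ y ∈ Set.uIcc a b,
      HasDerivAt (fun y => -(ν / y) ^ c / c) ((ν / y) ^ c / y) y := by
    intro y hy
    have hy := pos hy
    have deriv_div : HasDerivAt (fun y => ν / y) (-ν / y ^ 2) y := by
      simpa using (hasDerivAt_const y ν).fun_div (hasDerivAt_id y) hy.ne'
    refine (((deriv_div.rpow_const (p := c)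
      (.inl (div_pos hν hy).ne')).neg).div_const c).congr_deriv ?_
    rw [Real.rpow_sub_one (div_pos hν hy).ne']
    field_simp
  rw [intervalIntegral.integral_eq_sub_of_hasDerivAt primitive]
  · ring
  · refine ContinuousOn.intervalIntegrable fun y hy => ContinuousAt.continuousWithinAt ?_
    have hy := pos hy
    exact ((continuousAt_const.div continuousAt_id hy.ne').rpow_const
      (.inl (div_pos hν hy).ne')).div continuousAt_id hy.ne'

theorem intervalIntegrable_truncPow_div {ν x y : ℝ} (hν : 0 < ν) (hx : 0 < x) (hxy : x ≤ y) :
    IntervalIntegrable (fun u => truncPow c ν u / u) volume x y := by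
  rw [intervalIntegrable_iff_integrableOn_Ioc_of_le hxy]
  refine Measure.integrableOn_of_bounded (M := 1 / x) (by simp) ?_ ?_
  · exact ((measurable_truncPow c ν).div measurable_id).aestronglyMeasurable
  · filter_upwards [ae_restrict_mem measurableSet_Ioc] with u hu
    rw [Real.norm_of_nonneg (div_nonneg (truncPow_nonneg c hν u) (hx.trans hu.1).le)]
    exact div_le_div₀ zero_le_one (truncPow_le_one hc hν u) hx hu.1.le

theorem integral_truncPow_div_of_le {ν a b : ℝ} (hν : 0 < ν) (hνa : ν ≤ a) (hab : a ≤ b) :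
    ∫ y in a..b, truncPow c ν y / y = ((ν / a) ^ c - (ν / b) ^ c) / c := by
  rw [← integral_div_rpow_div hc hν (hν.trans_le hνa) hab]
  refine intervalIntegral.integral_congr fun y hy => ?_
  rw [Set.uIcc_of_le hab] at hy
  simp only [truncPow_of_le c (hνa.trans hy.1)]

omit hc in
theorem integral_truncPow_div_eq_zero {ν a b : ℝ} (hab : a ≤ b) (hbν : b ≤ ν) :
    ∫ y in a..b, truncPow c ν y / y = 0 := by
  rw [intervalIntegral.integral_of_le hab, integral_Ioc_eq_integral_Ioo]
  refine setIntegral_eq_zero_of_forall_eq_zero fun y hy => ?_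
  rw [truncPow_of_lt c (hy.2.trans_le hbν), zero_div]

theorem indicator_eq_truncPow {ν x H : ℝ} (hν : 0 < ν) (hx : 0 < x) (hH : 0 ≤ H) :
    (if x < ν ∧ ν ≤ x + H then (1 : ℝ) else 0) =
      truncPow c ν (x + H) - truncPow c ν x + c * ∫ y in x..x + H, truncPow c ν y / y := by
  have hle : x ≤ x + H := by linarith
  rcases le_or_gt ν x with h | hxν
  · rw [integral_truncPow_div_of_le hc hν h hle, if_neg (by simp [h]),
      truncPow_of_le c (h.trans hle), truncPow_of_le c h]
    field_simp; ring
  rcases le_or_gt ν (x + H) with hνx | h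
  · rw [← intervalIntegral.integral_add_adjacent_intervals
      (intervalIntegrable_truncPow_div hc hν hx hxν.le)
      (intervalIntegrable_truncPow_div hc hν hν hνx),
      integral_truncPow_div_eq_zero hxν.le le_rfl, integral_truncPow_div_of_le hc hν le_rfl hνx,
      if_pos ⟨hxν, hνx⟩, truncPow_of_le c hνx, truncPow_of_lt c hxν, div_self hν.ne',
      Real.one_rpow]
    field_simp; ring
  · rw [integral_truncPow_div_eq_zero hle h.le, if_neg (by simp [h]), truncPow_of_lt c h,
      truncPow_of_lt c hxν]
    ring

omit hc in
theorem truncPow_mul_truncPow_div_sq_eqOn {ν μ : ℝ} (hμ : 0 < μ) (h : μ ≤ ν) :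
    Set.EqOn (fun y => truncPow c ν y * truncPow c μ y / y ^ 2)
      (Set.indicator (Set.Ici ν) fun y => (ν * μ) ^ c * y ^ (-2 * c - 2)) (Set.Ioi 0) := by
  have hν : 0 < ν := hμ.trans_le h
  intro y (hy : 0 < y)
  rcases le_or_gt ν y with hνy | hyν
  · rw [Set.indicator_of_mem (by exact hνy)]
    simp only [truncPow_of_le c hνy, truncPow_of_le c (h.trans hνy)]
    rw [Real.div_rpow hν.le hy.le, Real.div_rpow hμ.le hy.le, Real.mul_rpow hν.le hμ.le,
      Real.rpow_sub hy, neg_mul, Real.rpow_neg hy.le, two_mul, Real.rpow_add hy, Real.rpow_two]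
    field_simp
  · rw [Set.indicator_of_notMem (by exact hyν.not_ge)]
    simp only [truncPow_of_lt c hyν, zero_mul, zero_div]

theorem integrableOn_truncPow_mul {ν μ : ℝ} (hν : 0 < ν) (hμ : 0 < μ) :
    IntegrableOn (fun y => truncPow c ν y * truncPow c μ y / y ^ 2) (Set.Ioi 0) := by
  wlog h : μ ≤ ν generalizing ν μ
  · simp_rw [mul_comm (truncPow c ν _)]
    exact this hμ hν (le_of_not_ge h)
  rw [integrableOn_congr_fun (truncPow_mul_truncPow_div_sq_eqOn hμ h) measurableSet_Ioi]
  refine Integrable.integrableOn ?_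
  rw [integrable_indicator_iff measurableSet_Ici, integrableOn_Ici_iff_integrableOn_Ioi]
  exact (integrableOn_Ioi_rpow_of_lt (by linarith) hν).const_mul _

theorem integral_truncPow_mul {ν μ : ℝ} (hν : 0 < ν) (hμ : 0 < μ) :
    ∫ y in Set.Ioi 0, truncPow c ν y * truncPow c μ y / y ^ 2 = (√ν)⁻¹ * (√μ)⁻¹ *
        (Real.exp (-(c + 1 / 2) * |Real.log ν - Real.log μ|) / (2 * (c + 1 / 2))) := by
  wlog h : μ ≤ ν generalizing ν μ
  · simp_rw [mul_comm (truncPow c ν _)]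
    rw [abs_sub_comm, mul_comm (√ν)⁻¹]
    exact this hμ hν (le_of_not_ge h)
  rw [setIntegral_congr_fun measurableSet_Ioi (truncPow_mul_truncPow_div_sq_eqOn hμ h),
    setIntegral_indicator measurableSet_Ici,
    Set.inter_eq_self_of_subset_right (Set.Ici_subset_Ioi.mpr hν), integral_Ici_eq_integral_Ioi,
    integral_const_mul, integral_Ioi_rpow_of_lt (by linarith) hν,
    show -2 * c - 2 + 1 = -(2 * (c + 1 / 2)) by ring, neg_div_neg_eq,
    abs_of_nonneg (by linarith [Real.log_le_log hμ h]), Real.mul_rpow hν.le hμ.le,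
    Real.sqrt_eq_rpow, Real.sqrt_eq_rpow]
  simp only [Real.rpow_def_of_pos hν, Real.rpow_def_of_pos hμ, ← Real.exp_neg, ← Real.exp_add,
    ← mul_div_assoc]
  congr 2
  ring

end TruncatedPowers

section TruncatedSums

open MeasureTheory Complex

variable {ι : Type*} {c : ℝ} {s : Finset ι} {ν : ι → ℝ} {β : ι → ℂ}

/-- The sum of the `β i` weighted by the truncated powers of the frequencies `ν i`: a substitute
for the summatory function `∑_{ν i ≤ y} β i` that decays at infinity. -/
noncomputable def truncSum (c : ℝ) (s : Finset ι) (ν : ι → ℝ) (β : ι → ℂ) (y : ℝ) : ℂ :=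
  ∑ i ∈ s, β i * (truncPow c (ν i) y : ℂ)

/-- The density `|G y|² / y²` of `G = truncSum c s ν β`, extended by zero to `y ≤ 0`. Its total
mass is a mean value of an exponential polynomial by Parseval's formula. -/
noncomputable def truncDensity (c : ℝ) (s : Finset ι) (ν : ι → ℝ) (β : ι → ℂ) : ℝ → ℝ :=
  (Set.Ioi 0).indicator fun y => ‖truncSum c s ν β y‖ ^ 2 / y ^ 2

theorem measurable_truncSum (c : ℝ) (s : Finset ι) (ν : ι → ℝ) (β : ι → ℂ) :
    Measurable (truncSum c s ν β) :=
  Finset.measurable_fun_sum _ fun i _ =>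
    (Complex.measurable_ofReal.comp (measurable_truncPow c (ν i))).const_mul _

theorem norm_truncSum_le (hν : ∀ i ∈ s, 0 < ν i) (hc : 0 < c) (β : ι → ℂ) (y : ℝ) :
    ‖truncSum c s ν β y‖ ≤ ∑ i ∈ s, ‖β i‖ := by
  refine (norm_sum_le _ _).trans (Finset.sum_le_sum fun i hi => ?_)
  rw [norm_mul, norm_real, Real.norm_of_nonneg (truncPow_nonneg c (hν i hi) y)]
  exact mul_le_of_le_one_right (norm_nonneg _) (truncPow_le_one hc (hν i hi) y)

theorem truncDensity_nonneg (c : ℝ) (s : Finset ι) (ν : ι → ℝ) (β : ι → ℂ) (y : ℝ) :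
    0 ≤ truncDensity c s ν β y :=
  Set.indicator_nonneg (fun _ _ => by positivity) y

theorem truncDensity_of_pos {y : ℝ} (hy : 0 < y) :
    truncDensity c s ν β y = (‖truncSum c s ν β y‖ / y) ^ 2 := by
  rw [div_pow]
  exact Set.indicator_of_mem (Set.mem_Ioi.mpr hy) _

theorem ofReal_norm_sum_mul_ofReal_sq (s : Finset ι) (β : ι → ℂ) (τ : ι → ℝ) :
    ((‖∑ i ∈ s, β i * (τ i : ℂ)‖ ^ 2 : ℝ) : ℂ) =
      ∑ i ∈ s, ∑ j ∈ s, β i * (starRingEnd ℂ) (β j) * ((τ i * τ j : ℝ) : ℂ) := by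
  rw [ofReal_pow, ← mul_conj', map_sum, Finset.sum_mul_sum]
  refine Finset.sum_congr rfl fun i _ => Finset.sum_congr rfl fun j _ => ?_
  rw [map_mul, conj_ofReal]
  push_cast; ring

theorem ofReal_norm_truncSum_sq_div (c : ℝ) (s : Finset ι) (ν : ι → ℝ) (β : ι → ℂ) (y : ℝ) :
    ((‖truncSum c s ν β y‖ ^ 2 / y ^ 2 : ℝ) : ℂ) = ∑ i ∈ s, ∑ j ∈ s, β i * (starRingEnd ℂ) (β j) *
      ((truncPow c (ν i) y * truncPow c (ν j) y / y ^ 2 : ℝ) : ℂ) := by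
  rw [ofReal_div, truncSum, ofReal_norm_sum_mul_ofReal_sq]
  simp only [Finset.sum_div]
  refine Finset.sum_congr rfl fun i _ => Finset.sum_congr rfl fun j _ => ?_
  push_cast; ring

section Parseval

variable (hν : ∀ i ∈ s, 0 < ν i) (hc : 0 < c)
include hν hc

theorem integrableOn_mul_ofReal_truncPow_mul (β : ι → ℂ) {i j : ι} (hi : i ∈ s) (hj : j ∈ s) :
    IntegrableOn (fun y => β i * (starRingEnd ℂ) (β j) *
      ((truncPow c (ν i) y * truncPow c (ν j) y / y ^ 2 : ℝ) : ℂ)) (Set.Ioi 0) :=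
  ((integrableOn_truncPow_mul hc (hν i hi) (hν j hj)).ofReal (𝕜 := ℂ)).const_mul _

theorem integrable_truncDensity (β : ι → ℂ) : Integrable (truncDensity c s ν β) := by
  refine (integrable_indicator_iff measurableSet_Ioi).mpr ?_
  have : IntegrableOn (fun y => ((‖truncSum c s ν β y‖ ^ 2 / y ^ 2 : ℝ) : ℂ)) (Set.Ioi 0) := by
    simp_rw [ofReal_norm_truncSum_sq_div]
    exact integrable_finsetSum _ fun i hi => integrable_finsetSum _ fun j hj =>
      integrableOn_mul_ofReal_truncPow_mul hν hc β hi hj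
  exact this.re.congr (.of_forall fun y => ofReal_re _)

theorem integral_truncDensity (β : ι → ℂ) :
    ∫ y, truncDensity c s ν β y = 1 / (2 * Real.pi) * ∫ t : ℝ, ‖∑ i ∈ s, β i * ((√(ν i))⁻¹ : ℝ) *
        cexp (-(t * Real.log (ν i) * I))‖ ^ 2 / ((c + 1 / 2) ^ 2 + t ^ 2) := by
  rw [truncDensity, integral_indicator measurableSet_Ioi, ← ofReal_inj, ofReal_mul,
    integral_norm_sq_expPoly_div (by positivity) s (fun i => β i * ((√(ν i))⁻¹ : ℝ))
      fun i => Real.log (ν i), ← integral_complex_ofReal]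
  simp_rw [ofReal_norm_truncSum_sq_div]
  rw [integral_finsetSum _ fun i hi => integrable_finsetSum _ fun j hj =>
    integrableOn_mul_ofReal_truncPow_mul hν hc β hi hj, Finset.mul_sum]
  refine Finset.sum_congr rfl fun i hi => ?_
  rw [integral_finsetSum _ fun j hj => integrableOn_mul_ofReal_truncPow_mul hν hc β hi hj,
    Finset.mul_sum]
  refine Finset.sum_congr rfl fun j hj => ?_
  rw [integral_const_mul, integral_complex_ofReal, integral_truncPow_mul hc (hν i hi) (hν j hj),
    map_mul, conj_ofReal]
  have pi_ne : (Real.pi : ℂ) ≠ 0 := ofReal_ne_zero.mpr Real.pi_ne_zero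
  simp only [ofReal_mul, ofReal_div, ofReal_one, ofReal_ofNat]
  field_simp

end Parseval

end TruncatedSums

section SlidingWindow

open MeasureTheory

theorem sq_intervalIntegral_le {f : ℝ → ℝ} {a b : ℝ} (hab : a < b)
    (hf : IntervalIntegrable f volume a b)
    (hf2 : IntervalIntegrable (fun x => f x ^ 2) volume a b) :
    (∫ x in a..b, f x) ^ 2 ≤ (b - a) * ∫ x in a..b, f x ^ 2 := by
  rw [intervalIntegrable_iff_integrableOn_Ioc_of_le hab.le] at hf hf2
  have jensen := (even_two.convexOn_pow (𝕜 := ℝ)).map_set_average_le (t := Set.Ioc a b)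
    (μ := volume) (by fun_prop) isClosed_univ (by simp [hab]) (by simp) (by simp) hf hf2
  rw [← Set.uIoc_of_le hab.le, interval_average_eq_div, interval_average_eq_div, div_pow,
    div_le_div_iff₀ (by nlinarith) (by linarith)] at jensen
  nlinarith

variable {q : ℝ → ℝ} (hq : Integrable q)
include hq

theorem continuous_integral_sliding_window (H : ℝ) :
    Continuous fun x => ∫ y in x..x + H, q y := by
  have integrable (a b : ℝ) : IntervalIntegrable q volume a b := hq.intervalIntegrable
  have primitive := intervalIntegral.continuous_primitive (μ := volume) integrable 0
  simp_rw [← fun x => intervalIntegral.integral_interval_sub_left (integrable 0 (x + H))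
    (integrable 0 x)]
  exact (primitive.comp (continuous_add_const H)).sub primitive

variable (hq0 : ∀ y, 0 ≤ q y)
include hq0

theorem intervalIntegral_le_integral {a b : ℝ} (hab : a ≤ b) :
    ∫ y in a..b, q y ≤ ∫ y, q y := by
  rw [intervalIntegral.integral_of_le hab]
  exact setIntegral_le_integral hq (.of_forall hq0)

theorem integral_sliding_window_le {X Y H : ℝ} (hXY : X ≤ Y) (hH : 0 ≤ H) :
    ∫ x in X..Y, ∫ y in x..x + H, q y ≤ H * ∫ y, q y := by
  have integrable (a b : ℝ) : IntervalIntegrable q volume a b := hq.intervalIntegrable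
  set Q : ℝ → ℝ := fun x => ∫ y in X..x, q y
  have continuous : Continuous Q := intervalIntegral.continuous_primitive integrable X
  have integrable_Q (a b : ℝ) : IntervalIntegrable Q volume a b := continuous.intervalIntegrable a b
  have integrable_shift : IntervalIntegrable (fun x => Q (x + H)) volume X Y :=
    (continuous.comp (continuous_add_const H)).intervalIntegrable _ _
  have window_eq (x : ℝ) : ∫ y in x..x + H, q y = Q (x + H) - Q x :=
    (intervalIntegral.integral_interval_sub_left (integrable _ _) (integrable _ _)).symm
  have telescope : ∫ x in X..Y, ∫ y in x..x + H, q y =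
      (∫ x in Y..Y + H, Q x) - ∫ x in X..X + H, Q x := by
    simp_rw [window_eq]
    rw [intervalIntegral.integral_sub integrable_shift (integrable_Q _ _),
      intervalIntegral.integral_comp_add_right Q,
      intervalIntegral.integral_interval_sub_interval_comm (integrable_Q _ _) (integrable_Q _ _)
        (integrable_Q _ _), intervalIntegral.integral_symm Y, intervalIntegral.integral_symm X]
    ring
  have lower : 0 ≤ ∫ x in X..X + H, Q x :=
    intervalIntegral.integral_nonneg (by linarith) fun x hx =>
      intervalIntegral.integral_nonneg hx.1 fun _ _ => hq0 _
  have upper : ∫ x in Y..Y + H, Q x ≤ H * ∫ y, q y := by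
    calc ∫ x in Y..Y + H, Q x ≤ ∫ x in Y..Y + H, ∫ y, q y :=
          intervalIntegral.integral_mono_on (by linarith) (integrable_Q _ _) (by simp)
            fun x hx => intervalIntegral_le_integral hq hq0 (hXY.trans hx.1)
      _ = H * ∫ y, q y := by simp
  linarith

omit hq0 in
theorem intervalIntegrable_window_combination (a b c H X Y : ℝ) :
    IntervalIntegrable (fun x => a * q (x + H) + b * q x + c * ∫ y in x..x + H, q y) volume X Y :=
  ((((hq.comp_add_right H).intervalIntegrable).const_mul a).add
    (hq.intervalIntegrable.const_mul b)).add
    (((continuous_integral_sliding_window hq H).intervalIntegrable _ _).const_mul c)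

theorem integral_window_combination_le {a b c : ℝ} (ha : 0 ≤ a) (hb : 0 ≤ b) (hc : 0 ≤ c)
    {H X Y : ℝ} (hXY : X ≤ Y) (hH : 0 ≤ H) :
    ∫ x in X..Y, (a * q (x + H) + b * q x + c * ∫ y in x..x + H, q y) ≤
      (a + b + c * H) * ∫ y, q y := by
  have integrable_shift : IntervalIntegrable (fun x => a * q (x + H)) volume X Y :=
    ((hq.comp_add_right H).intervalIntegrable).const_mul a
  have integrable : IntervalIntegrable (fun x => b * q x) volume X Y :=
    hq.intervalIntegrable.const_mul b
  calc _ = a * (∫ x in X..Y, q (x + H)) + b * (∫ x in X..Y, q x) +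
        c * ∫ x in X..Y, ∫ y in x..x + H, q y := by
        rw [intervalIntegral.integral_add (integrable_shift.add integrable)
          (((continuous_integral_sliding_window hq H).intervalIntegrable _ _).const_mul c),
          intervalIntegral.integral_add integrable_shift integrable]
        simp only [intervalIntegral.integral_const_mul]
    _ ≤ a * (∫ y, q y) + b * (∫ y, q y) + c * (H * ∫ y, q y) := by
        gcongr
        · rw [intervalIntegral.integral_comp_add_right q]
          exact intervalIntegral_le_integral hq hq0 (by linarith)
        · exact intervalIntegral_le_integral hq hq0 hXY
        · exact integral_sliding_window_le hq hq0 hXY hH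
    _ = (a + b + c * H) * ∫ y, q y := by ring

end SlidingWindow

section WindowSum

open MeasureTheory Complex

variable {ι : Type*} (s : Finset ι) (ν : ι → ℝ) (β : ι → ℂ)

/-- The sum of the `β i` over the frequencies `ν i` in the window `[x, x + H]`. -/
noncomputable def windowSum (H x : ℝ) : ℂ :=
  ∑ i ∈ s, if x ≤ ν i ∧ ν i ≤ x + H then β i else 0

theorem measurable_windowSum (H : ℝ) : Measurable (windowSum s ν β H) := by
  refine Finset.measurable_fun_sum _ fun i _ => Measurable.ite ?_ measurable_const measurable_const
  have : {x : ℝ | x ≤ ν i ∧ ν i ≤ x + H} = Set.Icc (ν i - H) (ν i) := by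
    ext x
    rw [Set.mem_ofPred_eq, Set.mem_Icc, sub_le_iff_le_add, and_comm]
  rw [this]
  exact measurableSet_Icc

theorem norm_windowSum_le (H x : ℝ) : ‖windowSum s ν β H x‖ ≤ ∑ i ∈ s, ‖β i‖ := by
  refine (norm_sum_le _ _).trans (Finset.sum_le_sum fun i _ => ?_)
  split_ifs
  · exact le_rfl
  · rw [norm_zero]; exact norm_nonneg _

theorem intervalIntegrable_norm_windowSum_sq (H a b : ℝ) :
    IntervalIntegrable (fun x => ‖windowSum s ν β H x‖ ^ 2) volume a b := by
  rw [intervalIntegrable_iff]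
  refine Measure.integrableOn_of_bounded (M := (∑ i ∈ s, ‖β i‖) ^ 2) (by simp)
    ((measurable_windowSum s ν β H).norm.pow_const 2).aestronglyMeasurable (.of_forall fun x => ?_)
  rw [Real.norm_of_nonneg (by positivity)]
  gcongr
  exact norm_windowSum_le s ν β H x

variable {s ν} (hν : ∀ i ∈ s, 0 < ν i) {c : ℝ} (hc : 0 < c)
include hν hc

theorem integral_truncSum_div {x y : ℝ} (hx : 0 < x) (hxy : x ≤ y) :
    ∫ u in x..y, truncSum c s ν β u / u =
      ∑ i ∈ s, β i * ((∫ u in x..y, truncPow c (ν i) u / u : ℝ) : ℂ) := by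
  have expand (u : ℝ) : truncSum c s ν β u / u =
      ∑ i ∈ s, β i * ((truncPow c (ν i) u / u : ℝ) : ℂ) := by
    simp only [truncSum, Finset.sum_div, ofReal_div, mul_div_assoc]
  have integrable : ∀ i ∈ s, IntervalIntegrable (fun u => ((truncPow c (ν i) u / u : ℝ) : ℂ))
      volume x y := fun i hi =>
    have h := intervalIntegrable_truncPow_div hc (hν i hi) hx hxy
    ⟨h.1.ofReal, h.2.ofReal⟩
  simp_rw [expand]
  rw [intervalIntegral.integral_finsetSum fun i hi => (integrable i hi).const_mul _]
  simp only [intervalIntegral.integral_const_mul, intervalIntegral.integral_ofReal]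

theorem windowSum_eq_truncSum {x H : ℝ} (hx : 0 < x) (hH : 0 ≤ H) (hne : ∀ i ∈ s, x ≠ ν i) :
    windowSum s ν β H x = truncSum c s ν β (x + H) - truncSum c s ν β x +
      c * ∫ y in x..x + H, truncSum c s ν β y / y := by
  rw [integral_truncSum_div β hν hc hx (by linarith), truncSum, truncSum, Finset.mul_sum,
    ← Finset.sum_sub_distrib, ← Finset.sum_add_distrib]
  refine Finset.sum_congr rfl fun i hi => ?_
  have indicator := congrArg (fun r : ℝ => β i * (r : ℂ))
    (indicator_eq_truncPow hc (hν i hi) hx hH)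
  simp only [ofReal_add, ofReal_sub, ofReal_mul, ← (hne i hi).le_iff_lt] at indicator
  calc (if x ≤ ν i ∧ ν i ≤ x + H then β i else 0)
      = β i * ((if x ≤ ν i ∧ ν i ≤ x + H then (1 : ℝ) else 0 : ℝ) : ℂ) := by split_ifs <;> simp
    _ = _ := by rw [indicator]; ring

theorem norm_integral_truncSum_div_sq_le {x H : ℝ} (hx : 0 < x) (hH : 0 < H) :
    ‖∫ y in x..x + H, truncSum c s ν β y / y‖ ^ 2 ≤
      H * ∫ y in x..x + H, truncDensity c s ν β y := by
  have hle : x ≤ x + H := by linarith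
  have pos {y : ℝ} (hy : y ∈ Set.uIcc x (x + H)) : 0 < y := by
    rw [Set.uIcc_of_le hle] at hy; exact hx.trans_le hy.1
  have integrable : IntervalIntegrable (fun y => ‖truncSum c s ν β y‖ / y) volume x (x + H) := by
    rw [intervalIntegrable_iff_integrableOn_Ioc_of_le hle]
    refine Measure.integrableOn_of_bounded (M := (∑ i ∈ s, ‖β i‖) / x) (by simp)
      ((measurable_truncSum c s ν β).norm.div measurable_id).aestronglyMeasurable ?_
    filter_upwards [ae_restrict_mem measurableSet_Ioc] with y hy
    rw [Real.norm_of_nonneg (div_nonneg (norm_nonneg _) (hx.trans hy.1).le)]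
    exact div_le_div₀ (Finset.sum_nonneg fun _ _ => norm_nonneg _)
      (norm_truncSum_le hν hc β y) hx hy.1.le
  have integrable_sq :
      IntervalIntegrable (fun y => (‖truncSum c s ν β y‖ / y) ^ 2) volume x (x + H) :=
    (integrable_truncDensity hν hc β).intervalIntegrable.congr
      fun y hy => truncDensity_of_pos (pos (Set.uIoc_subset_uIcc hy))
  calc ‖∫ y in x..x + H, truncSum c s ν β y / y‖ ^ 2
      ≤ (∫ y in x..x + H, ‖truncSum c s ν β y‖ / y) ^ 2 := by
        gcongr
        refine (intervalIntegral.norm_integral_le_integral_norm hle).trans_eq ?_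
        refine intervalIntegral.integral_congr fun y hy => ?_
        rw [norm_div, norm_real, Real.norm_of_nonneg (pos hy).le]
    _ ≤ (x + H - x) * ∫ y in x..x + H, (‖truncSum c s ν β y‖ / y) ^ 2 :=
        sq_intervalIntegral_le (by linarith) integrable integrable_sq
    _ = H * ∫ y in x..x + H, truncDensity c s ν β y := by
        rw [add_sub_cancel_left]
        congr 1
        exact intervalIntegral.integral_congr fun y hy => (truncDensity_of_pos (pos hy)).symm

theorem norm_windowSum_sq_le {x X H : ℝ} (hx : 0 < x) (hxX : x ≤ X) (hH : 0 < H)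
    (hne : ∀ i ∈ s, x ≠ ν i) :
    ‖windowSum s ν β H x‖ ^ 2 ≤ 3 * (X + H) ^ 2 * truncDensity c s ν β (x + H) +
      3 * X ^ 2 * truncDensity c s ν β x +
      3 * c ^ 2 * H * ∫ y in x..x + H, truncDensity c s ν β y := by
  have norm_sq_le {y Y : ℝ} (hy : 0 < y) (hyY : y ≤ Y) :
      ‖truncSum c s ν β y‖ ^ 2 ≤ Y ^ 2 * truncDensity c s ν β y := by
    calc ‖truncSum c s ν β y‖ ^ 2 = y ^ 2 * truncDensity c s ν β y := by
          rw [truncDensity_of_pos hy]; field_simp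
      _ ≤ Y ^ 2 * truncDensity c s ν β y := by
          gcongr; exact truncDensity_nonneg c s ν β y
  set J := ∫ y in x..x + H, truncSum c s ν β y / y
  have triangle : ‖windowSum s ν β H x‖ ≤
      ‖truncSum c s ν β (x + H)‖ + ‖truncSum c s ν β x‖ + c * ‖J‖ := by
    rw [windowSum_eq_truncSum β hν hc hx hH.le hne]
    refine (norm_add_le _ _).trans (add_le_add (norm_sub_le _ _) ?_)
    rw [norm_mul, norm_real, Real.norm_of_nonneg hc.le]
  have sq_add_le (u v w : ℝ) : (u + v + w) ^ 2 ≤ 3 * (u ^ 2 + v ^ 2 + w ^ 2) := by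
    nlinarith [sq_nonneg (u - v), sq_nonneg (v - w), sq_nonneg (u - w)]
  calc ‖windowSum s ν β H x‖ ^ 2
      ≤ (‖truncSum c s ν β (x + H)‖ + ‖truncSum c s ν β x‖ + c * ‖J‖) ^ 2 := by gcongr
    _ ≤ 3 * (‖truncSum c s ν β (x + H)‖ ^ 2 + ‖truncSum c s ν β x‖ ^ 2 + (c * ‖J‖) ^ 2) :=
        sq_add_le _ _ _
    _ ≤ 3 * ((X + H) ^ 2 * truncDensity c s ν β (x + H) + X ^ 2 * truncDensity c s ν β x +
          c ^ 2 * (H * ∫ y in x..x + H, truncDensity c s ν β y)) := by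
        rw [mul_pow]
        gcongr
        · exact norm_sq_le (by linarith) (by linarith)
        · exact norm_sq_le hx hxX
        · exact norm_integral_truncSum_div_sq_le β hν hc hx hH
    _ = _ := by ring

omit hc in
theorem integral_norm_windowSum_sq_le {X H : ℝ} (hX : 0 < X) (hH : 0 < H) :
    ∫ x in X..2 * X, ‖windowSum s ν β H x‖ ^ 2 ≤
      3 * ((2 * X + H) ^ 2 + (2 * X) ^ 2 + X ^ 2) * (1 / (2 * Real.pi) *
        ∫ t : ℝ, ‖∑ i ∈ s, β i * ((√(ν i))⁻¹ : ℝ) *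
        cexp (-(t * Real.log (ν i) * I))‖ ^ 2 / ((X / H + 1 / 2) ^ 2 + t ^ 2)) := by
  classical
  have hc : 0 < X / H := div_pos hX hH
  have integrable := integrable_truncDensity hν hc β
  have avoid : ∀ᵐ x : ℝ, x ∉ s.image ν :=
    measure_eq_zero_iff_ae_notMem.mp ((s.image ν).finite_toSet.measure_zero volume)
  have hX2 : X ≤ 2 * X := by linarith
  calc ∫ x in X..2 * X, ‖windowSum s ν β H x‖ ^ 2
      ≤ ∫ x in X..2 * X, (3 * (2 * X + H) ^ 2 * truncDensity (X / H) s ν β (x + H) +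
          3 * (2 * X) ^ 2 * truncDensity (X / H) s ν β x +
          3 * (X / H) ^ 2 * H * ∫ y in x..x + H, truncDensity (X / H) s ν β y) := by
        refine intervalIntegral.integral_mono_ae_restrict hX2
          (intervalIntegrable_norm_windowSum_sq s ν β H _ _)
          (intervalIntegrable_window_combination integrable _ _ _ _ _ _) ?_
        filter_upwards [ae_restrict_mem measurableSet_Icc, ae_restrict_of_ae avoid] with x hx hxν
        exact norm_windowSum_sq_le β hν hc (hX.trans_le hx.1) hx.2 hH
          fun i hi h => hxν (Finset.mem_image.mpr ⟨i, hi, h.symm⟩)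
    _ ≤ (3 * (2 * X + H) ^ 2 + 3 * (2 * X) ^ 2 + 3 * (X / H) ^ 2 * H * H) *
          ∫ y, truncDensity (X / H) s ν β y :=
        integral_window_combination_le integrable (truncDensity_nonneg _ s ν β) (by positivity)
          (by positivity) (by positivity) hX2 hH.le
    _ = _ := by
        rw [integral_truncDensity hν hc β]
        congr 1
        field_simp

end WindowSum

section LaplaceTransform

open MeasureTheory Complex Filter Topology

/-- The two-sided Laplace transform `∫ φ(v) e^{wv} dv`. It is used as a Mellin transform in
logarithmic coordinates, hence the sign of the exponent. -/
noncomputable def twoSidedLaplace (φ : ℝ → ℂ) (w : ℂ) : ℂ := ∫ v : ℝ, φ v * cexp (w * v)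

variable {φ : ℝ → ℂ} {R : ℝ}

theorem hasCompactSupport_of_forall_lt_abs (hs : ∀ v, R < |v| → φ v = 0) :
    HasCompactSupport φ :=
  .intro (isCompact_Icc (a := -R) (b := R)) fun v hv =>
    hs v (not_le.mp fun h => hv (abs_le.mp h))

theorem deriv_eq_zero_of_forall_lt_abs (hs : ∀ v, R < |v| → φ v = 0) {v : ℝ} (hv : R < |v|) :
    deriv φ v = 0 := by
  have hzero : φ =ᶠ[𝓝 v] fun _ => 0 := by
    filter_upwards [(isOpen_lt continuous_const continuous_abs).mem_nhds hv] with u hu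
    exact hs u hu
  rw [hzero.deriv_eq, deriv_const]

theorem integrable_mul_cexp (hc : Continuous φ) (hs : ∀ v, R < |v| → φ v = 0) (w : ℂ) :
    Integrable fun v : ℝ => φ v * cexp (w * v) :=
  (hc.mul (by fun_prop)).integrable_of_hasCompactSupport
    (hasCompactSupport_of_forall_lt_abs hs).mul_right

theorem norm_twoSidedLaplace_le (hc : Continuous φ) (hs : ∀ v, R < |v| → φ v = 0) (w : ℂ) :
    ‖twoSidedLaplace φ w‖ ≤ (∫ v, ‖φ v‖) * Real.exp (R * |w.re|) := by
  have hφ : Integrable φ := by simpa using integrable_mul_cexp hc hs 0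
  rw [← integral_mul_const]
  refine norm_integral_le_of_norm_le (hφ.norm.mul_const _) (.of_forall fun v => ?_)
  by_cases hv : R < |v|
  · simp [hs v hv]
  · rw [norm_mul, norm_exp]
    gcongr
    rw [re_mul_ofReal]
    calc w.re * v ≤ |w.re * v| := le_abs_self _
      _ = |v| * |w.re| := by rw [abs_mul, mul_comm]
      _ ≤ R * |w.re| := by gcongr; exact not_lt.mp hv

theorem mul_twoSidedLaplace (hd : ContDiff ℝ 1 φ) (hs : ∀ v, R < |v| → φ v = 0) (w : ℂ) :
    w * twoSidedLaplace φ w = -twoSidedLaplace (deriv φ) w := by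
  have hexp (x : ℝ) : HasDerivAt (fun v : ℝ => cexp (w * v)) (w * cexp (w * x)) x := by
    have hlin : HasDerivAt (fun v : ℝ => w * (v : ℂ)) w x := by
      simpa using (hasDerivAt_id x).ofReal_comp.const_mul w
    simpa [mul_comm] using hlin.cexp
  have hparts := integral_mul_deriv_eq_deriv_mul_of_integrable
    (fun x _ => (hd.differentiable one_ne_zero x).hasDerivAt) (fun x _ => hexp x)
    (((integrable_mul_cexp hd.continuous hs w).const_mul w).congr
      (.of_forall fun v => mul_left_comm _ _ _))
    (integrable_mul_cexp (hd.continuous_deriv le_rfl)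
      (fun _ => deriv_eq_zero_of_forall_lt_abs hs) w)
    (integrable_mul_cexp hd.continuous hs w)
  rw [twoSidedLaplace, ← integral_const_mul, twoSidedLaplace, ← hparts]
  exact integral_congr_ae (.of_forall fun v => mul_left_comm _ _ _)

theorem exists_norm_pow_mul_twoSidedLaplace_le (J : ℕ) (hd : ContDiff ℝ (⊤ : ℕ∞) φ)
    (hs : ∀ v, R < |v| → φ v = 0) :
    ∃ C : ℝ, 0 ≤ C ∧ ∀ w : ℂ, ‖w‖ ^ J * ‖twoSidedLaplace φ w‖ ≤ C * Real.exp (R * |w.re|) := by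
  induction J generalizing φ with
  | zero =>
    refine ⟨∫ v, ‖φ v‖, integral_nonneg fun _ => norm_nonneg _, fun w => ?_⟩
    simpa using norm_twoSidedLaplace_le hd.continuous hs w
  | succ J ih =>
    obtain ⟨C, hC, h⟩ := ih (hd.iterate_deriv 1) fun _ => deriv_eq_zero_of_forall_lt_abs hs
    refine ⟨C, hC, fun w => ?_⟩
    rw [pow_succ, mul_assoc, ← norm_mul,
      mul_twoSidedLaplace (hd.of_le (by exact_mod_cast le_top)) hs w, norm_neg]
    exact h w

theorem exists_norm_twoSidedLaplace_le (J : ℕ) (hd : ContDiff ℝ (⊤ : ℕ∞) φ)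
    (hs : ∀ v, R < |v| → φ v = 0) :
    ∃ C : ℝ, 0 ≤ C ∧ ∀ w : ℂ,
      ‖twoSidedLaplace φ w‖ ≤ C * Real.exp (R * |w.re|) / (1 + |w.im|) ^ J := by
  obtain ⟨C₀, hC₀, h₀⟩ := exists_norm_pow_mul_twoSidedLaplace_le 0 hd hs
  obtain ⟨C₁, hC₁, h₁⟩ := exists_norm_pow_mul_twoSidedLaplace_le J hd hs
  refine ⟨2 ^ (J - 1) * (C₀ + C₁), by positivity, fun w => ?_⟩
  have h₀w : ‖twoSidedLaplace φ w‖ ≤ C₀ * Real.exp (R * |w.re|) := by simpa using h₀ w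
  rw [le_div_iff₀ (by positivity)]
  calc ‖twoSidedLaplace φ w‖ * (1 + |w.im|) ^ J
      ≤ ‖twoSidedLaplace φ w‖ * (2 ^ (J - 1) * (1 ^ J + ‖w‖ ^ J)) := by
        gcongr
        refine (add_pow_le zero_le_one (abs_nonneg _) J).trans ?_
        gcongr
        exact abs_im_le_norm w
    _ = 2 ^ (J - 1) * (‖twoSidedLaplace φ w‖ + ‖w‖ ^ J * ‖twoSidedLaplace φ w‖) := by
        rw [one_pow]; ring
    _ ≤ 2 ^ (J - 1) * (C₀ * Real.exp (R * |w.re|) + C₁ * Real.exp (R * |w.re|)) := by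
        have := h₁ w
        gcongr
    _ = _ := by ring

theorem differentiable_twoSidedLaplace (hc : Continuous φ) (hs : ∀ v, R < |v| → φ v = 0) :
    Differentiable ℂ (twoSidedLaplace φ) := by
  intro w
  have hφ : Integrable φ := by simpa using integrable_mul_cexp hc hs 0
  have hdom (v : ℝ) (z : ℂ) (hz : z ∈ Metric.ball w 1) :
      ‖φ v * (cexp (z * v) * v)‖ ≤ ‖φ v‖ * (Real.exp ((‖w‖ + 1) * |R|) * |R|) := by
    by_cases hv : R < |v|
    · simp [hs v hv]
    have hvR : |v| ≤ |R| := (not_lt.mp hv).trans (le_abs_self R)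
    have hzw : ‖z‖ ≤ ‖w‖ + 1 := by
      linarith [norm_le_norm_add_norm_sub' z w, mem_ball_iff_norm.mp hz]
    have hexp : z.re * v ≤ (‖w‖ + 1) * |R| :=
      calc z.re * v ≤ |z.re| * |v| := (le_abs_self _).trans_eq (abs_mul _ _)
        _ ≤ _ := mul_le_mul ((abs_re_le_norm z).trans hzw) hvR (abs_nonneg _) (by positivity)
    rw [norm_mul, norm_mul, norm_exp, norm_real, Real.norm_eq_abs, re_mul_ofReal]
    gcongr
  have hderiv (v : ℝ) (z : ℂ) :
      HasDerivAt (fun z : ℂ => φ v * cexp (z * v)) (φ v * (cexp (z * v) * v)) z :=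
    (hasDerivAt_mul_const (v : ℂ)).cexp.const_mul _
  exact (hasDerivAt_integral_of_dominated_loc_of_deriv_le (Metric.ball_mem_nhds w one_pos)
    (.of_forall fun z => (hc.mul (by fun_prop)).aestronglyMeasurable)
    (integrable_mul_cexp hc hs w) (hc.mul (by fun_prop)).aestronglyMeasurable
    (.of_forall hdom) (hφ.norm.mul_const _)
    (.of_forall fun v z _ => hderiv v z)).2.differentiableAt

theorem one_add_sq_le_one_add_abs_sq (y : ℝ) : 1 + y ^ 2 ≤ (1 + |y|) ^ 2 := by
  nlinarith [abs_nonneg y, sq_abs y]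

theorem integrable_twoSidedLaplace_add_mul_I (hd : ContDiff ℝ (⊤ : ℕ∞) φ)
    (hs : ∀ v, R < |v| → φ v = 0) (c : ℝ) :
    Integrable fun y : ℝ => twoSidedLaplace φ (c + y * I) := by
  obtain ⟨C, hC, hb⟩ := exists_norm_twoSidedLaplace_le 2 hd hs
  have hcont : Continuous (twoSidedLaplace φ) :=
    (differentiable_twoSidedLaplace hd.continuous hs).continuous
  refine (integrable_inv_one_add_sq.const_mul (C * Real.exp (R * |c|))).mono'
    (hcont.comp (by fun_prop)).aestronglyMeasurable (.of_forall fun y => (hb _).trans ?_)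
  simp only [add_re, ofReal_re, mul_re, I_re, mul_zero, ofReal_im, I_im, mul_one, sub_self,
    add_zero, add_im, mul_im, zero_add]
  rw [div_eq_mul_inv]
  gcongr
  exact one_add_sq_le_one_add_abs_sq y

theorem integral_twoSidedLaplace_mul_cexp (hd : ContDiff ℝ (⊤ : ℕ∞) φ)
    (hs : ∀ v, R < |v| → φ v = 0) (c v : ℝ) :
    ∫ y : ℝ, twoSidedLaplace φ (c + y * I) * cexp (-((c + y * I) * v)) = 2 * Real.pi * φ v := by
  have hfourier (w : ℝ) : ∫ x : ℝ, cexp (-(w * x * I)) * (φ x * cexp (c * x)) =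
      twoSidedLaplace φ (c - w * I) := by
    refine integral_congr_ae (.of_forall fun x => ?_)
    simp only
    rw [mul_left_comm, ← Complex.exp_add]
    congr 2; ring
  have hinv := integral_cexp_mul_of_fourier_eq (f := fun v => φ v * cexp (c * v))
    (hd.continuous.mul (by fun_prop)) (integrable_mul_cexp hd.continuous hs c)
    (by simpa [sub_eq_add_neg] using (integrable_twoSidedLaplace_add_mul_I hd hs c).comp_neg)
    hfourier v
  rw [← integral_neg_eq_self] at hinv
  calc ∫ y : ℝ, twoSidedLaplace φ (c + y * I) * cexp (-((c + y * I) * v))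
      = (∫ x : ℝ, cexp ((-x : ℝ) * v * I) * twoSidedLaplace φ (c - (-x : ℝ) * I)) *
          cexp (-(c * v)) := by
        rw [← integral_mul_const]
        refine integral_congr_ae (.of_forall fun x => ?_)
        simp only
        rw [mul_right_comm, ← Complex.exp_add, mul_comm (cexp _)]
        congr 2 <;> push_cast <;> ring
    _ = 2 * Real.pi * φ v := by
        rw [hinv, mul_assoc, mul_assoc, mul_assoc, ← Complex.exp_add]
        simp [mul_assoc]

end LaplaceTransform

section VerticalLine

open MeasureTheory Complex Filter Topology

variable {h : ℂ → ℂ} {c C : ℝ}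

theorem norm_intervalIntegral_vertical_sub_le (hd : Differentiable ℂ h) (hc : 0 ≤ c)
    (hb : ∀ x ∈ Set.Icc 0 c, ∀ y : ℝ, ‖h (x + y * I)‖ ≤ C / (1 + y ^ 2)) (T : ℝ) :
    ‖(∫ y in -T..T, h (c + y * I)) - ∫ y in -T..T, h (y * I)‖ ≤ 2 * (C / (1 + T ^ 2) * c) := by
  have hcauchy := integral_boundary_rect_eq_zero_of_differentiableOn h (-T * I) (c + T * I)
    hd.differentiableOn
  simp only [mul_re, neg_re, ofReal_re, I_re, mul_zero, neg_im, ofReal_im, neg_zero, I_im,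
    mul_one, sub_self, add_re, add_zero, mul_im, add_im, zero_add, ofReal_zero, ofReal_neg,
    smul_eq_mul] at hcauchy
  have hedges : (∫ y in -T..T, h (c + y * I)) - ∫ y in -T..T, h (y * I) =
      I * ((∫ x in (0 : ℝ)..c, h (x + (-T : ℝ) * I)) - ∫ x in (0 : ℝ)..c, h (x + T * I)) := by
    push_cast
    linear_combination (-I) * hcauchy +
      ((∫ y in -T..T, h (c + y * I)) - ∫ y in -T..T, h (y * I)) * I_sq
  have hedge (y : ℝ) : ‖∫ x in (0 : ℝ)..c, h (x + y * I)‖ ≤ C / (1 + y ^ 2) * c := by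
    have := intervalIntegral.norm_integral_le_of_norm_le_const (a := 0) (b := c)
      (f := fun x : ℝ => h (x + y * I)) fun x hx =>
        hb x (Set.Ioc_subset_Icc_self (Set.uIoc_of_le hc ▸ hx)) y
    simpa [abs_of_nonneg hc] using this
  rw [hedges, norm_mul, norm_I, one_mul, two_mul]
  refine (norm_sub_le _ _).trans (add_le_add ?_ (hedge T))
  simpa only [neg_sq] using hedge (-T)

theorem integral_vertical_line_eq (hd : Differentiable ℂ h) (hc : 0 ≤ c)
    (hb : ∀ x ∈ Set.Icc 0 c, ∀ y : ℝ, ‖h (x + y * I)‖ ≤ C / (1 + y ^ 2)) :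
    ∫ y : ℝ, h (y * I) = ∫ y : ℝ, h (c + y * I) := by
  have hint (x : ℝ) (hx : x ∈ Set.Icc 0 c) : Integrable fun y : ℝ => h (x + y * I) :=
    (integrable_inv_one_add_sq.const_mul C).mono'
      (hd.continuous.comp (by fun_prop)).aestronglyMeasurable
      (.of_forall fun y => (hb x hx y).trans_eq (div_eq_mul_inv _ _))
  have hint₀ : Integrable fun y : ℝ => h (y * I) := by simpa using hint 0 ⟨le_rfl, hc⟩
  have hlim₀ := intervalIntegral_tendsto_integral hint₀ tendsto_neg_atTop_atBot tendsto_id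
  have hlim := intervalIntegral_tendsto_integral (hint c ⟨hc, le_rfl⟩) tendsto_neg_atTop_atBot
    tendsto_id
  have hbound : Tendsto (fun T : ℝ => 2 * (C / (1 + T ^ 2) * c)) atTop (𝓝 0) := by
    have hden : Tendsto (fun T : ℝ => 1 + T ^ 2) atTop atTop :=
      tendsto_atTop_add_const_left _ _ (tendsto_pow_atTop two_ne_zero)
    simpa using ((tendsto_const_nhds (x := C)).div_atTop hden).mul_const c |>.const_mul 2
  have hdiff := squeeze_zero_norm (norm_intervalIntegral_vertical_sub_le hd hc hb) hbound
  exact (sub_eq_zero.mp (tendsto_nhds_unique (hlim.sub hlim₀) hdiff)).symm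

end VerticalLine

section StripGrowth

open MeasureTheory Complex Filter Topology

theorem rpow_le_factorial_mul_exp {x : ℝ} (a : ℝ) (hx : 1 ≤ x) :
    x ^ a ≤ (⌈a⌉₊.factorial : ℝ) * Real.exp x := by
  calc x ^ a ≤ x ^ (⌈a⌉₊ : ℝ) := Real.rpow_le_rpow_of_exponent_le hx (Nat.le_ceil a)
    _ = x ^ ⌈a⌉₊ := Real.rpow_natCast _ _
    _ ≤ _ := (div_le_iff₀' (by positivity)).mp
      (Real.pow_div_factorial_le_exp x (by linarith) ⌈a⌉₊)

theorem exists_norm_rpow_le_mul_exp_abs_im (a : ℝ) {σ : ℝ} (hσ : 0 < σ) (τ : ℝ) :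
    ∃ C : ℝ, ∀ z : ℂ, σ ≤ z.re → z.re ≤ τ → ‖z‖ ^ a ≤ C * Real.exp |z.im| := by
  refine ⟨⌈a⌉₊.factorial * Real.exp τ + σ ^ (-|a|), fun z hσz hτz => ?_⟩
  rw [add_mul, mul_assoc, ← Real.exp_add]
  rcases le_total 1 ‖z‖ with hz | hz
  · refine (rpow_le_factorial_mul_exp a hz).trans (le_add_of_le_of_nonneg ?_ (by positivity))
    gcongr
    refine (norm_le_abs_re_add_abs_im z).trans ?_
    rw [abs_of_nonneg (hσ.le.trans hσz)]
    gcongr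
  · have hσn : σ ≤ ‖z‖ := hσz.trans (re_le_norm z)
    refine le_add_of_nonneg_of_le (by positivity) ?_
    calc ‖z‖ ^ a ≤ ‖z‖ ^ (-|a|) :=
          Real.rpow_le_rpow_of_exponent_ge (hσ.trans_le hσn) hz (neg_abs_le a)
      _ ≤ σ ^ (-|a|) := Real.rpow_le_rpow_of_nonpos hσ hσn (by simp)
      _ ≤ σ ^ (-|a|) * Real.exp |z.im| :=
          le_mul_of_one_le_right (by positivity) (Real.one_le_exp (abs_nonneg _))

theorem one_le_norm_add_one {s : ℂ} (hs : 0 ≤ s.re) : 1 ≤ ‖s + 1‖ :=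
  calc (1 : ℝ) ≤ (s + 1).re := by simpa using hs
    _ ≤ _ := re_le_norm _

theorem one_add_abs_im_div_two_le_norm_add_one {s : ℂ} (hs : 0 ≤ s.re) :
    (1 + |s.im|) / 2 ≤ ‖s + 1‖ := by
  have him : |s.im| ≤ ‖s + 1‖ := by simpa using abs_im_le_norm (s + 1)
  linarith [one_le_norm_add_one hs]

theorem norm_div_add_one_pow_le (z : ℂ) {s : ℂ} (hs : 0 ≤ s.re) (J : ℕ) :
    ‖z / (s + 1) ^ J‖ ≤ ‖z‖ := by
  rw [norm_div, norm_pow]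
  exact div_le_self (norm_nonneg _) (one_le_pow₀ (one_le_norm_add_one hs))

theorem norm_div_add_one_pow_le_of_norm_le {z s : ℂ} (hs : 0 ≤ s.re) {C : ℝ} {J : ℕ}
    (hz : ‖z‖ ≤ C * (1 + |s.im|) ^ J) : ‖z / (s + 1) ^ J‖ ≤ C * 2 ^ J := by
  have hC : 0 ≤ C := nonneg_of_mul_nonneg_left ((norm_nonneg _).trans hz) (by positivity)
  have hpos : 0 < ‖s + 1‖ := one_pos.trans_le (one_le_norm_add_one hs)
  rw [norm_div, norm_pow, div_le_iff₀ (pow_pos hpos _)]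
  calc ‖z‖ ≤ C * (1 + |s.im|) ^ J := hz
    _ = C * 2 ^ J * ((1 + |s.im|) / 2) ^ J := by rw [div_pow]; field_simp
    _ ≤ _ := by gcongr; exact one_add_abs_im_div_two_le_norm_add_one hs

theorem exists_isBigO_exp_mul_exp_abs_im_of_finite_order {f : ℂ → ℂ}
    (horder : ∃ a C : ℝ, ∀ s : ℂ, ‖f s‖ ≤ C * Real.exp (‖s‖ ^ a)) {σ : ℝ} (hσ : 0 < σ) (τ : ℝ)
    (J : ℕ) :
    ∃ B : ℝ, (fun z => f z / (z + 1) ^ J)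
      =O[comap (_root_.abs ∘ im) atTop ⊓ 𝓟 (re ⁻¹' Set.Ioo σ τ)]
        fun z => Real.exp (B * Real.exp |z.im|) := by
  obtain ⟨a, C, hC⟩ := horder
  have hC₀ : 0 ≤ C := nonneg_of_mul_nonneg_left ((norm_nonneg _).trans (hC 0)) (Real.exp_pos _)
  obtain ⟨B, hB⟩ := exists_norm_rpow_le_mul_exp_abs_im a hσ τ
  refine ⟨B, .of_bound C (eventually_inf_principal.mpr (.of_forall fun z hz => ?_))⟩
  rw [Real.norm_of_nonneg (Real.exp_pos _).le]
  refine (norm_div_add_one_pow_le _ (hσ.trans hz.1).le J).trans ((hC z).trans ?_)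
  gcongr
  exact hB z hz.1.le hz.2.le

-- Phragmén–Lindelöf is applied to `f(s) / (s + 1)^J`, which is bounded on both lines.
theorem norm_le_strip_of_norm_le_boundary {f : ℂ → ℂ} (hf : Differentiable ℂ f)
    (horder : ∃ a C : ℝ, ∀ s : ℂ, ‖f s‖ ≤ C * Real.exp (‖s‖ ^ a)) {B C : ℝ} {J : ℕ}
    (hleft : ∀ s : ℂ, s.re = 1 / 2 → ‖f s‖ ≤ C * (1 + |s.im|) ^ J)
    (hright : ∀ s : ℂ, s.re = 2 → ‖f s‖ ≤ B) {s : ℂ} (hs : 1 / 2 ≤ s.re) (hs' : s.re ≤ 2) :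
    ‖f s‖ ≤ max (C * 2 ^ J) B * ‖s + 1‖ ^ J := by
  have hne {z : ℂ} (hz : 1 / 2 ≤ z.re) : z + 1 ≠ 0 :=
    norm_pos_iff.mp (one_pos.trans_le (one_le_norm_add_one (by linarith)))
  have hclosure : closure (re ⁻¹' Set.Ioo (1 / 2 : ℝ) 2) ⊆ {z : ℂ | 1 / 2 ≤ z.re} :=
    closure_minimal (fun z hz => hz.1.le) (isClosed_le continuous_const continuous_re)
  have hdiff : DiffContOnCl ℂ (fun z => f z / (z + 1) ^ J) (re ⁻¹' Set.Ioo (1 / 2 : ℝ) 2) := by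
    refine DifferentiableOn.diffContOnCl fun z hz => DifferentiableAt.differentiableWithinAt ?_
    exact (hf z).div (by fun_prop) (pow_ne_zero _ (hne (hclosure hz)))
  obtain ⟨B', hB'⟩ := exists_isBigO_exp_mul_exp_abs_im_of_finite_order horder one_half_pos 2 J
  have hpi : 1 < Real.pi / (2 - 1 / 2) := by
    rw [lt_div_iff₀ (by norm_num)]; linarith [Real.pi_gt_three]
  have hbound := PhragmenLindelof.vertical_strip (C := max (C * 2 ^ J) B) hdiff
    ⟨1, hpi, B', by simpa only [one_mul] using hB'⟩
    (fun z hz => (norm_div_add_one_pow_le_of_norm_le (by rw [hz]; norm_num)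
      (hleft z hz)).trans (le_max_left _ _))
    (fun z hz => ((norm_div_add_one_pow_le _ (by rw [hz]; norm_num) J).trans
      (hright z hz)).trans (le_max_right _ _)) hs hs'
  rwa [norm_div, norm_pow, div_le_iff₀ (pow_pos (norm_pos_iff.mpr (hne hs)) _)] at hbound

theorem norm_le_tsum_norm_term_of_LSeriesHasSum {a : ℕ → ℂ} {s z : ℂ} (h : LSeriesHasSum a s z) :
    ‖z‖ ≤ ∑' n, ‖LSeries.term a s.re n‖ := by
  have hnorm (n : ℕ) : ‖LSeries.term a s n‖ = ‖LSeries.term a s.re n‖ := by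
    simp only [LSeries.norm_term_eq, ofReal_re]
  simp only [← hnorm]
  rw [← h.LSeries_eq]
  exact norm_tsum_le_tsum_norm h.LSeriesSummable.norm

theorem IsEntireEulerProduct.exists_norm_le_strip {A : ℕ → ℂ} {L : ℂ → ℂ} {d : ℕ}
    (hL : IsEntireEulerProduct A L d) {θ : ℝ} (hθ : IsSubconvexityExponent L θ) :
    ∃ (C : ℝ) (J : ℕ), 0 ≤ C ∧
      ∀ s : ℂ, 1 / 2 ≤ s.re → s.re ≤ 2 → ‖L s‖ ≤ C * (1 + |s.im|) ^ J := by
  obtain ⟨C, hC⟩ := hθ.2 1 one_pos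
  have hC₀ : 0 ≤ C := by simpa using (norm_nonneg _).trans (hC 0)
  have hleft (s : ℂ) (hs : s.re = 1 / 2) : ‖L s‖ ≤ C * (1 + |s.im|) ^ ⌈θ + 1⌉₊ := by
    have hline : s = 1 / 2 + (s.im : ℂ) * I := by apply Complex.ext <;> simp [hs]
    calc ‖L s‖ ≤ C * (1 + |s.im|) ^ (θ + 1) := by simpa only [← hline] using hC s.im
      _ ≤ C * (1 + |s.im|) ^ (⌈θ + 1⌉₊ : ℝ) := by
          gcongr
          · linarith [abs_nonneg s.im]
          · exact Nat.le_ceil _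
      _ = _ := by rw [Real.rpow_natCast]
  have hright (s : ℂ) (hs : s.re = 2) : ‖L s‖ ≤ ∑' n, ‖LSeries.term A (2 : ℝ) n‖ :=
    hs ▸ norm_le_tsum_norm_term_of_LSeriesHasSum (hL.dirichlet_series s (by rw [hs]; norm_num))
  set D := max (C * 2 ^ ⌈θ + 1⌉₊) (∑' n, ‖LSeries.term A (2 : ℝ) n‖)
  have hD : 0 ≤ D := le_max_of_le_left (by positivity)
  refine ⟨D * 3 ^ ⌈θ + 1⌉₊, ⌈θ + 1⌉₊, mul_nonneg hD (by positivity), fun s hs hs' => ?_⟩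
  refine (norm_le_strip_of_norm_le_boundary hL.entire hL.finite_order hleft hright hs
    hs').trans ?_
  rw [mul_assoc, ← mul_pow]
  refine mul_le_mul_of_nonneg_left (pow_le_pow_left₀ (norm_nonneg _) ?_ _) hD
  refine (norm_le_abs_re_add_abs_im _).trans ?_
  simp only [add_re, one_re, add_im, one_im, add_zero]
  rw [abs_of_nonneg (by linarith)]
  linarith [abs_nonneg s.im]

end StripGrowth

section SmoothSums

open MeasureTheory Complex Filter Topology

variable {φ : ℝ → ℂ} {R : ℝ} {a : ℕ → ℂ}

theorem continuous_term_comp {g : ℝ → ℂ} (hg : Continuous g) (a : ℕ → ℂ) (k : ℕ) :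
    Continuous fun y => LSeries.term a (g y) k := by
  rcases eq_or_ne k 0 with rfl | hk
  · simpa only [LSeries.term_zero] using continuous_const
  simp only [LSeries.term_of_ne_zero hk]
  have hk₀ : (k : ℂ) ≠ 0 := Nat.cast_ne_zero.mpr hk
  exact continuous_const.div (hg.const_cpow (.inl hk₀)) fun y => by simp [cpow_eq_zero_iff, hk]

theorem hasSum_integral_twoSidedLaplace_mul_term (hd : ContDiff ℝ (⊤ : ℕ∞) φ)
    (hs : ∀ v, R < |v| → φ v = 0) {s₀ : ℂ} {c ℓ : ℝ} (ha : LSeriesSummable a (s₀ + c / ℓ)) :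
    HasSum (fun k : ℕ => ∫ y : ℝ,
        twoSidedLaplace φ (c + y * I) * LSeries.term a (s₀ + (c + y * I) / ℓ) k)
      (∫ y : ℝ, twoSidedLaplace φ (c + y * I) * LSeries a (s₀ + (c + y * I) / ℓ)) := by
  have hnorm (y : ℝ) (k : ℕ) :
      ‖LSeries.term a (s₀ + (c + y * I) / ℓ) k‖ = ‖LSeries.term a (s₀ + c / ℓ) k‖ := by
    simp [LSeries.norm_term_eq, div_ofReal_re]
  have hint := integrable_twoSidedLaplace_add_mul_I hd hs c
  simp only [LSeries, ← tsum_mul_left]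
  refine hasSum_integral_of_summable_integral_norm (fun k => ?_) ?_
  · refine (hint.norm.mul_const ‖LSeries.term a (s₀ + c / ℓ) k‖).mono'
      (hint.aestronglyMeasurable.mul
        (continuous_term_comp (by fun_prop) a k).aestronglyMeasurable) (.of_forall fun y => ?_)
    rw [norm_mul, hnorm]
  · simp_rw [norm_mul, hnorm, integral_mul_const]
    exact ha.norm.mul_left _

theorem integral_twoSidedLaplace_mul_term (hd : ContDiff ℝ (⊤ : ℕ∞) φ)
    (hs : ∀ v, R < |v| → φ v = 0) (a : ℕ → ℂ) (s₀ : ℂ) (c ℓ : ℝ) (k : ℕ) :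
    ∫ y : ℝ, twoSidedLaplace φ (c + y * I) * LSeries.term a (s₀ + (c + y * I) / ℓ) k =
      2 * Real.pi * (φ (Real.log k / ℓ) * LSeries.term a s₀ k) := by
  rcases eq_or_ne k 0 with rfl | hk
  · simp
  have hk₀ : (k : ℂ) ≠ 0 := Nat.cast_ne_zero.mpr hk
  rw [← mul_assoc, ← integral_twoSidedLaplace_mul_cexp hd hs c, ← integral_mul_const]
  refine integral_congr_ae (.of_forall fun y => ?_)
  simp only
  have hexponent : (c + y * I) * ((Real.log k / ℓ : ℝ) : ℂ) =
      (Real.log k : ℂ) * ((c + y * I) / ℓ) := by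
    push_cast; ring
  rw [mul_assoc, LSeries.term_of_ne_zero hk, LSeries.term_of_ne_zero hk, cpow_add _ _ hk₀,
    cpow_def_of_ne_zero hk₀ ((c + y * I) / ℓ), Complex.exp_neg, ← natCast_log, hexponent]
  field_simp

theorem integral_twoSidedLaplace_mul_LSeries (hd : ContDiff ℝ (⊤ : ℕ∞) φ)
    (hs : ∀ v, R < |v| → φ v = 0) {s₀ : ℂ} {c ℓ : ℝ} (ha : LSeriesSummable a (s₀ + c / ℓ))
    {K : ℕ} (hK : ∀ k : ℕ, K < k → φ (Real.log k / ℓ) = 0) :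
    ∫ y : ℝ, twoSidedLaplace φ (c + y * I) * LSeries a (s₀ + (c + y * I) / ℓ) =
      2 * Real.pi * ∑ k ∈ Finset.Icc 1 K, φ (Real.log k / ℓ) * LSeries.term a s₀ k := by
  have hseries := hasSum_integral_twoSidedLaplace_mul_term hd hs ha
  simp_rw [integral_twoSidedLaplace_mul_term hd hs] at hseries
  rw [Finset.mul_sum]
  refine hseries.unique (hasSum_sum_of_ne_finset_zero fun k hk => ?_)
  rcases eq_or_ne k 0 with rfl | hk₀
  · simp
  · have hlt : K < k := not_le.mp fun h => hk (Finset.mem_Icc.mpr ⟨Nat.pos_of_ne_zero hk₀, h⟩)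
    simp [hK k hlt]

theorem one_add_abs_add_div_le {ℓ : ℝ} (hℓ : 1 ≤ ℓ) (t y : ℝ) :
    1 + |t + y / ℓ| ≤ (1 + |t|) * (1 + |y|) := by
  have hdiv : |y / ℓ| ≤ |y| := by
    rw [abs_div, abs_of_pos (one_pos.trans_le hℓ)]
    exact div_le_self (abs_nonneg _) hℓ
  nlinarith [abs_add_le t (y / ℓ), abs_nonneg t, abs_nonneg y]

theorem integral_twoSidedLaplace_mul_eq_of_strip (hd : ContDiff ℝ (⊤ : ℕ∞) φ)
    (hs : ∀ v, R < |v| → φ v = 0) {f : ℂ → ℂ} (hf : Differentiable ℂ f) {s₀ : ℂ} {c ℓ : ℝ}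
    (hc : 0 ≤ c) (hℓ : 1 ≤ ℓ) {C : ℝ} {J : ℕ}
    (hgrowth : ∀ s : ℂ, s₀.re ≤ s.re → s.re ≤ s₀.re + c / ℓ → ‖f s‖ ≤ C * (1 + |s.im|) ^ J) :
    ∫ y : ℝ, twoSidedLaplace φ (y * I) * f (s₀ + y * I / ℓ) =
      ∫ y : ℝ, twoSidedLaplace φ (c + y * I) * f (s₀ + (c + y * I) / ℓ) := by
  have hℓ₀ : 0 < ℓ := one_pos.trans_le hℓ
  have hC : 0 ≤ C := nonneg_of_mul_nonneg_left ((norm_nonneg _).trans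
    (hgrowth s₀ le_rfl (le_add_of_nonneg_right (div_nonneg hc hℓ₀.le)))) (by positivity)
  obtain ⟨C₁, hC₁, hΦ⟩ := exists_norm_twoSidedLaplace_le (J + 2) hd hs
  refine integral_vertical_line_eq (h := fun w => twoSidedLaplace φ w * f (s₀ + w / ℓ))
    ((differentiable_twoSidedLaplace hd.continuous hs).mul (hf.comp (by fun_prop))) hc
    (C := C₁ * Real.exp (|R| * c) * (C * (1 + |s₀.im|) ^ J)) fun x hx y => ?_
  have hΦxy : ‖twoSidedLaplace φ (x + y * I)‖ ≤
      C₁ * Real.exp (|R| * c) / (1 + |y|) ^ (J + 2) := by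
    have hexp : R * |x| ≤ |R| * c := by
      rw [abs_of_nonneg hx.1]
      exact mul_le_mul (le_abs_self R) hx.2 hx.1 (abs_nonneg R)
    refine (hΦ (x + y * I)).trans ?_
    simp only [add_re, ofReal_re, mul_re, I_re, mul_zero, ofReal_im, I_im, mul_one, sub_self,
      add_zero, add_im, mul_im, zero_add]
    gcongr
  have hfxy : ‖f (s₀ + (x + y * I) / ℓ)‖ ≤ C * ((1 + |s₀.im|) * (1 + |y|)) ^ J := by
    have hre : (s₀ + (x + y * I) / ℓ).re = s₀.re + x / ℓ := by simp [div_ofReal_re]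
    have him : (s₀ + (x + y * I) / ℓ).im = s₀.im + y / ℓ := by simp [div_ofReal_im]
    refine (hgrowth _ (hre ▸ le_add_of_nonneg_right (div_nonneg hx.1 hℓ₀.le)) ?_).trans ?_
    · rw [hre]; gcongr; exact hx.2
    · rw [him]; gcongr; exact one_add_abs_add_div_le hℓ _ _
  rw [norm_mul]
  calc ‖twoSidedLaplace φ (x + y * I)‖ * ‖f (s₀ + (x + y * I) / ℓ)‖
      ≤ C₁ * Real.exp (|R| * c) / (1 + |y|) ^ (J + 2) *
          (C * ((1 + |s₀.im|) * (1 + |y|)) ^ J) := by gcongr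
    _ = C₁ * Real.exp (|R| * c) * (C * (1 + |s₀.im|) ^ J) / (1 + |y|) ^ 2 := by
        rw [mul_pow, pow_add]; field_simp
    _ ≤ _ := by gcongr; exact one_add_sq_le_one_add_abs_sq y

theorem norm_integral_twoSidedLaplace_mul_le {β C : ℝ}
    (hΦ : ∀ w : ℂ, ‖twoSidedLaplace φ w‖ ≤ C * Real.exp (R * |w.re|) / (1 + |w.im|) ^ (⌈β⌉₊ + 2))
    (hβ : 0 ≤ β) {f : ℂ → ℂ} {B ℓ : ℝ} (hℓ : 1 ≤ ℓ)
    (hf : ∀ t : ℝ, ‖f (1 / 2 + t * I)‖ ≤ B * (1 + |t|) ^ β) (t : ℝ) :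
    ‖∫ y : ℝ, twoSidedLaplace φ (y * I) * f (1 / 2 + t * I + y * I / ℓ)‖ ≤
      C * (B * (1 + |t|) ^ β) * Real.pi := by
  rw [← integral_univ_inv_one_add_sq, ← integral_const_mul]
  refine norm_integral_le_of_norm_le (integrable_inv_one_add_sq.const_mul _)
    (.of_forall fun y => ?_)
  have hΦy : ‖twoSidedLaplace φ (y * I)‖ ≤ C / (1 + |y|) ^ (⌈β⌉₊ + 2) := by simpa using hΦ (y * I)
  have hC : 0 ≤ C := by simpa using (norm_nonneg _).trans (hΦ 0)
  have hB : 0 ≤ B := by simpa using (norm_nonneg _).trans (hf 0)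
  have hfy : ‖f (1 / 2 + t * I + y * I / ℓ)‖ ≤ B * ((1 + |t|) ^ β * (1 + |y|) ^ ⌈β⌉₊) := by
    have hline : (1 / 2 + t * I + y * I / ℓ : ℂ) = 1 / 2 + ((t + y / ℓ : ℝ) : ℂ) * I := by
      push_cast; ring
    rw [hline]
    refine (hf _).trans ?_
    gcongr
    calc (1 + |t + y / ℓ|) ^ β ≤ ((1 + |t|) * (1 + |y|)) ^ β := by
          gcongr; exact one_add_abs_add_div_le hℓ t y
      _ = (1 + |t|) ^ β * (1 + |y|) ^ β := Real.mul_rpow (by positivity) (by positivity)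
      _ ≤ _ := by
          rw [← Real.rpow_natCast (1 + |y|)]
          gcongr
          · linarith [abs_nonneg y]
          · exact Nat.le_ceil β
  rw [norm_mul]
  calc ‖twoSidedLaplace φ (y * I)‖ * ‖f (1 / 2 + t * I + y * I / ℓ)‖
      ≤ C / (1 + |y|) ^ (⌈β⌉₊ + 2) * (B * ((1 + |t|) ^ β * (1 + |y|) ^ ⌈β⌉₊)) := by gcongr
    _ = C * (B * (1 + |t|) ^ β) * ((1 + |y|) ^ 2)⁻¹ := by rw [pow_add]; field_simp
    _ ≤ _ := by gcongr; exact one_add_sq_le_one_add_abs_sq y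

theorem exists_norm_sum_smooth_mul_term_le (hd : ContDiff ℝ (⊤ : ℕ∞) φ)
    (hs : ∀ v, R < |v| → φ v = 0) {β : ℝ} (hβ : 0 ≤ β) :
    ∃ C : ℝ, 0 ≤ C ∧ ∀ (f : ℂ → ℂ) (a : ℕ → ℂ) (B ℓ : ℝ), 1 ≤ ℓ → Differentiable ℂ f →
      (∃ (C' : ℝ) (J : ℕ), ∀ s : ℂ, 1 / 2 ≤ s.re → s.re ≤ 2 → ‖f s‖ ≤ C' * (1 + |s.im|) ^ J) →
      (∀ s : ℂ, 1 < s.re → LSeriesHasSum a s (f s)) →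
      (∀ t : ℝ, ‖f (1 / 2 + t * I)‖ ≤ B * (1 + |t|) ^ β) →
      ∀ (t : ℝ) (K : ℕ), (∀ k : ℕ, K < k → φ (Real.log k / ℓ) = 0) →
        ‖∑ k ∈ Finset.Icc 1 K, φ (Real.log k / ℓ) * LSeries.term a (1 / 2 + t * I) k‖ ≤
          C * (B * (1 + |t|) ^ β) := by
  obtain ⟨C, hC, hΦ⟩ := exists_norm_twoSidedLaplace_le (⌈β⌉₊ + 2) hd hs
  refine ⟨C, hC, ?_⟩
  rintro f a B ℓ hℓ hf ⟨C', J, hgrowth⟩ hseries hline t K hK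
  have hℓ₀ : ℓ ≠ 0 := (one_pos.trans_le hℓ).ne'
  have hwidth : 3 / 2 * ℓ / ℓ = 3 / 2 := mul_div_cancel_right₀ _ hℓ₀
  have hre (w : ℂ) (hw : w.re = 3 / 2 * ℓ) : 1 < (1 / 2 + t * I + w / ℓ).re := by
    simp [div_ofReal_re, hw, hwidth]; norm_num
  have hshift := integral_twoSidedLaplace_mul_eq_of_strip hd hs hf (s₀ := 1 / 2 + t * I)
    (c := 3 / 2 * ℓ) (by positivity) hℓ fun s h₁ h₂ => hgrowth s (by simpa using h₁)
      (h₂.trans_eq (by rw [hwidth]; simp; norm_num))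
  have hLSeries (y : ℝ) : f (1 / 2 + t * I + ((3 / 2 * ℓ : ℝ) + y * I) / ℓ) =
      LSeries a (1 / 2 + t * I + ((3 / 2 * ℓ : ℝ) + y * I) / ℓ) :=
    ((hseries _ (hre _ (by simp))).LSeries_eq).symm
  simp only [hLSeries] at hshift
  rw [integral_twoSidedLaplace_mul_LSeries hd hs (hseries _ (hre _ (by simp))).LSeriesSummable
    hK] at hshift
  have hbound := norm_integral_twoSidedLaplace_mul_le hΦ hβ hℓ hline t
  have hnorm : ‖(2 * Real.pi : ℂ)‖ = 2 * Real.pi := by simp [Real.pi_pos.le]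
  rw [hshift, norm_mul, hnorm] at hbound
  nlinarith [Real.pi_pos, norm_nonneg
    (∑ k ∈ Finset.Icc 1 K, φ (Real.log k / ℓ) * LSeries.term a (1 / 2 + t * I) k)]

end SmoothSums

section CriticalLine

open MeasureTheory Complex

/-- The character `n ↦ n ^ (-1/2 - it)`, the value of the Dirichlet term at the point `1/2 + it` of
the critical line. -/
noncomputable def critChar (t : ℝ) (n : ℕ) : ℂ := ((√(n : ℝ))⁻¹ : ℝ) * cexp (-(t * Real.log n * I))

theorem norm_critChar (t : ℝ) (n : ℕ) : ‖critChar t n‖ = (√(n : ℝ))⁻¹ := by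
  rw [critChar, norm_mul, norm_real, Real.norm_of_nonneg (by positivity), ← ofReal_mul, ← neg_mul,
    ← ofReal_neg, norm_exp_ofReal_mul_I, mul_one]

theorem mul_critChar (z : ℂ) (t : ℝ) (n : ℕ) :
    z * critChar t n = z * ((√(n : ℝ))⁻¹ : ℝ) * cexp (-(t * Real.log n * I)) := by
  rw [critChar, ← mul_assoc]

theorem norm_mul_inv_sqrt_sq (z : ℂ) (n : ℕ) : ‖z * ((√(n : ℝ))⁻¹ : ℝ)‖ ^ 2 = ‖z‖ ^ 2 / n := by
  rw [norm_mul, norm_real, Real.norm_of_nonneg (by positivity), mul_pow, inv_pow,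
    Real.sq_sqrt (Nat.cast_nonneg n), div_eq_mul_inv]

theorem norm_mul_critChar_sq (z : ℂ) (t : ℝ) (n : ℕ) : ‖z * critChar t n‖ ^ 2 = ‖z‖ ^ 2 / n := by
  rw [norm_mul, norm_critChar, mul_pow, inv_pow, Real.sq_sqrt (Nat.cast_nonneg n), div_eq_mul_inv]

theorem critChar_mul (t : ℝ) {m n : ℕ} (hm : m ≠ 0) (hn : n ≠ 0) :
    critChar t (m * n) = critChar t m * critChar t n := by
  simp only [critChar]
  rw [Nat.cast_mul, Real.sqrt_mul (Nat.cast_nonneg m),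
    Real.log_mul (by exact_mod_cast hm) (by exact_mod_cast hn), mul_inv, mul_mul_mul_comm,
    ← Complex.exp_add]
  push_cast
  congr 2
  ring

theorem critChar_eq_cpow (t : ℝ) {n : ℕ} (hn : n ≠ 0) :
    critChar t n = ((n : ℂ) ^ (1 / 2 + t * I : ℂ))⁻¹ := by
  have cast_ne_zero : (n : ℂ) ≠ 0 := by exact_mod_cast hn
  rw [critChar, cpow_add _ _ cast_ne_zero, mul_inv, cpow_def_of_ne_zero cast_ne_zero (t * I),
    ← Complex.exp_neg, ← natCast_log]
  congr 1
  · rw [Real.sqrt_eq_rpow, ofReal_inv, ofReal_cpow (Nat.cast_nonneg n)]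
    push_cast; rfl
  · congr 1; ring

theorem term_eq_mul_critChar (a : ℕ → ℂ) (t : ℝ) {n : ℕ} (hn : n ≠ 0) :
    LSeries.term a (1 / 2 + t * I) n = a n * critChar t n := by
  rw [LSeries.term_of_ne_zero hn, critChar_eq_cpow t hn, div_eq_mul_inv]

theorem continuous_critChar (n : ℕ) : Continuous fun t => critChar t n := by
  unfold critChar; fun_prop

theorem IsEntireEulerProduct.exists_norm_sum_coprimePart_mul_le {A : ℕ → ℂ} {L : ℂ → ℂ} {d : ℕ}
    (hL : IsEntireEulerProduct A L d) {θ : ℝ} (hθ : IsSubconvexityExponent L θ) {φ : ℝ → ℂ}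
    {R : ℝ} (hd : ContDiff ℝ (⊤ : ℕ∞) φ) (hs : ∀ v, R < |v| → φ v = 0) {ε : ℝ} (hε : 0 < ε) :
    ∃ C : ℝ, 0 ≤ C ∧ ∀ (m : ℕ) (ℓ t : ℝ) (K : ℕ), m ≠ 0 → 1 ≤ ℓ →
      (∀ k : ℕ, K < k → φ (Real.log k / ℓ) = 0) →
      ‖∑ k ∈ Finset.Icc 1 K, coprimePart A m k * φ (Real.log k / ℓ) * critChar t k‖ ≤
        C * ((m : ℝ) ^ ε * (1 + |t|) ^ (θ + ε)) := by
  obtain ⟨C₁, hC₁, norm_sum_le⟩ :=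
    exists_norm_sum_smooth_mul_term_le hd hs (add_nonneg hθ.1 hε.le)
  obtain ⟨C₂, hC₂, two_pow_le⟩ := exists_two_pow_mul_card_primeFactors_le d hε
  obtain ⟨C₃, norm_L_le⟩ := hθ.2 ε hε
  obtain ⟨C₄, J, hC₄, norm_L_le_strip⟩ := hL.exists_norm_le_strip hθ
  have hC₃ : 0 ≤ C₃ := by simpa using (norm_nonneg _).trans (norm_L_le 0)
  refine ⟨C₁ * (C₃ * C₂), by positivity, fun m ℓ t K hm hℓ hK => ?_⟩
  obtain ⟨g, g_entire, norm_g_le, hasSum⟩ := hL.exists_hasSum_coprimePart hm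
  set G : ℝ := (2 : ℝ) ^ (d * m.primeFactors.card)
  have growth (s : ℂ) (h₁ : 1 / 2 ≤ s.re) (h₂ : s.re ≤ 2) :
      ‖L s * g s‖ ≤ C₄ * G * (1 + |s.im|) ^ J := by
    rw [norm_mul, mul_right_comm]
    exact mul_le_mul (norm_L_le_strip s h₁ h₂) (norm_g_le s h₁) (norm_nonneg _) (by positivity)
  have growth_line (t : ℝ) : ‖L (1 / 2 + t * I) * g (1 / 2 + t * I)‖ ≤
      C₃ * G * (1 + |t|) ^ (θ + ε) := by
    rw [norm_mul, mul_right_comm]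
    exact mul_le_mul (norm_L_le t) (norm_g_le _ (by simp)) (norm_nonneg _) (by positivity)
  calc _ = ‖∑ k ∈ Finset.Icc 1 K, φ (Real.log k / ℓ) *
        LSeries.term (coprimePart A m) (1 / 2 + t * I) k‖ := by
        congr 1
        refine Finset.sum_congr rfl fun k hk => ?_
        rw [term_eq_mul_critChar _ t (Nat.one_le_iff_ne_zero.mp (Finset.mem_Icc.mp hk).1)]
        ring
    _ ≤ C₁ * (C₃ * G * (1 + |t|) ^ (θ + ε)) :=
        norm_sum_le (fun s => L s * g s) (coprimePart A m) (C₃ * G) ℓ hℓ (hL.entire.mul g_entire)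
          ⟨C₄ * G, J, growth⟩ hasSum growth_line t K hK
    _ ≤ C₁ * (C₃ * (C₂ * (m : ℝ) ^ ε) * (1 + |t|) ^ (θ + ε)) := by
        gcongr
        exact two_pow_le m hm
    _ = _ := by ring

end CriticalLine

section CoprimeSeparation

open ArithmeticFunction in
theorem sum_moebius_ite_dvd_eq {m k N : ℕ} (hm : m ≠ 0) (hmN : m ≤ N) :
    ∑ e ∈ Finset.Icc 1 N, (if e ∣ m ∧ e ∣ k then ((moebius e : ℤ) : ℂ) else 0) =
      if m.Coprime k then 1 else 0 := by
  have filter_eq : (Finset.Icc 1 N).filter (fun e => e ∣ m ∧ e ∣ k) = (m.gcd k).divisors := by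
    ext e
    simp only [Finset.mem_filter, Finset.mem_Icc, Nat.mem_divisors, Nat.dvd_gcd_iff]
    constructor
    · rintro ⟨_, h⟩
      exact ⟨h, fun hg => hm (Nat.eq_zero_of_gcd_eq_zero_left hg)⟩
    · rintro ⟨h, _⟩
      exact ⟨⟨Nat.pos_of_dvd_of_pos h.1 (Nat.pos_of_ne_zero hm),
        (Nat.le_of_dvd (Nat.pos_of_ne_zero hm) h.1).trans hmN⟩, h⟩
  have sum_eq : ∑ e ∈ (m.gcd k).divisors, moebius e = if m.gcd k = 1 then 1 else 0 := by
    rw [← coe_mul_zeta_apply, moebius_mul_coe_zeta, one_apply]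
  rw [← Finset.sum_filter, filter_eq, ← Int.cast_sum, sum_eq]
  simp only [Nat.Coprime]
  split_ifs <;> simp

theorem norm_sum_mul_sq_le {ι : Type*} (s : Finset ι) (f g : ι → ℂ) :
    ‖∑ i ∈ s, f i * g i‖ ^ 2 ≤ (∑ i ∈ s, ‖f i‖ ^ 2) * ∑ i ∈ s, ‖g i‖ ^ 2 := by
  calc ‖∑ i ∈ s, f i * g i‖ ^ 2 ≤ (∑ i ∈ s, ‖f i‖ * ‖g i‖) ^ 2 := by
        gcongr
        refine (norm_sum_le _ _).trans_eq ?_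
        simp_rw [norm_mul]
    _ ≤ _ := Finset.sum_mul_sq_le_sq_mul_sq _ _ _

theorem sum_sum_ite_coprime_eq (S T : Finset ℕ) (u v : ℕ → ℂ) {N : ℕ}
    (hS : ∀ m ∈ S, m ≠ 0 ∧ m ≤ N) :
    ∑ m ∈ S, ∑ k ∈ T, (if m.Coprime k then u m * v k else 0) =
      ∑ e ∈ Finset.Icc 1 N, (((ArithmeticFunction.moebius e : ℤ) : ℂ) * ∑ m ∈ S with e ∣ m, u m) *
        ∑ k ∈ T with e ∣ k, v k := by
  have product_eq (e : ℕ) : (((ArithmeticFunction.moebius e : ℤ) : ℂ) *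
      ∑ m ∈ S with e ∣ m, u m) * ∑ k ∈ T with e ∣ k, v k = ∑ m ∈ S, ∑ k ∈ T,
        (if e ∣ m ∧ e ∣ k then ((ArithmeticFunction.moebius e : ℤ) : ℂ) else 0) * (u m * v k) := by
    rw [Finset.sum_filter, Finset.sum_filter, mul_assoc, Finset.sum_mul_sum, Finset.mul_sum]
    refine Finset.sum_congr rfl fun m _ => ?_
    rw [Finset.mul_sum]
    refine Finset.sum_congr rfl fun k _ => ?_
    by_cases h1 : e ∣ m <;> by_cases h2 : e ∣ k <;> simp [h1, h2]
  simp only [product_eq]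
  symm
  rw [Finset.sum_comm]
  refine Finset.sum_congr rfl fun m hm => ?_
  rw [Finset.sum_comm]
  refine Finset.sum_congr rfl fun k _ => ?_
  rw [← Finset.sum_mul, sum_moebius_ite_dvd_eq (hS m hm).1 (hS m hm).2, ite_mul, one_mul, zero_mul]

theorem norm_sum_sum_ite_coprime_sq_le (S T : Finset ℕ) (u v : ℕ → ℂ) {N : ℕ}
    (hS : ∀ m ∈ S, m ≠ 0 ∧ m ≤ N) :
    ‖∑ m ∈ S, ∑ k ∈ T, if m.Coprime k then u m * v k else 0‖ ^ 2 ≤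
      (∑ e ∈ Finset.Icc 1 N, ‖∑ m ∈ S with e ∣ m, u m‖ ^ 2) *
        ∑ e ∈ Finset.Icc 1 N, ‖∑ k ∈ T with e ∣ k, v k‖ ^ 2 := by
  rw [sum_sum_ite_coprime_eq S T u v hS]
  refine (norm_sum_mul_sq_le _ _ _).trans ?_
  gcongr with e
  rw [norm_mul, Complex.norm_intCast]
  refine mul_le_of_le_one_left (norm_nonneg _) ?_
  exact_mod_cast ArithmeticFunction.abs_moebius_le_one

theorem card_filter_dvd_le (S : Finset ℕ) {N e : ℕ} (hS : ∀ m ∈ S, m ≠ 0 ∧ m ≤ N) :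
    ((S.filter (e ∣ ·)).card : ℝ) ≤ N / e := by
  have card_le : (S.filter (e ∣ ·)).card ≤ N / e := by
    rw [← Nat.Ioc_filter_dvd_card_eq_div]
    refine Finset.card_le_card fun m hm => ?_
    obtain ⟨mem, dvd⟩ := Finset.mem_filter.mp hm
    exact Finset.mem_filter.mpr
      ⟨Finset.mem_Ioc.mpr ⟨Nat.pos_of_ne_zero (hS m mem).1, (hS m mem).2⟩, dvd⟩
  calc ((S.filter (e ∣ ·)).card : ℝ) ≤ ((N / e : ℕ) : ℝ) := by exact_mod_cast card_le
    _ ≤ _ := Nat.cast_div_le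

theorem sum_sum_filter_dvd_le (E S : Finset ℕ) (f : ℕ → ℝ) (hf : ∀ m ∈ S, 0 ≤ f m)
    (hS : ∀ m ∈ S, m ≠ 0) :
    ∑ e ∈ E, ∑ m ∈ S with e ∣ m, f m ≤ ∑ m ∈ S, (m.divisors.card : ℝ) * f m := by
  simp_rw [Finset.sum_filter]
  rw [Finset.sum_comm]
  refine Finset.sum_le_sum fun m hm => ?_
  rw [← Finset.sum_filter, Finset.sum_const, nsmul_eq_mul]
  refine mul_le_mul_of_nonneg_right ?_ (hf m hm)
  exact_mod_cast Finset.card_le_card fun e he =>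
    Nat.mem_divisors.mpr ⟨(Finset.mem_filter.mp he).2, hS m hm⟩

theorem sum_norm_sq_filter_dvd_le (S E : Finset ℕ) (u : ℕ → ℂ) {N : ℕ} {r : ℝ} (hr : 0 < r)
    (hS : ∀ m ∈ S, m ≠ 0 ∧ m ≤ N) (hE : ∀ e ∈ E, r ≤ e) :
    ∑ e ∈ E, ‖∑ m ∈ S with e ∣ m, u m‖ ^ 2 ≤
      N / r * ∑ m ∈ S, (m.divisors.card : ℝ) * ‖u m‖ ^ 2 := by
  calc ∑ e ∈ E, ‖∑ m ∈ S with e ∣ m, u m‖ ^ 2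
      ≤ ∑ e ∈ E, N / r * ∑ m ∈ S with e ∣ m, ‖u m‖ ^ 2 := by
        refine Finset.sum_le_sum fun e he => ?_
        have cauchySchwarz := norm_sum_mul_sq_le (S.filter (e ∣ ·)) (fun _ => 1) u
        simp only [one_mul, norm_one, one_pow, Finset.sum_const, nsmul_eq_mul, mul_one]
          at cauchySchwarz
        refine cauchySchwarz.trans ?_
        gcongr
        refine (card_filter_dvd_le S hS).trans ?_
        gcongr
        exact hE e he
    _ = N / r * ∑ e ∈ E, ∑ m ∈ S with e ∣ m, ‖u m‖ ^ 2 := by rw [Finset.mul_sum]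
    _ ≤ _ := by
        gcongr
        exact sum_sum_filter_dvd_le E S _ (fun _ _ => by positivity) fun m hm => (hS m hm).1

end CoprimeSeparation

section DirichletPolynomials

open MeasureTheory Complex

/-- The Dirichlet polynomial `∑_{k ∈ S} b(k) k^{-s}` at the point `s = 1/2 + it`. -/
noncomputable def critPoly (S : Finset ℕ) (b : ℕ → ℂ) (t : ℝ) : ℂ := ∑ k ∈ S, b k * critChar t k

theorem norm_critPoly_le (S : Finset ℕ) (b : ℕ → ℂ) (t : ℝ) :
    ‖critPoly S b t‖ ≤ ∑ k ∈ S, ‖b k‖ * (√(k : ℝ))⁻¹ := by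
  refine (norm_sum_le _ _).trans_eq (Finset.sum_congr rfl fun k _ => ?_)
  rw [norm_mul, norm_critChar]

theorem continuous_critPoly (S : Finset ℕ) (b : ℕ → ℂ) : Continuous (critPoly S b) :=
  continuous_finsetSum _ fun k _ => continuous_const.mul (continuous_critChar k)

theorem integrable_norm_critPoly_pow_div (S : Finset ℕ) (b : ℕ → ℂ) (j : ℕ) {r : ℝ} (hr : 0 < r) :
    Integrable fun t : ℝ => ‖critPoly S b t‖ ^ j / (r ^ 2 + t ^ 2) := by
  refine ((integrable_inv_sq_add_sq hr).const_mul
    ((∑ k ∈ S, ‖b k‖ * (√(k : ℝ))⁻¹) ^ j)).mono' ?_ (.of_forall fun t => ?_)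
  · exact (((continuous_critPoly S b).norm.pow j).div (by fun_prop)
      fun t => by positivity).aestronglyMeasurable
  · rw [Real.norm_of_nonneg (by positivity), mul_one_div]
    gcongr
    exact norm_critPoly_le S b t

theorem card_piFinset_prod_eq_le (S : Finset ℕ) (k : ℕ) {n : ℕ} (hn : n ≠ 0) :
    ((Fintype.piFinset fun _ : Fin k => S).filter fun τ => ∏ i, τ i = n).card ≤
      n.divisors.card ^ k := by
  calc _ ≤ (Fintype.piFinset fun _ : Fin k => n.divisors).card := by
        refine Finset.card_le_card fun τ hτ => Fintype.mem_piFinset.mpr fun i => ?_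
        exact Nat.mem_divisors.mpr
          ⟨(Finset.mem_filter.mp hτ).2 ▸ Finset.dvd_prod_of_mem τ (Finset.mem_univ i), hn⟩
    _ = _ := by simp [Fintype.card_piFinset]

theorem sum_piFinset_norm_prod_sq_eq (S : Finset ℕ) (b : ℕ → ℂ) (k : ℕ) :
    ∑ τ ∈ Fintype.piFinset (fun _ : Fin k => S),
      ‖∏ i, (b (τ i) * ((√(τ i : ℝ))⁻¹ : ℝ))‖ ^ 2 = (∑ m ∈ S, ‖b m‖ ^ 2 / m) ^ k := by
  calc _ = ∑ τ ∈ Fintype.piFinset (fun _ : Fin k => S), ∏ i, (‖b (τ i)‖ ^ 2 / (τ i : ℝ)) := by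
        refine Finset.sum_congr rfl fun τ _ => ?_
        rw [norm_prod, ← Finset.prod_pow]
        simp_rw [norm_mul_inv_sqrt_sq]
    _ = ∏ _i : Fin k, ∑ m ∈ S, ‖b m‖ ^ 2 / m :=
        (Finset.prod_univ_sum (fun _ => S) fun _ m => ‖b m‖ ^ 2 / (m : ℝ)).symm
    _ = _ := by simp

theorem critPoly_pow_eq {S : Finset ℕ} (hS : ∀ m ∈ S, m ≠ 0) (b : ℕ → ℂ) (k : ℕ) (t : ℝ) :
    critPoly S b t ^ k = ∑ τ ∈ Fintype.piFinset (fun _ : Fin k => S),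
      (∏ i, (b (τ i) * ((√(τ i : ℝ))⁻¹ : ℝ))) * cexp (-(t * Real.log (∏ i, τ i : ℕ) * I)) := by
  calc _ = ∏ _i : Fin k, ∑ m ∈ S, b m * critChar t m := by simp [critPoly]
    _ = ∑ τ ∈ Fintype.piFinset (fun _ : Fin k => S), ∏ i, (b (τ i) * critChar t (τ i)) :=
        Finset.prod_univ_sum (fun _ => S) fun _ m => b m * critChar t m
    _ = _ := by
        refine Finset.sum_congr rfl fun τ hτ => ?_
        have τ_ne_zero (i : Fin k) : (τ i : ℝ) ≠ 0 := by
          exact_mod_cast hS _ (Fintype.mem_piFinset.mp hτ i)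
        simp_rw [mul_critChar]
        rw [Finset.prod_mul_distrib (g := fun i => cexp _), ← Complex.exp_sum, Nat.cast_prod,
          Real.log_prod fun i _ => τ_ne_zero i]
        push_cast
        rw [Finset.sum_neg_distrib, Finset.mul_sum, Finset.sum_mul]

theorem integral_norm_critPoly_pow_div_le (S : Finset ℕ) (b : ℕ → ℂ) {N : ℕ}
    (hS : ∀ m ∈ S, m ≠ 0 ∧ m ≤ N) (k : ℕ) {D : ℝ}
    (hD : ∀ n : ℕ, n ≠ 0 → n ≤ N ^ k → (n.divisors.card : ℝ) ^ k ≤ D) {T : ℝ} (hT : 0 < T) :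
    ∫ t : ℝ, ‖critPoly S b t‖ ^ (2 * k) / (T ^ 2 + t ^ 2) ≤
      Real.pi / T * (D * (1 + 2 * (N : ℝ) ^ k / T)) * (∑ m ∈ S, ‖b m‖ ^ 2 / m) ^ k := by
  have meanValue := integral_norm_sq_dirichletPoly_div_le hT (Fintype.piFinset fun _ : Fin k => S)
    (fun τ => ∏ i, (b (τ i) * ((√(τ i : ℝ))⁻¹ : ℝ))) (fun τ => ∏ i, τ i) (N := N ^ k)
    (fun τ hτ => by
      have hτ (i : Fin k) := hS _ (Fintype.mem_piFinset.mp hτ i)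
      refine ⟨Nat.one_le_iff_ne_zero.mpr (Finset.prod_ne_zero_iff.mpr fun i _ => (hτ i).1), ?_⟩
      calc ∏ i, τ i ≤ ∏ _i : Fin k, N := Finset.prod_le_prod' fun i _ => (hτ i).2
        _ = _ := by simp)
    (D := D) (fun n hn => by
      obtain ⟨one_le_n, n_le⟩ := Finset.mem_Icc.mp hn
      have n_ne_zero : n ≠ 0 := Nat.one_le_iff_ne_zero.mp one_le_n
      refine le_trans ?_ (hD n n_ne_zero n_le)
      exact_mod_cast card_piFinset_prod_eq_le S k n_ne_zero)
  rw [sum_piFinset_norm_prod_sq_eq] at meanValue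
  simp_rw [← critPoly_pow_eq (fun m hm => (hS m hm).1), norm_pow] at meanValue
  push_cast at meanValue
  calc _ = ∫ t : ℝ, (‖critPoly S b t‖ ^ k) ^ 2 / (T ^ 2 + t ^ 2) := by
        simp_rw [← pow_mul, mul_comm k 2]
    _ ≤ _ := meanValue

/-- The points of `[-T, T]` at which the square of the Dirichlet polynomial exceeds `W`. -/
def largeValues (S : Finset ℕ) (b : ℕ → ℂ) (T W : ℝ) : Set ℝ :=
  {t : ℝ | |t| ≤ T ∧ W < ‖critPoly S b t‖ ^ 2}

theorem largeValues_subset_Icc (S : Finset ℕ) (b : ℕ → ℂ) (T W : ℝ) :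
    largeValues S b T W ⊆ Set.Icc (-T) T := fun _ ht => abs_le.mp ht.1

theorem measurableSet_largeValues (S : Finset ℕ) (b : ℕ → ℂ) (T W : ℝ) :
    MeasurableSet (largeValues S b T W) :=
  (isClosed_le continuous_abs continuous_const).measurableSet.inter
    (isOpen_lt continuous_const ((continuous_critPoly S b).norm.pow 2)).measurableSet

theorem volume_largeValues_le (S : Finset ℕ) (b : ℕ → ℂ) {N : ℕ} (hS : ∀ m ∈ S, m ≠ 0 ∧ m ≤ N)
    (k : ℕ) {D : ℝ} (hD : ∀ n : ℕ, n ≠ 0 → n ≤ N ^ k → (n.divisors.card : ℝ) ^ k ≤ D) {T W : ℝ}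
    (hT : 0 < T) (hW : 0 < W) :
    volume.real (largeValues S b T W) ≤
      2 * Real.pi * D * (T + 2 * (N : ℝ) ^ k) * ((∑ m ∈ S, ‖b m‖ ^ 2 / m) / W) ^ k := by
  have volume_ne_top : volume (largeValues S b T W) ≠ ⊤ :=
    ((measure_mono (largeValues_subset_Icc S b T W)).trans_lt measure_Icc_lt_top).ne
  have integrable := integrable_norm_critPoly_pow_div S b (2 * k) hT
  have chebyshev : volume.real (largeValues S b T W) * (W ^ k / (2 * T ^ 2)) ≤
      ∫ t : ℝ, ‖critPoly S b t‖ ^ (2 * k) / (T ^ 2 + t ^ 2) := by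
    calc _ = ∫ _t in largeValues S b T W, W ^ k / (2 * T ^ 2) := by
          rw [setIntegral_const, smul_eq_mul]
      _ ≤ ∫ t in largeValues S b T W, ‖critPoly S b t‖ ^ (2 * k) / (T ^ 2 + t ^ 2) := by
          refine setIntegral_mono_on (integrableOn_const volume_ne_top) integrable.integrableOn
            (measurableSet_largeValues S b T W) fun t ht => ?_
          have sq_le : t ^ 2 ≤ T ^ 2 := sq_le_sq' (abs_le.mp ht.1).1 (abs_le.mp ht.1).2
          rw [pow_mul]
          exact div_le_div₀ (by positivity) (pow_le_pow_left₀ hW.le ht.2.le k) (by positivity)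
            (by linarith)
      _ ≤ _ := setIntegral_le_integral integrable (.of_forall fun t => by positivity)
  have bound := chebyshev.trans (integral_norm_critPoly_pow_div_le S b hS k hD hT)
  rw [← le_div_iff₀ (by positivity)] at bound
  refine bound.trans_eq ?_
  rw [div_pow]
  field_simp

end DirichletPolynomials

section DivisorSums

open MeasureTheory Complex

theorem integrable_sum_norm_critPoly_filter_dvd_sq_div (E Q : Finset ℕ) (b : ℕ → ℂ) {r : ℝ}
    (hr : 0 < r) :
    Integrable fun t : ℝ =>
      (∑ e ∈ E, ‖critPoly (Q.filter (e ∣ ·)) b t‖ ^ 2) / (r ^ 2 + t ^ 2) := by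
  simp_rw [Finset.sum_div]
  exact integrable_finsetSum _ fun e _ => integrable_norm_critPoly_pow_div _ b 2 hr

theorem integral_norm_critPoly_sq_div_le (Q : Finset ℕ) (b : ℕ → ℂ) {K : ℕ}
    (hQ : ∀ k ∈ Q, 1 ≤ k ∧ k ≤ K) {r : ℝ} (hr : 0 < r) :
    ∫ t : ℝ, ‖critPoly Q b t‖ ^ 2 / (r ^ 2 + t ^ 2) ≤
      Real.pi / r * (1 + 2 * K / r) * ∑ k ∈ Q, ‖b k‖ ^ 2 / k := by
  have meanValue := integral_norm_sq_dirichletPoly_div_le hr Q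
    (fun k => b k * ((√(k : ℝ))⁻¹ : ℝ)) id hQ (D := 1) fun n _ => by
      rw [Nat.cast_le_one, Finset.card_le_one]
      exact fun x hx y hy => (Finset.mem_filter.mp hx).2.trans (Finset.mem_filter.mp hy).2.symm
  simp only [id, norm_mul_inv_sqrt_sq, one_mul] at meanValue
  simp only [critPoly, mul_critChar]
  exact meanValue

theorem integral_sum_norm_critPoly_filter_dvd_sq_div_le (E Q : Finset ℕ) (b : ℕ → ℂ) {K : ℕ}
    (hQ : ∀ k ∈ Q, 1 ≤ k ∧ k ≤ K) {r : ℝ} (hr : 0 < r) :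
    ∫ t : ℝ, (∑ e ∈ E, ‖critPoly (Q.filter (e ∣ ·)) b t‖ ^ 2) / (r ^ 2 + t ^ 2) ≤
      Real.pi / r * (1 + 2 * K / r) * ∑ k ∈ Q, (k.divisors.card : ℝ) * (‖b k‖ ^ 2 / k) := by
  simp_rw [Finset.sum_div]
  rw [integral_finsetSum _ fun e _ => integrable_norm_critPoly_pow_div _ b 2 hr]
  calc _ ≤ ∑ e ∈ E, Real.pi / r * (1 + 2 * K / r) * ∑ k ∈ Q with e ∣ k, ‖b k‖ ^ 2 / k :=
        Finset.sum_le_sum fun e _ => integral_norm_critPoly_sq_div_le _ b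
          (fun k hk => hQ k (Finset.mem_filter.mp hk).1) hr
    _ = Real.pi / r * (1 + 2 * K / r) * ∑ e ∈ E, ∑ k ∈ Q with e ∣ k, ‖b k‖ ^ 2 / k := by
        rw [Finset.mul_sum]
    _ ≤ _ := by
        gcongr
        exact sum_sum_filter_dvd_le E Q _ (fun _ _ => by positivity) fun k hk =>
          Nat.one_le_iff_ne_zero.mp (hQ k hk).1

variable {S : Finset ℕ} {u : ℕ → ℂ} {N : ℕ} {C : ℝ}

theorem sum_norm_critPoly_filter_dvd_sq_le (hS : ∀ m ∈ S, m ≠ 0 ∧ m ≤ N)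
    (hC : ∑ m ∈ S, (m.divisors.card : ℝ) * (‖u m‖ ^ 2 / m) ≤ C) {E : Finset ℕ} {q : ℝ} (hq : 0 < q)
    (hE : ∀ e ∈ E, q ≤ e) (t : ℝ) :
    ∑ e ∈ E, ‖critPoly (S.filter (e ∣ ·)) u t‖ ^ 2 ≤ N / q * C := by
  refine (sum_norm_sq_filter_dvd_le S E (fun m => u m * critChar t m) hq hS hE).trans ?_
  simp_rw [norm_mul_critChar_sq]
  gcongr

theorem sum_filter_dvd_norm_sq_div_le (hS : ∀ m ∈ S, m ≠ 0 ∧ m ≤ N)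
    (hC : ∑ m ∈ S, (m.divisors.card : ℝ) * (‖u m‖ ^ 2 / m) ≤ C) (e : ℕ) :
    ∑ m ∈ S with e ∣ m, ‖u m‖ ^ 2 / (m : ℝ) ≤ C := by
  refine le_trans ?_ hC
  refine (Finset.sum_le_sum_of_subset_of_nonneg (Finset.filter_subset _ _)
    fun _ _ _ => by positivity).trans (Finset.sum_le_sum fun m hm => ?_)
  refine le_mul_of_one_le_left (by positivity) ?_
  exact_mod_cast Finset.card_pos.mpr ⟨1, Nat.one_mem_divisors.mpr (hS m hm).1⟩

/-- The points of `[-T, T]` at which the subsum over the multiples of some `e < q` has square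
exceeding `W`. -/
def exceptionalSet (S : Finset ℕ) (u : ℕ → ℂ) (N : ℕ) (q T W : ℝ) : Set ℝ :=
  ⋃ e ∈ (Finset.Icc 1 N).filter fun e : ℕ => (e : ℝ) < q, largeValues (S.filter (e ∣ ·)) u T W

theorem measurableSet_exceptionalSet (S : Finset ℕ) (u : ℕ → ℂ) (N : ℕ) (q T W : ℝ) :
    MeasurableSet (exceptionalSet S u N q T W) :=
  Finset.measurableSet_biUnion _ fun _ _ => measurableSet_largeValues _ u T W

theorem volume_exceptionalSet_ne_top (S : Finset ℕ) (u : ℕ → ℂ) (N : ℕ) (q T W : ℝ) :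
    volume (exceptionalSet S u N q T W) ≠ ⊤ :=
  ((measure_mono (Set.iUnion₂_subset fun _ _ => largeValues_subset_Icc _ u T W)).trans_lt
    measure_Icc_lt_top).ne

theorem card_filter_lt_le (N : ℕ) {q : ℝ} (hq : 0 ≤ q) :
    (((Finset.Icc 1 N).filter fun e : ℕ => (e : ℝ) < q).card : ℝ) ≤ q := by
  have subset : (Finset.Icc 1 N).filter (fun e : ℕ => (e : ℝ) < q) ⊆ Finset.Ioc 0 ⌊q⌋₊ :=
    fun e he => by
      obtain ⟨mem, lt⟩ := Finset.mem_filter.mp he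
      exact Finset.mem_Ioc.mpr ⟨(Finset.mem_Icc.mp mem).1, Nat.le_floor lt.le⟩
  calc _ ≤ (⌊q⌋₊ : ℝ) := by exact_mod_cast (Finset.card_le_card subset).trans_eq (by simp)
    _ ≤ q := Nat.floor_le hq

theorem volume_exceptionalSet_le (hS : ∀ m ∈ S, m ≠ 0 ∧ m ≤ N)
    (hC : ∑ m ∈ S, (m.divisors.card : ℝ) * (‖u m‖ ^ 2 / m) ≤ C) (j : ℕ) {D : ℝ} (hD₀ : 0 ≤ D)
    (hD : ∀ n : ℕ, n ≠ 0 → n ≤ N ^ j → (n.divisors.card : ℝ) ^ j ≤ D) {q T W : ℝ} (hq : 0 ≤ q)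
    (hT : 0 < T) (hW : 0 < W) :
    volume.real (exceptionalSet S u N q T W) ≤
      q * (2 * Real.pi * D * (T + 2 * (N : ℝ) ^ j) * (C / W) ^ j) := by
  have hC₀ : 0 ≤ C := le_trans (Finset.sum_nonneg fun _ _ => by positivity) hC
  calc _ ≤ ∑ e ∈ (Finset.Icc 1 N).filter fun e : ℕ => (e : ℝ) < q,
        volume.real (largeValues (S.filter (e ∣ ·)) u T W) := measureReal_biUnion_finset_le _ _
    _ ≤ ∑ _e ∈ (Finset.Icc 1 N).filter fun e : ℕ => (e : ℝ) < q,
        2 * Real.pi * D * (T + 2 * (N : ℝ) ^ j) * (C / W) ^ j := by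
        refine Finset.sum_le_sum fun e _ => (volume_largeValues_le _ u
          (fun m hm => hS m (Finset.mem_filter.mp hm).1) j hD hT hW).trans ?_
        gcongr
        exact sum_filter_dvd_norm_sq_div_le hS hC e
    _ ≤ _ := by
        rw [Finset.sum_const, nsmul_eq_mul]
        exact mul_le_mul_of_nonneg_right (card_filter_lt_le N hq) (by positivity)

theorem sum_norm_critPoly_filter_dvd_sq_le_of_notMem_exceptionalSet
    (hS : ∀ m ∈ S, m ≠ 0 ∧ m ≤ N) (hC : ∑ m ∈ S, (m.divisors.card : ℝ) * (‖u m‖ ^ 2 / m) ≤ C)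
    {q T W t : ℝ} (hq : 0 < q) (hW : 0 ≤ W) (ht : |t| ≤ T) (ht' : t ∉ exceptionalSet S u N q T W) :
    ∑ e ∈ Finset.Icc 1 N, ‖critPoly (S.filter (e ∣ ·)) u t‖ ^ 2 ≤ N / q * C + q * W := by
  rw [← Finset.sum_filter_add_sum_filter_not (Finset.Icc 1 N) (fun e : ℕ => (e : ℝ) < q), add_comm]
  refine add_le_add (sum_norm_critPoly_filter_dvd_sq_le hS hC hq
    (fun e he => not_lt.mp (Finset.mem_filter.mp he).2) t) ?_
  calc _ ≤ ∑ _e ∈ (Finset.Icc 1 N).filter fun e : ℕ => (e : ℝ) < q, W := by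
        refine Finset.sum_le_sum fun e he => ?_
        by_contra! h
        exact ht' (Set.mem_biUnion he ⟨ht, h⟩)
    _ ≤ q * W := by
        rw [Finset.sum_const, nsmul_eq_mul]
        exact mul_le_mul_of_nonneg_right (card_filter_lt_le N hq.le) hW

end DivisorSums

section BilinearForms

open MeasureTheory Complex

theorem div_sq_add_sq_le_add_add_indicator {f Φ Λ Φ₁ Φ₂ P T r t : ℝ} {U : Set ℝ} (hf : f ≤ Φ * Λ)
    (hΛ : 0 ≤ Λ) (hΦ₁ : 0 ≤ Φ₁) (hΦ₂ : 0 ≤ Φ₂) (hP : 0 ≤ P) (hT : 0 < T) (hr : 0 < r)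
    (h₁ : t ∉ U → |t| ≤ T → Φ ≤ Φ₁) (h₂ : Φ ≤ Φ₂) (h₃ : |t| ≤ T → f ≤ P) :
    f / (r ^ 2 + t ^ 2) ≤ Φ₁ * (Λ / (r ^ 2 + t ^ 2)) + 2 * Φ₂ * (Λ / (T ^ 2 + t ^ 2)) +
      U.indicator (fun _ => P / r ^ 2) t := by
  have nonneg₁ : 0 ≤ Φ₁ * (Λ / (r ^ 2 + t ^ 2)) := by positivity
  have nonneg₂ : 0 ≤ 2 * Φ₂ * (Λ / (T ^ 2 + t ^ 2)) := by positivity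
  have nonneg₃ : 0 ≤ U.indicator (fun _ => P / r ^ 2) t :=
    Set.indicator_nonneg (fun _ _ => by positivity) t
  rcases le_or_gt |t| T with ht | ht
  · by_cases mem : t ∈ U
    · have large_le : f / (r ^ 2 + t ^ 2) ≤ U.indicator (fun _ => P / r ^ 2) t := by
        rw [Set.indicator_of_mem mem]
        exact div_le_div₀ hP (h₃ ht) (by positivity) (by nlinarith [sq_nonneg t])
      linarith
    · have small_le : f / (r ^ 2 + t ^ 2) ≤ Φ₁ * (Λ / (r ^ 2 + t ^ 2)) := by
        rw [← mul_div_assoc]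
        gcongr
        exact hf.trans (mul_le_mul_of_nonneg_right (h₁ mem ht) hΛ)
      linarith
  · have sq_le : T ^ 2 ≤ t ^ 2 := by
      rw [← sq_abs t]
      exact pow_le_pow_left₀ hT.le ht.le 2
    have tail_le : f / (r ^ 2 + t ^ 2) ≤ 2 * Φ₂ * (Λ / (T ^ 2 + t ^ 2)) := by
      calc f / (r ^ 2 + t ^ 2) ≤ Φ₂ * Λ / ((T ^ 2 + t ^ 2) / 2) :=
            div_le_div₀ (by positivity) (hf.trans (mul_le_mul_of_nonneg_right h₂ hΛ))
              (by positivity) (by nlinarith [sq_nonneg r])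
        _ = _ := by field_simp
    linarith

theorem integral_div_sq_add_sq_le_of_exceptional {f Φ Λ : ℝ → ℝ} (hf₀ : ∀ t, 0 ≤ f t)
    (hf : ∀ t, f t ≤ Φ t * Λ t) (hΛ : ∀ t, 0 ≤ Λ t) {Φ₁ Φ₂ P T r : ℝ} (hΦ₁ : 0 ≤ Φ₁)
    (hΦ₂ : 0 ≤ Φ₂) (hP : 0 ≤ P) (hT : 0 < T) (hr : 0 < r) {U : Set ℝ} (hU : MeasurableSet U)
    (hU' : volume U ≠ ⊤) (h₁ : ∀ t, t ∉ U → |t| ≤ T → Φ t ≤ Φ₁) (h₂ : ∀ t, Φ t ≤ Φ₂)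
    (h₃ : ∀ t, |t| ≤ T → f t ≤ P) (hΛr : Integrable fun t => Λ t / (r ^ 2 + t ^ 2))
    (hΛT : Integrable fun t => Λ t / (T ^ 2 + t ^ 2)) :
    ∫ t, f t / (r ^ 2 + t ^ 2) ≤ Φ₁ * (∫ t, Λ t / (r ^ 2 + t ^ 2)) +
      2 * Φ₂ * (∫ t, Λ t / (T ^ 2 + t ^ 2)) + P / r ^ 2 * volume.real U := by
  have integrable_indicator : Integrable (U.indicator fun _ => P / r ^ 2) :=
    (integrable_indicator_iff hU).mpr (integrableOn_const hU')
  have integrable_add : Integrable fun t =>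
      Φ₁ * (Λ t / (r ^ 2 + t ^ 2)) + 2 * Φ₂ * (Λ t / (T ^ 2 + t ^ 2)) :=
    (hΛr.const_mul Φ₁).add (hΛT.const_mul (2 * Φ₂))
  calc _ ≤ ∫ t, (Φ₁ * (Λ t / (r ^ 2 + t ^ 2)) + 2 * Φ₂ * (Λ t / (T ^ 2 + t ^ 2)) +
        U.indicator (fun _ => P / r ^ 2) t) :=
        integral_mono_of_nonneg (.of_forall fun t => div_nonneg (hf₀ t) (by positivity))
          (integrable_add.add integrable_indicator) (.of_forall fun t =>
            div_sq_add_sq_le_add_add_indicator (hf t) (hΛ t) hΦ₁ hΦ₂ hP hT hr (h₁ t) (h₂ t) (h₃ t))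
    _ = _ := by
        rw [integral_add integrable_add integrable_indicator,
          integral_add (hΛr.const_mul Φ₁) (hΛT.const_mul (2 * Φ₂)), integral_const_mul,
          integral_const_mul, integral_indicator hU, setIntegral_const, smul_eq_mul,
          mul_comm (volume.real U)]

/-- The bilinear Dirichlet polynomial `∑ u(m) v(k) (mk)^{-s}` over coprime pairs `(m, k) ∈ S × Q`
at the point `s = 1/2 + it`. -/
noncomputable def coprimeCritPoly (S Q : Finset ℕ) (u v : ℕ → ℂ) (t : ℝ) : ℂ :=
  ∑ m ∈ S, ∑ k ∈ Q, if m.Coprime k then (u m * critChar t m) * (v k * critChar t k) else 0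

theorem integral_norm_coprimeCritPoly_sq_div_le (S Q : Finset ℕ) (u v : ℕ → ℂ) {N K : ℕ}
    (hS : ∀ m ∈ S, m ≠ 0 ∧ m ≤ N) (hQ : ∀ k ∈ Q, 1 ≤ k ∧ k ≤ K) {CN CK P T r q W D : ℝ}
    (hCN : ∑ m ∈ S, (m.divisors.card : ℝ) * (‖u m‖ ^ 2 / m) ≤ CN)
    (hCK : ∑ k ∈ Q, (k.divisors.card : ℝ) * (‖v k‖ ^ 2 / k) ≤ CK) (j : ℕ) (hD₀ : 0 ≤ D)
    (hD : ∀ n : ℕ, n ≠ 0 → n ≤ N ^ j → (n.divisors.card : ℝ) ^ j ≤ D) (hT : 0 < T) (hr : 0 < r)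
    (hq : 0 < q) (hW : 0 < W) (hP₀ : 0 ≤ P)
    (hP : ∀ t : ℝ, |t| ≤ T → ‖coprimeCritPoly S Q u v t‖ ^ 2 ≤ P) :
    ∫ t : ℝ, ‖coprimeCritPoly S Q u v t‖ ^ 2 / (r ^ 2 + t ^ 2) ≤
      (N / q * CN + q * W) * (Real.pi / r * (1 + 2 * K / r) * CK) +
      2 * (N * CN) * (Real.pi / T * (1 + 2 * K / T) * CK) +
      P / r ^ 2 * (q * (2 * Real.pi * D * (T + 2 * (N : ℝ) ^ j) * (CN / W) ^ j)) := by
  have hCN₀ : 0 ≤ CN := le_trans (Finset.sum_nonneg fun _ _ => by positivity) hCN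
  have total_le (t : ℝ) :
      ∑ e ∈ Finset.Icc 1 N, ‖critPoly (S.filter (e ∣ ·)) u t‖ ^ 2 ≤ N * CN := by
    simpa using sum_norm_critPoly_filter_dvd_sq_le hS hCN one_pos
      (fun e he => by exact_mod_cast (Finset.mem_Icc.mp he).1) t
  refine (integral_div_sq_add_sq_le_of_exceptional (U := exceptionalSet S u N q T W)
    (Λ := fun t => ∑ e ∈ Finset.Icc 1 N, ‖critPoly (Q.filter (e ∣ ·)) v t‖ ^ 2)
    (fun t => by positivity)
    (fun t => norm_sum_sum_ite_coprime_sq_le S Q (fun m => u m * critChar t m)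
      (fun k => v k * critChar t k) hS)
    (fun t => Finset.sum_nonneg fun _ _ => by positivity)
    (add_nonneg (mul_nonneg (by positivity) hCN₀) (by positivity))
    (mul_nonneg (by positivity) hCN₀) hP₀ hT hr
    (measurableSet_exceptionalSet S u N q T W) (volume_exceptionalSet_ne_top S u N q T W)
    (fun t ht ht' => sum_norm_critPoly_filter_dvd_sq_le_of_notMem_exceptionalSet hS hCN hq hW.le
      ht' ht) total_le hP (integrable_sum_norm_critPoly_filter_dvd_sq_div _ Q v hr)
    (integrable_sum_norm_critPoly_filter_dvd_sq_div _ Q v hT)).trans ?_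
  have mean_le {a : ℝ} (ha : 0 < a) := (integral_sum_norm_critPoly_filter_dvd_sq_div_le
    (Finset.Icc 1 N) Q v hQ ha).trans (mul_le_mul_of_nonneg_left hCK (by positivity))
  gcongr
  · exact mean_le hr
  · exact mean_le hT
  · exact volume_exceptionalSet_le hS hCN j hD₀ hD hq.le hT hW

end BilinearForms

section ReductionToCriticalLine

open MeasureTheory Complex

/-- The coprime pairs in `S × Q`, the index set over which a bilinear short sum becomes a
`windowSum`. -/
def coprimePairs (S Q : Finset ℕ) : Finset (ℕ × ℕ) :=
  (S ×ˢ Q).filter fun p => p.1.Coprime p.2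

theorem sum_coprimePairs_eq_coprimeCritPoly {S Q : Finset ℕ} (hS : ∀ m ∈ S, m ≠ 0)
    (hQ : ∀ k ∈ Q, k ≠ 0) (u v : ℕ → ℂ) (t : ℝ) :
    ∑ p ∈ coprimePairs S Q, u p.1 * v p.2 * ((√((p.1 * p.2 : ℕ) : ℝ))⁻¹ : ℝ) *
      cexp (-(t * Real.log ((p.1 * p.2 : ℕ) : ℝ) * I)) = coprimeCritPoly S Q u v t := by
  rw [coprimePairs, coprimeCritPoly, Finset.sum_filter, Finset.sum_product]
  refine Finset.sum_congr rfl fun m hm => Finset.sum_congr rfl fun k hk => ?_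
  simp only
  rw [← mul_critChar, critChar_mul t (hS m hm) (hQ k hk), mul_mul_mul_comm]

namespace IsEntireEulerProduct

variable {A : ℕ → ℂ} {L : ℂ → ℂ} {d : ℕ} {M H : ℝ} {K : ℕ} {w : ℕ → ℂ}

theorem shortSum_eq_windowSum (hL : IsEntireEulerProduct A L d) {x y : ℝ} (hxy : x + H ≤ y)
    (hw : ∀ m ∈ Finset.Ioc ⌊M⌋₊ ⌊2 * M⌋₊, ∀ k : ℕ, 1 ≤ k → (m : ℝ) * k ≤ y → k ≤ K ∧ w k = 1) :
    shortSum A M H x = windowSum (coprimePairs (Finset.Ioc ⌊M⌋₊ ⌊2 * M⌋₊) (Finset.Icc 1 K))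
      (fun p => ((p.1 * p.2 : ℕ) : ℝ)) (fun p => A p.1 * (A p.2 * w p.2)) H x := by
  rw [shortSum, windowSum, coprimePairs, Finset.sum_filter, Finset.sum_product]
  refine Finset.sum_congr rfl fun m hm => ?_
  have hm₁ : 1 ≤ m := by have := (Finset.mem_Ioc.mp hm).1; omega
  have hm₁' : (1 : ℝ) ≤ m := by exact_mod_cast hm₁
  simp only [← ite_and]
  rw [← Finset.sum_filter]
  refine Finset.sum_congr ?_ fun k hk => ?_
  · ext k
    simp only [Finset.mem_filter, Finset.mem_Icc, Nat.cast_mul]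
    constructor
    · rintro ⟨⟨hk, _⟩, hx, hxH, hmk⟩
      exact ⟨⟨hk, (hw m hm k hk (hxH.trans hxy)).1⟩, hmk, hx, hxH⟩
    · rintro ⟨⟨hk, _⟩, hmk, hx, hxH⟩
      have hkm : (k : ℝ) ≤ m * k := le_mul_of_one_le_left (Nat.cast_nonneg k) hm₁'
      exact ⟨⟨hk, Nat.le_floor (hkm.trans hxH)⟩, hx, hxH, hmk⟩
  · simp only [Finset.mem_filter, Finset.mem_Icc, Nat.cast_mul] at hk
    obtain ⟨⟨hk, _⟩, hmk, _, hxH⟩ := hk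
    rw [(hw m hm k hk (hxH.trans hxy)).2, mul_one, hL.map_mul_of_coprime hmk (by omega) (by omega)]

theorem integral_norm_shortSum_sq_le (hL : IsEntireEulerProduct A L d) {X : ℝ} (hX : 0 < X)
    (hH : 0 < H) (hw : ∀ m ∈ Finset.Ioc ⌊M⌋₊ ⌊2 * M⌋₊, ∀ k : ℕ, 1 ≤ k →
      (m : ℝ) * k ≤ 2 * X + H → k ≤ K ∧ w k = 1) :
    ∫ x in X..2 * X, ‖shortSum A M H x‖ ^ 2 ≤
      3 * ((2 * X + H) ^ 2 + (2 * X) ^ 2 + X ^ 2) * (1 / (2 * Real.pi) *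
        ∫ t : ℝ, ‖coprimeCritPoly (Finset.Ioc ⌊M⌋₊ ⌊2 * M⌋₊) (Finset.Icc 1 K) A
          (fun k => A k * w k) t‖ ^ 2 / ((X / H + 1 / 2) ^ 2 + t ^ 2)) := by
  have ne_zero_left : ∀ m ∈ Finset.Ioc ⌊M⌋₊ ⌊2 * M⌋₊, m ≠ 0 := fun m hm => by
    have := (Finset.mem_Ioc.mp hm).1; omega
  have ne_zero_right : ∀ k ∈ Finset.Icc 1 K, k ≠ 0 := fun k hk => by
    have := (Finset.mem_Icc.mp hk).1; omega
  have mul_pos : ∀ p ∈ coprimePairs (Finset.Ioc ⌊M⌋₊ ⌊2 * M⌋₊) (Finset.Icc 1 K),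
      0 < ((p.1 * p.2 : ℕ) : ℝ) := fun p hp => by
    obtain ⟨hm, hk⟩ := Finset.mem_product.mp (Finset.mem_filter.mp hp).1
    exact_mod_cast Nat.mul_pos (Nat.pos_of_ne_zero (ne_zero_left _ hm))
      (Nat.pos_of_ne_zero (ne_zero_right _ hk))
  have mean_square :=
    integral_norm_windowSum_sq_le (fun p => A p.1 * (A p.2 * w p.2)) mul_pos hX hH
  simp only [sum_coprimePairs_eq_coprimeCritPoly ne_zero_left ne_zero_right A
    (fun k => A k * w k)] at mean_square
  refine le_trans (le_of_eq (intervalIntegral.integral_congr fun x hx => ?_)) mean_square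
  rw [Set.uIcc_of_le (by linarith)] at hx
  rw [hL.shortSum_eq_windowSum (y := 2 * X + H) (by linarith [hx.2]) hw]

end IsEntireEulerProduct

theorem exists_contDiff_cutoff {δ ε : ℝ} (hδ : δ < 1) (hε : 0 < ε) (hεδ : ε ≤ δ) :
    ∃ φ : ℝ → ℂ, ContDiff ℝ (⊤ : ℕ∞) φ ∧ (∀ v, 2 < |v| → φ v = 0) ∧ (∀ v, ‖φ v‖ ≤ 1) ∧
      (∀ v, 0 ≤ v → v ≤ 1 - δ + ε / 2 → φ v = 1) ∧ ∀ v, 1 - δ + ε < v → φ v = 0 := by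
  let ψ : ContDiffBump ((ε - δ) / 2 : ℝ) :=
    { rIn := 1 - δ / 2
      rOut := 1 - δ / 2 + ε / 2
      rIn_pos := by linarith
      rIn_lt_rOut := by linarith }
  have eq_zero (v : ℝ) (hv : 1 - δ / 2 + ε / 2 ≤ |v - (ε - δ) / 2|) : ((ψ v : ℝ) : ℂ) = 0 := by
    rw [ψ.zero_of_le_dist (by rwa [Real.dist_eq]), ofReal_zero]
  refine ⟨fun v => (ψ v : ℝ), ofRealCLM.contDiff.comp ψ.contDiff, fun v hv => eq_zero v ?_,
    fun v => ?_, fun v hv₀ hv => ?_, fun v hv => eq_zero v ?_⟩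
  · have center_le : |(ε - δ) / 2| ≤ 1 / 2 := abs_le.mpr ⟨by linarith, by linarith⟩
    linarith [abs_sub_abs_le_abs_sub v ((ε - δ) / 2)]
  · rw [norm_real, Real.norm_of_nonneg ψ.nonneg]
    exact ψ.le_one
  · have mem_ball : v ∈ Metric.closedBall ((ε - δ) / 2) (1 - δ / 2) := by
      rw [mem_closedBall_iff_norm, Real.norm_eq_abs, abs_le]
      constructor <;> linarith
    simp only [ψ.one_of_mem_closedBall mem_ball, ofReal_one]
  · exact le_trans (by linarith) (le_abs_self _)

end ReductionToCriticalLine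

section ParameterChoice

variable {X H T N K r c δ ε θ : ℝ}

theorem rpow_mul_le_of_mul_rpow_le {a b σ : ℝ} (hX : 1 ≤ X) (hc : 0 < c) (hH : c * X ^ a ≤ H)
    (hb : b - a ≤ σ) : X ^ b * H ≤ 1 / c * (X ^ σ * H ^ 2) := by
  have hX₀ : 0 < X := by linarith
  have hH₀ : 0 < H := hH.trans_lt' (by positivity)
  calc X ^ b * H = 1 / c * (X ^ (b - a) * (c * X ^ a)) * H := by
        rw [mul_left_comm (X ^ (b - a)), ← Real.rpow_add hX₀, sub_add_cancel, ← mul_assoc,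
          one_div_mul_cancel hc.ne', one_mul]
    _ ≤ 1 / c * (X ^ σ * H) * H := by gcongr
    _ = 1 / c * (X ^ σ * H ^ 2) := by ring

theorem mean_value_term_le {E F B C a α β γ κ σ : ℝ} (hX : 1 ≤ X) (hc : 0 < c)
    (hH : c * X ^ a ≤ H) (hr : 0 < r) (hrH : 1 / r ≤ H * X ^ (-β)) (hK₀ : 0 ≤ K) (hK : K ≤ X ^ κ)
    (hB : 0 ≤ B) (hE : E ≤ B * X ^ α) (hC : 0 ≤ C) (hF₀ : 0 ≤ F) (hF : F ≤ C * X ^ γ)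
    (h₁ : 2 + α + γ - β - a ≤ σ) (h₂ : 2 + α + γ - β + κ - β ≤ σ) :
    X ^ 2 * (E * (Real.pi / r * (1 + 2 * K / r) * F)) ≤
      4 * B * C * (1 / c + 2) * (X ^ σ * H ^ 2) := by
  have hX₀ : 0 < X := by linarith
  have hH₀ : 0 < H := hH.trans_lt' (by positivity)
  have first_power : X ^ (2 + α + γ - β) = X ^ 2 * X ^ α * X ^ γ * X ^ (-β) := by
    rw [sub_eq_add_neg, Real.rpow_add hX₀, Real.rpow_add hX₀, Real.rpow_add hX₀, Real.rpow_two]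
  have second_power : X ^ (2 + α + γ - β + κ - β) =
      X ^ (2 + α + γ - β) * X ^ κ * X ^ (-β) := by
    rw [sub_eq_add_neg _ β, Real.rpow_add hX₀, Real.rpow_add hX₀]
  have kernel_le : Real.pi / r * (1 + 2 * K / r) ≤
      4 * (H * X ^ (-β)) * (1 + 2 * X ^ κ * (H * X ^ (-β))) := by
    rw [div_eq_mul_one_div Real.pi, div_eq_mul_one_div (2 * K)]
    gcongr
    exact Real.pi_le_four
  calc _ ≤ X ^ 2 * (B * X ^ α *
        (4 * (H * X ^ (-β)) * (1 + 2 * X ^ κ * (H * X ^ (-β))) * (C * X ^ γ))) := by gcongr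
    _ = 4 * B * C *
        (X ^ (2 + α + γ - β) * H + 2 * (X ^ (2 + α + γ - β + κ - β) * H ^ 2)) := by
      rw [second_power, first_power]
      ring
    _ ≤ 4 * B * C * (1 / c * (X ^ σ * H ^ 2) + 2 * (X ^ σ * H ^ 2)) :=
      mul_le_mul_of_nonneg_left (add_le_add (rpow_mul_le_of_mul_rpow_le hX hc hH h₁)
        (by gcongr)) (by positivity)
    _ = _ := by ring

theorem large_values_measure_le {ρ C : ℝ} {k : ℕ} (hX : 1 ≤ X) (hkδ : 1 ≤ k * δ)
    (hTX : T ≤ X) (hN₀ : 0 ≤ N) (hN : N ≤ 2 * X ^ δ) (hC : 0 ≤ C) :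
    (T + 2 * N ^ k) * (C * X ^ (ε / k) / X ^ (δ - 2 * ρ)) ^ k ≤
      (1 + 2 ^ (k + 1)) * C ^ k * X ^ (ε + 2 * (k * ρ)) := by
  have hX₀ : 0 < X := by linarith
  have rpow_pow (a : ℝ) : (X ^ a) ^ k = X ^ (k * a) := by
    rw [← Real.rpow_natCast, ← Real.rpow_mul hX₀.le, mul_comm]
  have length_le : T + 2 * N ^ k ≤ (1 + 2 ^ (k + 1)) * X ^ (k * δ) := by
    have hTk : T ≤ X ^ (k * δ) := hTX.trans <| by
      simpa using Real.rpow_le_rpow_of_exponent_le hX hkδ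
    have hNk : N ^ k ≤ 2 ^ k * X ^ (k * δ) := by
      rw [← rpow_pow, ← mul_pow]
      gcongr
    rw [pow_succ]
    linarith
  have moment_eq : (C * X ^ (ε / k) / X ^ (δ - 2 * ρ)) ^ k =
      C ^ k * X ^ (ε + 2 * (k * ρ) - k * δ) := by
    rw [mul_div_assoc, ← Real.rpow_sub hX₀, mul_pow, rpow_pow]
    congr 2
    rw [mul_sub, mul_div_cancel₀ ε (left_ne_zero_of_mul (one_pos.trans_le hkδ).ne')]
    ring
  calc _ ≤ (1 + 2 ^ (k + 1)) * X ^ (k * δ) * (C ^ k * X ^ (ε + 2 * (k * ρ) - k * δ)) := by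
        rw [moment_eq]
        gcongr
    _ = (1 + 2 ^ (k + 1)) * C ^ k * (X ^ (k * δ) * X ^ (ε + 2 * (k * ρ) - k * δ)) := by ring
    _ = _ := by rw [← Real.rpow_add hX₀, add_sub_cancel]

theorem rpow_div_rpow_mul_sq (hX : 0 < X) (hH : 0 < H) (a : ℝ) :
    (X ^ a / H) ^ (2 * θ) * H ^ 2 = X ^ (2 * θ * a) * H ^ (2 - 2 * θ) := by
  rw [Real.div_rpow (Real.rpow_nonneg hX.le _) hH.le, ← Real.rpow_mul hX.le, Real.rpow_sub hH,
    Real.rpow_two, mul_comm a]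
  ring

theorem large_values_term_le {ρ η C₁ C₂ C₃ : ℝ} {k : ℕ} (hX : 1 ≤ X) (hH : 0 < H) (hr : 0 < r)
    (hrH : 1 / r ≤ H * X ^ (-1 : ℝ)) (hkδ : 1 ≤ k * δ)
    (hTX : X ^ (1 + δ) / H ≤ X) (hN₀ : 0 ≤ N) (hN : N ≤ 2 * X ^ δ) (hC₁ : 0 ≤ C₁) (hC₂ : 0 ≤ C₂)
    (hC₃ : 0 ≤ C₃) (hη : δ + 7 * ε + ρ + 2 * (k * ρ) ≤ η) :
    X ^ 2 * (C₃ * (N * (X ^ (5 * ε) * (X ^ (1 + δ) / H) ^ (2 * θ))) / r ^ 2 *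
      (X ^ ρ * (2 * Real.pi * (C₂ * X ^ ε) * (X ^ (1 + δ) / H + 2 * N ^ k) *
        (C₁ * X ^ (ε / k) / X ^ (δ - 2 * ρ)) ^ k))) ≤
      4 * Real.pi * (1 + 2 ^ (k + 1)) * C₁ ^ k * C₂ * C₃ *
        (X ^ η * (X ^ (2 * θ * (1 + δ)) * H ^ (2 - 2 * θ))) := by
  have hX₀ : 0 < X := by linarith
  have measure_le := large_values_measure_le (ε := ε) (ρ := ρ) hX hkδ hTX hN₀ hN hC₁
  have sq_mul_one_div_sq_le : X ^ 2 * (1 / r) ^ 2 ≤ H ^ 2 := by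
    calc X ^ 2 * (1 / r) ^ 2 ≤ X ^ 2 * (H * X ^ (-1 : ℝ)) ^ 2 := by gcongr
      _ = H ^ 2 := by
        rw [Real.rpow_neg_one]
        field_simp
  have exponent_le : X ^ δ * X ^ (5 * ε) * X ^ ρ * X ^ ε * X ^ (ε + 2 * (k * ρ)) ≤ X ^ η := by
    simp only [← Real.rpow_add hX₀]
    exact Real.rpow_le_rpow_of_exponent_le hX (by linarith)
  rw [← rpow_div_rpow_mul_sq hX₀ hH]
  set V := (X ^ (1 + δ) / H) ^ (2 * θ)
  have : 0 ≤ V := by positivity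
  calc _ = C₃ * N * X ^ (5 * ε) * V * (X ^ 2 * (1 / r) ^ 2) * X ^ ρ *
        (2 * Real.pi * C₂ * X ^ ε) * ((X ^ (1 + δ) / H + 2 * N ^ k) *
          (C₁ * X ^ (ε / k) / X ^ (δ - 2 * ρ)) ^ k) := by ring
    _ ≤ C₃ * (2 * X ^ δ) * X ^ (5 * ε) * V * H ^ 2 * X ^ ρ * (2 * Real.pi * C₂ * X ^ ε) *
        ((1 + 2 ^ (k + 1)) * C₁ ^ k * X ^ (ε + 2 * (k * ρ))) := by gcongr
    _ = 4 * Real.pi * (1 + 2 ^ (k + 1)) * C₁ ^ k * C₂ * C₃ *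
        (X ^ δ * X ^ (5 * ε) * X ^ ρ * X ^ ε * X ^ (ε + 2 * (k * ρ)) * (V * H ^ 2)) := by ring
    _ ≤ _ := by gcongr

theorem div_rpow_mul_add_rpow_mul_le {ρ Y C : ℝ} (hX : 1 ≤ X) (hε : 0 ≤ ε) (hC : 1 ≤ C)
    (hY₀ : 0 ≤ Y) (hY : Y ≤ X ^ ε) (hN : N ≤ 2 * X ^ δ) :
    N / X ^ ρ * (C * Y) + X ^ ρ * X ^ (δ - 2 * ρ) ≤ 3 * C * X ^ (δ - ρ + ε) := by
  have hX₀ : 0 < X := by linarith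
  calc N / X ^ ρ * (C * Y) + X ^ ρ * X ^ (δ - 2 * ρ) ≤
        2 * X ^ δ / X ^ ρ * (C * X ^ ε) + C * X ^ (ρ + (δ - 2 * ρ) + ε) := by
        rw [← Real.rpow_add hX₀]
        gcongr
        refine (Real.rpow_le_rpow_of_exponent_le hX (by linarith)).trans
          (le_mul_of_one_le_left (by positivity) hC)
    _ = 2 * C * (X ^ δ / X ^ ρ * X ^ ε) + C * X ^ (δ - ρ + ε) := by ring_nf
    _ = _ := by
      rw [← Real.rpow_sub hX₀, ← Real.rpow_add hX₀]
      ring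

end ParameterChoice

section CriticalLineMeanSquare

open Complex

theorem exists_card_divisors_pow_le {k : ℕ} (hk : k ≠ 0) {ε : ℝ} (hε : 0 < ε) :
    ∃ C : ℝ, 1 ≤ C ∧ ∀ (X : ℝ) (N n : ℕ), (N : ℝ) ≤ X → n ≠ 0 → n ≤ N ^ k →
      (n.divisors.card : ℝ) ^ k ≤ C * X ^ ε := by
  obtain ⟨C, hC, card_pow_le⟩ :=
    exists_card_divisors_pow_le_mul_rpow k (ε := ε / k) (by positivity)
  refine ⟨C, hC, fun X N n hN hn hnN => (card_pow_le n hn).trans ?_⟩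
  have hX : 0 ≤ X := (Nat.cast_nonneg N).trans hN
  have le_pow : (n : ℝ) ≤ X ^ k := by
    calc (n : ℝ) ≤ (N : ℝ) ^ k := by exact_mod_cast hnN
      _ ≤ X ^ k := by gcongr
  calc C * (n : ℝ) ^ (ε / k) ≤ C * (X ^ k) ^ (ε / k) := by gcongr
    _ = C * X ^ ε := by
      rw [← Real.rpow_natCast, ← Real.rpow_mul hX, mul_div_cancel₀ ε (by exact_mod_cast hk)]

theorem sum_le_sum_card_divisors_mul {S : Finset ℕ} (hS : ∀ m ∈ S, m ≠ 0) {f : ℕ → ℝ}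
    (hf : ∀ m, 0 ≤ f m) : ∑ m ∈ S, f m ≤ ∑ m ∈ S, (m.divisors.card : ℝ) * f m := by
  refine Finset.sum_le_sum fun m hm => le_mul_of_one_le_left (hf m) ?_
  exact_mod_cast Finset.card_pos.mpr ⟨1, Nat.one_mem_divisors.mpr (hS m hm)⟩

theorem coprimeCritPoly_eq_sum_mul (S Q : Finset ℕ) (u A w : ℕ → ℂ) (t : ℝ) :
    coprimeCritPoly S Q u (fun k => A k * w k) t =
      ∑ m ∈ S, (u m * critChar t m) * ∑ k ∈ Q, coprimePart A m k * w k * critChar t k := by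
  simp only [coprimeCritPoly, coprimePart, Finset.mul_sum, Nat.coprime_comm, ite_mul, mul_ite,
    zero_mul, mul_zero]

namespace IsEntireEulerProduct

variable {A : ℕ → ℂ} {L : ℂ → ℂ} {d : ℕ} {θ : ℝ} {φ : ℝ → ℂ} {R ε : ℝ}

theorem exists_sum_card_divisors_mul_norm_sq_div_le_of_le (hL : IsEntireEulerProduct A L d)
    (hε : 0 < ε) : ∃ C : ℝ, 1 ≤ C ∧ ∀ (X : ℝ) (S : Finset ℕ), 1 ≤ X →
      (∀ m ∈ S, m ≠ 0 ∧ (m : ℝ) ≤ X) →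
        ∑ m ∈ S, (m.divisors.card : ℝ) * (‖A m‖ ^ 2 / m) ≤ C * X ^ ε := by
  obtain ⟨C, hC, sum_le⟩ := hL.exists_sum_card_divisors_mul_norm_sq_div_le hε
  refine ⟨C, hC, fun X S hX hS => ?_⟩
  have subset_Icc : S ⊆ Finset.Icc 1 ⌊X⌋₊ := fun m hm => Finset.mem_Icc.mpr
    ⟨Nat.pos_of_ne_zero (hS m hm).1, Nat.le_floor (hS m hm).2⟩
  calc _ ≤ ∑ m ∈ Finset.Icc 1 ⌊X⌋₊, (m.divisors.card : ℝ) * (‖A m‖ ^ 2 / m) :=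
        Finset.sum_le_sum_of_subset_of_nonneg subset_Icc fun _ _ _ => by positivity
    _ ≤ C * (⌊X⌋₊ : ℝ) ^ ε := sum_le _ (Nat.le_floor (by exact_mod_cast hX))
    _ ≤ C * X ^ ε := by
      gcongr
      exact Nat.floor_le (by linarith)

theorem exists_norm_sum_coprimePart_logb_mul_le (hL : IsEntireEulerProduct A L d)
    (hθ : IsSubconvexityExponent L θ) (hφ : ContDiff ℝ (⊤ : ℕ∞) φ) (hR : ∀ v, R < |v| → φ v = 0)
    (hε : 0 < ε) : ∃ C : ℝ, 0 ≤ C ∧ ∀ (X T t : ℝ) (m K : ℕ), 3 ≤ X → m ≠ 0 → (m : ℝ) ≤ X →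
      1 ≤ T → T ≤ X → |t| ≤ T → (∀ k : ℕ, K < k → φ (Real.logb X k) = 0) →
        ‖∑ k ∈ Finset.Icc 1 K, coprimePart A m k * φ (Real.logb X k) * critChar t k‖ ≤
          C * (X ^ (2 * ε) * T ^ θ) := by
  obtain ⟨C, hC, norm_le⟩ := hL.exists_norm_sum_coprimePart_mul_le hθ hφ hR hε
  have hθ₀ := hθ.1
  refine ⟨C * 2 ^ (θ + ε), by positivity, fun X T t m K hX hm hmX hT hTX ht hK => ?_⟩
  have hX₀ : 0 < X := by linarith
  have one_le_log : 1 ≤ Real.log X := by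
    rw [Real.le_log_iff_exp_le hX₀]
    linarith [Real.exp_one_lt_d9]
  calc _ ≤ C * ((m : ℝ) ^ ε * (1 + |t|) ^ (θ + ε)) := norm_le m _ t K hm one_le_log hK
    _ ≤ C * (X ^ ε * (2 * T) ^ (θ + ε)) := by
      gcongr
      linarith
    _ = C * (X ^ ε * (2 ^ (θ + ε) * (T ^ θ * T ^ ε))) := by
      rw [Real.mul_rpow two_pos.le (by linarith), Real.rpow_add (by linarith : 0 < T)]
    _ ≤ C * (X ^ ε * (2 ^ (θ + ε) * (T ^ θ * X ^ ε))) := by gcongr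
    _ = _ := by
      rw [two_mul, Real.rpow_add hX₀]
      ring

theorem exists_norm_coprimeCritPoly_sq_le (hL : IsEntireEulerProduct A L d)
    (hθ : IsSubconvexityExponent L θ) (hφ : ContDiff ℝ (⊤ : ℕ∞) φ) (hR : ∀ v, R < |v| → φ v = 0)
    (hε : 0 < ε) : ∃ C : ℝ, 0 ≤ C ∧ ∀ (X T t : ℝ) (S : Finset ℕ) (K : ℕ) (u : ℕ → ℂ), 3 ≤ X →
      (∀ m ∈ S, m ≠ 0 ∧ (m : ℝ) ≤ X) → 1 ≤ T → T ≤ X → |t| ≤ T →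
      (∀ k : ℕ, K < k → φ (Real.logb X k) = 0) →
        ‖coprimeCritPoly S (Finset.Icc 1 K) u (fun k => A k * φ (Real.logb X k)) t‖ ^ 2 ≤
          (∑ m ∈ S, ‖u m‖ ^ 2 / m) * (S.card * (C * (X ^ (4 * ε) * T ^ (2 * θ)))) := by
  obtain ⟨C, -, norm_le⟩ := hL.exists_norm_sum_coprimePart_logb_mul_le hθ hφ hR hε
  refine ⟨C ^ 2, by positivity, fun X T t S K u hX hS hT hTX ht hK => ?_⟩
  have sq_eq : (C * (X ^ (2 * ε) * T ^ θ)) ^ 2 = C ^ 2 * (X ^ (4 * ε) * T ^ (2 * θ)) := by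
    rw [mul_pow, mul_pow, ← Real.rpow_mul_natCast (by linarith),
      ← Real.rpow_mul_natCast (by linarith)]
    push_cast
    ring_nf
  calc _ ≤ (∑ m ∈ S, ‖u m * critChar t m‖ ^ 2) * ∑ m ∈ S, ‖∑ k ∈ Finset.Icc 1 K,
        coprimePart A m k * φ (Real.logb X k) * critChar t k‖ ^ 2 := by
        rw [coprimeCritPoly_eq_sum_mul]
        exact norm_sum_mul_sq_le S _ _
    _ ≤ (∑ m ∈ S, ‖u m‖ ^ 2 / m) * ∑ m ∈ S, (C * (X ^ (2 * ε) * T ^ θ)) ^ 2 := by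
        simp_rw [norm_mul_critChar_sq]
        gcongr with m hm
        exact norm_le X T t m K hX (hS m hm).1 (hS m hm).2 hT hTX ht hK
    _ = _ := by rw [Finset.sum_const, nsmul_eq_mul, sq_eq]

theorem exists_integral_norm_coprimeCritPoly_sq_div_le (hL : IsEntireEulerProduct A L d)
    (hθ : IsSubconvexityExponent L θ) (hφ : ContDiff ℝ (⊤ : ℕ∞) φ) (hR : ∀ v, R < |v| → φ v = 0)
    (hφ₁ : ∀ v, ‖φ v‖ ≤ 1) (hε : 0 < ε) {j : ℕ} (hj : j ≠ 0) :
    ∃ C₁ C₂ C₃ : ℝ, 1 ≤ C₁ ∧ 0 ≤ C₂ ∧ 0 ≤ C₃ ∧ ∀ (X T r q W : ℝ) (S : Finset ℕ) (N K : ℕ),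
      3 ≤ X → 1 ≤ T → T ≤ X → 0 < r → 0 < q → 0 < W → (∀ m ∈ S, m ≠ 0 ∧ m ≤ N) → (N : ℝ) ≤ X →
      (K : ℝ) ≤ X → (∀ k : ℕ, K < k → φ (Real.logb X k) = 0) →
        ∫ t : ℝ, ‖coprimeCritPoly S (Finset.Icc 1 K) A (fun k => A k * φ (Real.logb X k)) t‖ ^ 2 /
            (r ^ 2 + t ^ 2) ≤
          (N / q * (C₁ * X ^ (ε / j)) + q * W) *
            (Real.pi / r * (1 + 2 * K / r) * (C₁ * X ^ (ε / j))) +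
          2 * (N * (C₁ * X ^ (ε / j))) * (Real.pi / T * (1 + 2 * K / T) * (C₁ * X ^ (ε / j))) +
          C₃ * (N * (X ^ (5 * ε) * T ^ (2 * θ))) / r ^ 2 *
            (q * (2 * Real.pi * (C₂ * X ^ ε) * (T + 2 * (N : ℝ) ^ j) *
              (C₁ * X ^ (ε / j) / W) ^ j)) := by
  obtain ⟨C₁, hC₁, sum_le⟩ :=
    hL.exists_sum_card_divisors_mul_norm_sq_div_le_of_le (ε := ε / j) (by positivity)
  obtain ⟨C₂, hC₂, card_le⟩ := exists_card_divisors_pow_le hj hε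
  obtain ⟨C₃, hC₃, poly_le⟩ := hL.exists_norm_coprimeCritPoly_sq_le hθ hφ hR hε
  refine ⟨C₁, C₂, C₁ * C₃, hC₁, by positivity, by positivity,
    fun X T r q W S N K hX hT hTX hr hq hW hS hNX hKX hK => ?_⟩
  have le_of_mem {m : ℕ} (hm : m ∈ S) : m ≠ 0 ∧ (m : ℝ) ≤ X :=
    ⟨(hS m hm).1, (Nat.cast_le.mpr (hS m hm).2).trans hNX⟩
  have sum_left_le := sum_le X S (by linarith) fun m hm => le_of_mem hm
  refine integral_norm_coprimeCritPoly_sq_div_le S (Finset.Icc 1 K) A _ hS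
    (fun k hk => Finset.mem_Icc.mp hk) sum_left_le ?_ j (by positivity)
    (fun n hn hnN => card_le X N n hNX hn hnN) (by linarith) hr hq hW (by positivity)
    fun t ht => (poly_le X T t S K A hX (fun m hm => le_of_mem hm) hT hTX ht hK).trans ?_
  · refine le_trans ?_ (sum_le X (Finset.Icc 1 K) (by linarith) fun k hk =>
      ⟨Nat.ne_zero_of_lt (Finset.mem_Icc.mp hk).1,
        (Nat.cast_le.mpr (Finset.mem_Icc.mp hk).2).trans hKX⟩)
    gcongr
    rw [norm_mul]
    exact mul_le_of_le_one_right (norm_nonneg _) (hφ₁ _)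
  · have sum_norm_sq_le : ∑ m ∈ S, ‖A m‖ ^ 2 / m ≤ C₁ * X ^ ε := by
      refine (sum_le_sum_card_divisors_mul (fun m hm => (hS m hm).1) fun _ => by positivity).trans
        (sum_left_le.trans ?_)
      gcongr
      · linarith
      · exact div_le_self hε.le (by exact_mod_cast Nat.one_le_iff_ne_zero.mpr hj)
    have card_le : S.card ≤ N := by
      simpa using Finset.card_le_card (t := Finset.Icc 1 N) fun m hm =>
        Finset.mem_Icc.mpr ⟨Nat.pos_of_ne_zero (hS m hm).1, (hS m hm).2⟩
    calc _ ≤ C₁ * X ^ ε * (N * (C₃ * (X ^ (4 * ε) * T ^ (2 * θ)))) := by gcongr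
      _ = C₁ * C₃ * (N * (X ^ ε * X ^ (4 * ε) * T ^ (2 * θ))) := by ring
      _ = _ := by
        rw [← Real.rpow_add (by linarith)]
        ring_nf

end IsEntireEulerProduct

end CriticalLineMeanSquare

section MeanSquareOfShortSums

open Filter

theorem exists_nat_mul_mem_Icc {δ : ℝ} (hδ : 0 < δ) : ∃ k : ℕ, k * δ ∈ Set.Icc 1 (1 + δ) := by
  refine ⟨⌈1 / δ⌉₊, (div_le_iff₀ hδ).mp (Nat.le_ceil _), ?_⟩
  calc ⌈1 / δ⌉₊ * δ ≤ (1 / δ + 1) * δ := by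
        gcongr
        exact (Nat.ceil_lt_add_one (by positivity)).le
    _ = 1 + δ := by
        rw [add_mul, one_div_mul_cancel hδ.ne', one_mul]

theorem eventually_le_rpow (a : ℝ) {b : ℝ} (hb : 0 < b) : ∀ᶠ X : ℝ in atTop, a ≤ X ^ b :=
  (tendsto_rpow_atTop hb).eventually_ge_atTop a

/-- The two terms of the second moment bound, with `X^{4δ}` in place of `X^{6δ}`: the sharper
exponent leaves room for the consequence. -/
noncomputable def secondMomentBound (θ δ X H : ℝ) : ℝ :=
  H ^ 2 * X ^ (1 - δ ^ 2) + X ^ (2 * θ * (1 + δ) + 4 * δ) * H ^ (2 - 2 * θ)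

section OptimizedParameters

variable {X H N K Y c δ C₁ : ℝ}

theorem one_div_div_add_half_le (hX : 0 < X) (hH : 0 < H) :
    1 / (X / H + 1 / 2) ≤ H * X ^ (-1 : ℝ) := by
  have : 0 < X / H := by positivity
  calc 1 / (X / H + 1 / 2) ≤ 1 / (X / H) := one_div_le_one_div_of_le this (by linarith)
    _ = H * X ^ (-1 : ℝ) := by rw [one_div_div, Real.rpow_neg_one, div_eq_mul_inv]

theorem one_le_rpow_div (hX : 0 < X) (hH₀ : 0 < H) (hc : c ≤ X ^ (7 * δ))
    (hH : H ≤ c * X ^ (1 - 6 * δ)) : 1 ≤ X ^ (1 + δ) / H := by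
  rw [one_le_div hH₀]
  calc H ≤ X ^ (7 * δ) * X ^ (1 - 6 * δ) := hH.trans (by gcongr)
    _ = X ^ (1 + δ) := by
      rw [← Real.rpow_add hX]
      ring_nf

theorem rpow_div_le (hX : 0 < X) (hc : 0 < c) (hcX : 1 / c ≤ X ^ (5 * δ))
    (hH : c * X ^ (6 * δ) ≤ H) : X ^ (1 + δ) / H ≤ X := by
  rw [div_le_iff₀ (hH.trans_lt' (by positivity))]
  calc X ^ (1 + δ) = X * (1 / X ^ (5 * δ) * X ^ (6 * δ)) := by
        rw [one_div, ← Real.rpow_neg hX.le, ← Real.rpow_add hX, Real.rpow_add hX, Real.rpow_one]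
        ring_nf
    _ ≤ X * (c * X ^ (6 * δ)) := by
      gcongr
      exact (one_div_le hc (by positivity)).mp hcX
    _ ≤ X * H := by gcongr

theorem small_values_term_le (hX : 1 ≤ X) (hc : 0 < c) (hδ : 0 < δ)
    (hH : c * X ^ (6 * δ) ≤ H) (hN : N ≤ 2 * X ^ δ) (hK₀ : 0 ≤ K)
    (hK : K ≤ X ^ (1 - δ + δ ^ 2 / 100)) (hC₁ : 1 ≤ C₁) (hY₀ : 0 ≤ Y)
    (hY : Y ≤ X ^ (δ ^ 2 / 100)) :
    X ^ 2 * ((N / X ^ (11 / 10 * δ ^ 2) * (C₁ * Y) +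
        X ^ (11 / 10 * δ ^ 2) * X ^ (δ - 2 * (11 / 10 * δ ^ 2))) *
      (Real.pi / (X / H + 1 / 2) * (1 + 2 * K / (X / H + 1 / 2)) * (C₁ * Y))) ≤
      12 * C₁ ^ 2 * (1 / c + 2) * (X ^ (-(δ ^ 2 / 100) + (1 - δ ^ 2)) * H ^ 2) := by
  have hX₀ : 0 < X := by linarith
  have hH₀ : 0 < H := hH.trans_lt' (by positivity)
  have hδ_sq : 0 ≤ δ ^ 2 := sq_nonneg δ
  refine (mean_value_term_le (σ := -(δ ^ 2 / 100) + (1 - δ ^ 2)) hX hc hH (by positivity)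
    (one_div_div_add_half_le hX₀ hH₀) hK₀ hK (by positivity)
    (div_rpow_mul_add_rpow_mul_le (ρ := 11 / 10 * δ ^ 2) hX (by positivity) hC₁
      hY₀ hY hN) (by positivity) (by positivity) (mul_le_mul_of_nonneg_left hY (by positivity))
    (by linarith) (by linarith)).trans_eq ?_
  ring

theorem tail_term_le (hX : 1 ≤ X) (hc : 0 < c) (hδ : 0 < δ) (hδ' : δ ≤ 1 / 12)
    (hH : c * X ^ (6 * δ) ≤ H) (hN : N ≤ 2 * X ^ δ) (hK₀ : 0 ≤ K)
    (hK : K ≤ X ^ (1 - δ + δ ^ 2 / 100)) (hC₁ : 0 ≤ C₁) (hY₀ : 0 ≤ Y)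
    (hY : Y ≤ X ^ (δ ^ 2 / 100)) :
    X ^ 2 * (2 * (N * (C₁ * Y)) * (Real.pi / (X ^ (1 + δ) / H) *
      (1 + 2 * K / (X ^ (1 + δ) / H)) * (C₁ * Y))) ≤
      16 * C₁ ^ 2 * (1 / c + 2) * (X ^ (-(δ ^ 2 / 100) + (1 - δ ^ 2)) * H ^ 2) := by
  have hX₀ : 0 < X := by linarith
  have hH₀ : 0 < H := hH.trans_lt' (by positivity)
  have hδ_sq : δ ^ 2 ≤ 1 / 12 * δ := by nlinarith
  have one_div_le : 1 / (X ^ (1 + δ) / H) ≤ H * X ^ (-(1 + δ)) := by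
    rw [one_div_div, Real.rpow_neg hX₀.le, div_eq_mul_inv]
  have coeff_le : 2 * (N * (C₁ * Y)) ≤ 4 * C₁ * X ^ (δ + δ ^ 2 / 100) := by
    calc _ ≤ 2 * (2 * X ^ δ * (C₁ * X ^ (δ ^ 2 / 100))) := by gcongr
      _ = _ := by
        rw [Real.rpow_add hX₀]
        ring
  refine (mean_value_term_le (σ := -(δ ^ 2 / 100) + (1 - δ ^ 2)) hX hc hH (by positivity)
    one_div_le hK₀ hK (by positivity) coeff_le hC₁ (by positivity)
    (mul_le_mul_of_nonneg_left hY hC₁) (by linarith) (by linarith)).trans_eq ?_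
  ring

theorem optimized_bound_le {θ C₂ C₃ : ℝ} {j : ℕ} (hX : 1 ≤ X) (hc : 0 < c) (hδ : 0 < δ)
    (hδ' : δ ≤ 1 / 12) (hH : c * X ^ (6 * δ) ≤ H) (hTX : X ^ (1 + δ) / H ≤ X)
    (hj : j * δ ∈ Set.Icc 1 (1 + δ)) (hN₀ : 0 ≤ N) (hN : N ≤ 2 * X ^ δ) (hK₀ : 0 ≤ K)
    (hK : K ≤ X ^ (1 - δ + δ ^ 2 / 100)) (hC₁ : 1 ≤ C₁) (hC₂ : 0 ≤ C₂) (hC₃ : 0 ≤ C₃) :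
    X ^ 2 * ((N / X ^ (11 / 10 * δ ^ 2) * (C₁ * X ^ (δ ^ 2 / 100 / j)) +
        X ^ (11 / 10 * δ ^ 2) * X ^ (δ - 2 * (11 / 10 * δ ^ 2))) *
          (Real.pi / (X / H + 1 / 2) * (1 + 2 * K / (X / H + 1 / 2)) *
            (C₁ * X ^ (δ ^ 2 / 100 / j))) +
      2 * (N * (C₁ * X ^ (δ ^ 2 / 100 / j))) * (Real.pi / (X ^ (1 + δ) / H) *
        (1 + 2 * K / (X ^ (1 + δ) / H)) * (C₁ * X ^ (δ ^ 2 / 100 / j))) +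
      C₃ * (N * (X ^ (5 * (δ ^ 2 / 100)) * (X ^ (1 + δ) / H) ^ (2 * θ))) / (X / H + 1 / 2) ^ 2 *
        (X ^ (11 / 10 * δ ^ 2) * (2 * Real.pi * (C₂ * X ^ (δ ^ 2 / 100)) *
          (X ^ (1 + δ) / H + 2 * N ^ j) * (C₁ * X ^ (δ ^ 2 / 100 / j) /
            X ^ (δ - 2 * (11 / 10 * δ ^ 2))) ^ j))) ≤
      (28 * C₁ ^ 2 * (1 / c + 2) + 4 * Real.pi * (1 + 2 ^ (j + 1)) * C₁ ^ j * C₂ * C₃) *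
        (X ^ (-(δ ^ 2 / 100)) * secondMomentBound θ δ X H) := by
  have hX₀ : 0 < X := by linarith
  have hH₀ : 0 < H := hH.trans_lt' (by positivity)
  have hC₁' : 0 ≤ C₁ := zero_le_one.trans hC₁
  have hj₀ : j ≠ 0 := by
    rintro rfl
    norm_num at hj
  have Y_le : X ^ (δ ^ 2 / 100 / j) ≤ X ^ (δ ^ 2 / 100) :=
    Real.rpow_le_rpow_of_exponent_le hX (div_le_self (by positivity)
      (by exact_mod_cast Nat.one_le_iff_ne_zero.mpr hj₀))
  have hY₀ : 0 ≤ X ^ (δ ^ 2 / 100 / j) := by positivity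
  have large_values_le := large_values_term_le (θ := θ) (ε := δ ^ 2 / 100) (ρ := 11 / 10 * δ ^ 2)
    (η := -(δ ^ 2 / 100) + 4 * δ) hX hH₀ (by positivity) (one_div_div_add_half_le hX₀ hH₀) hj.1
    hTX hN₀ hN hC₁' hC₂ hC₃ (by nlinarith [mul_le_mul_of_nonneg_right hj.2 hδ.le])
  rw [mul_add, mul_add]
  refine (add_le_add (add_le_add
    (small_values_term_le hX hc hδ hH hN hK₀ hK hC₁ hY₀ Y_le)
    (tail_term_le hX hc hδ hδ' hH hN hK₀ hK hC₁' hY₀ Y_le)) large_values_le).trans ?_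
  rw [secondMomentBound, Real.rpow_add hX₀, Real.rpow_add hX₀, Real.rpow_add hX₀ _ (4 * δ)]
  set B := C₁ ^ 2 * (1 / c + 2) with hB
  set D := 4 * Real.pi * (1 + 2 ^ (j + 1)) * C₁ ^ j * C₂ * C₃
  have : 0 ≤ B := by positivity
  have : 0 ≤ D := by positivity
  set Z := X ^ (-(δ ^ 2 / 100)) * (H ^ 2 * X ^ (1 - δ ^ 2)) with hZ
  set Z' := X ^ (-(δ ^ 2 / 100)) * (X ^ (2 * θ * (1 + δ)) * X ^ (4 * δ) * H ^ (2 - 2 * θ)) with hZ'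
  calc _ = 28 * B * Z + D * Z' := by
        rw [hB, hZ, hZ']
        ring
    _ ≤ 28 * B * Z + D * Z' + (28 * B * Z' + D * Z) := le_add_of_nonneg_right (by positivity)
    _ = _ := by
      rw [hB, hZ, hZ']
      ring

end OptimizedParameters

theorem parseval_factor_le {X H c I : ℝ} (hX : 0 ≤ X) (hH₀ : 0 ≤ H) (hH : H ≤ c * X)
    (hI : 0 ≤ I) : 3 * ((2 * X + H) ^ 2 + (2 * X) ^ 2 + X ^ 2) * (1 / (2 * Real.pi) * I) ≤
      3 * ((2 + c) ^ 2 + 5) * (X ^ 2 * I) := by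
  calc _ ≤ 3 * (((2 + c) * X) ^ 2 + (2 * X) ^ 2 + X ^ 2) * (1 * I) := by
        gcongr
        · linarith
        · rw [div_le_one (by positivity)]
          linarith [Real.pi_gt_three]
    _ = _ := by ring

theorem le_floor_and_cutoff_eq_one {X H δ ε : ℝ} {φ : ℝ → ℂ} (hX : 1 < X) (hε : 0 ≤ ε)
    (hφ : ∀ v, 0 ≤ v → v ≤ 1 - δ + ε / 2 → φ v = 1) (hH : 2 * X + H ≤ X ^ (ε / 2) * X) {m k : ℕ}
    (hm : X ^ δ < m) (hk : 1 ≤ k) (hmk : (m : ℝ) * k ≤ 2 * X + H) :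
    k ≤ ⌊X ^ (1 - δ + ε)⌋₊ ∧ φ (Real.logb X k) = 1 := by
  have hX₀ : 0 < X := by linarith
  have one_le_k : (1 : ℝ) ≤ k := by exact_mod_cast hk
  have le_rpow : (k : ℝ) ≤ X ^ (1 - δ + ε / 2) := by
    refine le_of_mul_le_mul_left (a := X ^ δ) ?_ (by positivity)
    calc X ^ δ * k ≤ m * k := by gcongr
      _ ≤ X ^ (ε / 2) * X := hmk.trans hH
      _ = X ^ δ * X ^ (1 - δ + ε / 2) := by
        rw [← Real.rpow_add_one hX₀.ne', ← Real.rpow_add hX₀]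
        ring_nf
  refine ⟨Nat.le_floor (le_rpow.trans
    (Real.rpow_le_rpow_of_exponent_le hX.le (by linarith))), hφ _ ?_ ?_⟩
  · exact Real.logb_nonneg hX one_le_k
  · exact (Real.logb_le_iff_le_rpow hX (by linarith)).mpr le_rpow

namespace IsEntireEulerProduct

variable {A : ℕ → ℂ} {L : ℂ → ℂ} {d : ℕ} {θ δ : ℝ}

theorem exists_eventually_integral_norm_coprimeCritPoly_sq_div_le
    (hL : IsEntireEulerProduct A L d) (hθ : IsSubconvexityExponent L θ) {φ : ℝ → ℂ} {R : ℝ}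
    (hφ : ContDiff ℝ (⊤ : ℕ∞) φ) (hR : ∀ v, R < |v| → φ v = 0) (hφ₁ : ∀ v, ‖φ v‖ ≤ 1)
    (hφ₀ : ∀ v, 1 - δ + δ ^ 2 / 100 < v → φ v = 0) (hδ₀ : 0 < δ) (hδ : δ ≤ 1 / 12) {c₁ : ℝ}
    (hc₁ : 0 < c₁) (c₂ : ℝ) :
    ∃ C : ℝ, 0 ≤ C ∧ ∀ᶠ X : ℝ in atTop, ∀ H : ℝ, c₁ * X ^ (6 * δ) ≤ H →
      H ≤ c₂ * X ^ (1 - 6 * δ) →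
        X ^ 2 * ∫ t : ℝ, ‖coprimeCritPoly (Finset.Ioc ⌊X ^ δ⌋₊ ⌊2 * X ^ δ⌋₊)
          (Finset.Icc 1 ⌊X ^ (1 - δ + δ ^ 2 / 100)⌋₊) A (fun k => A k * φ (Real.logb X k)) t‖ ^ 2 /
            ((X / H + 1 / 2) ^ 2 + t ^ 2) ≤
          C * (X ^ (-(δ ^ 2 / 100)) * secondMomentBound θ δ X H) := by
  obtain ⟨j, hj⟩ := exists_nat_mul_mem_Icc hδ₀
  have hj₀ : j ≠ 0 := by
    rintro rfl
    norm_num at hj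
  obtain ⟨C₁, C₂, C₃, hC₁, hC₂, hC₃, integral_le⟩ :=
    hL.exists_integral_norm_coprimeCritPoly_sq_div_le hθ hφ hR hφ₁
      (ε := δ ^ 2 / 100) (by positivity) hj₀
  refine ⟨28 * C₁ ^ 2 * (1 / c₁ + 2) + 4 * Real.pi * (1 + 2 ^ (j + 1)) * C₁ ^ j * C₂ * C₃,
    by positivity, ?_⟩
  filter_upwards [eventually_ge_atTop 3, eventually_le_rpow 2 (b := 1 - δ) (by linarith),
    eventually_le_rpow c₂ (b := 7 * δ) (by linarith),
    eventually_le_rpow (1 / c₁) (b := 5 * δ) (by linarith)] with X hX hX₁ hX₂ hX₃ H hH₁ hH₂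
  have hX₀ : 0 < X := by linarith
  have hH₀ : 0 < H := hH₁.trans_lt' (by positivity)
  have T_le := rpow_div_le hX₀ hc₁ hX₃ hH₁
  have N_le : (⌊2 * X ^ δ⌋₊ : ℝ) ≤ 2 * X ^ δ := Nat.floor_le (by positivity)
  have K_le : (⌊X ^ (1 - δ + δ ^ 2 / 100)⌋₊ : ℝ) ≤ X ^ (1 - δ + δ ^ 2 / 100) :=
    Nat.floor_le (by positivity)
  have N_le_X : (⌊2 * X ^ δ⌋₊ : ℝ) ≤ X := by
    calc (⌊2 * X ^ δ⌋₊ : ℝ) ≤ X ^ (1 - δ) * X ^ δ := N_le.trans (by gcongr)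
      _ = X := by rw [← Real.rpow_add hX₀, sub_add_cancel, Real.rpow_one]
  have K_le_X : (⌊X ^ (1 - δ + δ ^ 2 / 100)⌋₊ : ℝ) ≤ X := by
    refine K_le.trans ((Real.rpow_le_rpow_of_exponent_le (by linarith) ?_).trans_eq
      (Real.rpow_one X))
    nlinarith
  refine (mul_le_mul_of_nonneg_left (integral_le X (X ^ (1 + δ) / H) (X / H + 1 / 2)
    (X ^ (11 / 10 * δ ^ 2)) (X ^ (δ - 2 * (11 / 10 * δ ^ 2))) _ _ _ hX
    (one_le_rpow_div hX₀ hH₀ hX₂ hH₂) T_le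
    (by positivity) (by positivity) (by positivity)
    (fun m hm => ⟨Nat.ne_zero_of_lt (Finset.mem_Ioc.mp hm).1, (Finset.mem_Ioc.mp hm).2⟩)
    N_le_X K_le_X fun k hk => hφ₀ _ ?_) (by positivity)).trans
    (optimized_bound_le (by linarith) hc₁ hδ₀ hδ hH₁ T_le hj (by positivity) N_le (by positivity)
      K_le hC₁ hC₂ hC₃)
  exact (Real.lt_logb_iff_rpow_lt (by linarith) (by exact_mod_cast Nat.zero_lt_of_lt hk)).mpr
    (Nat.lt_of_floor_lt hk)

theorem exists_eventually_integral_norm_shortSum_sq_le (hL : IsEntireEulerProduct A L d)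
    (hθ : IsSubconvexityExponent L θ) (hδ₀ : 0 < δ) (hδ : δ ≤ 1 / 12) {c₁ : ℝ} (hc₁ : 0 < c₁)
    (c₂ : ℝ) : ∃ C : ℝ, 0 ≤ C ∧ ∀ᶠ X : ℝ in atTop, ∀ H : ℝ, c₁ * X ^ (6 * δ) ≤ H →
      H ≤ c₂ * X ^ (1 - 6 * δ) → ∫ x in X..2 * X, ‖shortSum A (X ^ δ) H x‖ ^ 2 ≤
        C * (X ^ (-(δ ^ 2 / 100)) * secondMomentBound θ δ X H) := by
  obtain ⟨φ, hφ, hφ₂, hφ_le, hφ_one, hφ_zero⟩ := exists_contDiff_cutoff (δ := δ)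
    (ε := δ ^ 2 / 100) (by linarith) (by positivity) (by nlinarith)
  obtain ⟨C, hC, integral_le⟩ := hL.exists_eventually_integral_norm_coprimeCritPoly_sq_div_le hθ
    hφ hφ₂ hφ_le hφ_zero hδ₀ hδ hc₁ c₂
  refine ⟨3 * ((2 + c₂) ^ 2 + 5) * C, by positivity, ?_⟩
  filter_upwards [integral_le, eventually_gt_atTop 1,
    eventually_le_rpow (2 + c₂) (b := δ ^ 2 / 100 / 2) (by positivity)] with
    X integral_le hX hX' H hH₁ hH₂
  have hX₀ : 0 < X := by linarith
  have hH₀ : 0 < H := hH₁.trans_lt' (by positivity)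
  have hc₂ : 0 < c₂ := pos_of_mul_pos_left (hH₀.trans_le hH₂) (by positivity)
  have H_le : H ≤ c₂ * X := by
    refine hH₂.trans (mul_le_mul_of_nonneg_left ?_ hc₂.le)
    simpa using Real.rpow_le_rpow_of_exponent_le hX.le (by linarith : 1 - 6 * δ ≤ 1)
  have window_le : 2 * X + H ≤ X ^ (δ ^ 2 / 100 / 2) * X := by
    linarith [mul_le_mul_of_nonneg_right hX' hX₀.le]
  refine (hL.integral_norm_shortSum_sq_le (w := fun k => φ (Real.logb X k)) hX₀ hH₀
    fun m hm k hk hmk => le_floor_and_cutoff_eq_one hX (by positivity) hφ_one window_le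
      (Nat.lt_of_floor_lt (Finset.mem_Ioc.mp hm).1) hk hmk).trans ?_
  refine le_trans ?_ ((mul_le_mul_of_nonneg_left (integral_le H hH₁ hH₂)
    (by positivity : 0 ≤ 3 * ((2 + c₂) ^ 2 + 5))).trans_eq (by ring))
  exact parseval_factor_le hX₀.le hH₀.le H_le (MeasureTheory.integral_nonneg fun t => by positivity)

end IsEntireEulerProduct

end MeanSquareOfShortSums

section SecondMomentBound

open MeasureTheory Filter

theorem norm_shortSum_le_sum (A : ℕ → ℂ) {M H x R : ℝ} (hM : 2 * M ≤ R) (hx : x + H ≤ R) :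
    ‖shortSum A M H x‖ ≤
      ∑ m ∈ Finset.range (⌊R⌋₊ + 1), ∑ k ∈ Finset.range (⌊R⌋₊ + 1), ‖A (m * k)‖ := by
  rw [shortSum]
  refine (norm_sum_le _ _).trans ((Finset.sum_le_sum fun m _ => norm_sum_le _ _).trans ?_)
  refine (Finset.sum_le_sum_of_subset_of_nonneg (fun m hm => ?_)
    fun _ _ _ => Finset.sum_nonneg fun _ _ => norm_nonneg _).trans
    (Finset.sum_le_sum fun m _ => Finset.sum_le_sum_of_subset_of_nonneg (fun k hk => ?_)
      fun _ _ _ => norm_nonneg _)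
  · rw [Finset.mem_range, Nat.lt_succ_iff]
    exact (Finset.mem_Ioc.mp hm).2.trans (Nat.floor_mono hM)
  · rw [Finset.mem_range, Nat.lt_succ_iff]
    exact (Finset.mem_Icc.mp (Finset.mem_filter.mp hk).1).2.trans (Nat.floor_mono hx)

theorem exists_integral_norm_shortSum_sq_le_of_le (A : ℕ → ℂ) {δ : ℝ} (hδ : 0 < δ) {c₁ : ℝ}
    (hc₁ : 0 < c₁) (c₂ X₁ : ℝ) :
    ∃ C : ℝ, ∀ X H : ℝ, 1 ≤ X → X ≤ X₁ → c₁ * X ^ (6 * δ) ≤ H → H ≤ c₂ * X ^ (1 - 6 * δ) →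
      ∫ x in X..2 * X, ‖shortSum A (X ^ δ) H x‖ ^ 2 ≤ C * (H ^ 2 * X ^ (1 - δ ^ 2)) := by
  set R : ℝ := 2 * X₁ ^ δ + (2 + |c₂|) * X₁
  set B : ℝ := ∑ m ∈ Finset.range (⌊R⌋₊ + 1), ∑ k ∈ Finset.range (⌊R⌋₊ + 1), ‖A (m * k)‖
  refine ⟨B ^ 2 * X₁ ^ δ ^ 2 / c₁ ^ 2, fun X H hX hXX₁ hH₁ hH₂ => ?_⟩
  have hX₀ : 0 < X := by linarith
  have hX₁ : 0 < X₁ := by linarith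
  have H_le : H ≤ |c₂| * X₁ := by
    calc H ≤ |c₂| * X ^ (1 : ℝ) := by
          refine hH₂.trans (mul_le_mul (le_abs_self _) ?_ (by positivity) (by positivity))
          exact Real.rpow_le_rpow_of_exponent_le hX (by linarith)
      _ ≤ |c₂| * X₁ := by
        rw [Real.rpow_one]
        gcongr
  have le_H : c₁ ≤ H :=
    (le_mul_of_one_le_right hc₁.le (Real.one_le_rpow hX (by positivity))).trans hH₁
  have two_mul_rpow_le : 2 * X ^ δ ≤ R := by
    calc 2 * X ^ δ ≤ 2 * X₁ ^ δ := by gcongr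
      _ ≤ R := le_add_of_nonneg_right (by positivity)
  have norm_le : ∀ x ∈ Set.uIoc X (2 * X), ‖‖shortSum A (X ^ δ) H x‖ ^ 2‖ ≤ B ^ 2 := by
    intro x hx
    rw [Set.uIoc_of_le (by linarith)] at hx
    rw [Real.norm_of_nonneg (by positivity)]
    gcongr
    refine norm_shortSum_le_sum A two_mul_rpow_le ?_
    linarith [hx.2, Real.rpow_nonneg hX₁.le δ]
  calc _ ≤ B ^ 2 * |2 * X - X| :=
        (Real.le_norm_self _).trans (intervalIntegral.norm_integral_le_of_norm_le_const norm_le)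
    _ = B ^ 2 * X ^ δ ^ 2 / c₁ ^ 2 * (c₁ ^ 2 * X ^ (1 - δ ^ 2)) := by
      rw [two_mul, add_sub_cancel_right, abs_of_pos hX₀, Real.rpow_sub hX₀, Real.rpow_one]
      field_simp
    _ ≤ _ := by gcongr

theorem eventually_mul_rpow_lt_mul_rpow {a b c₁ : ℝ} (hab : a < b) (hc₁ : 0 < c₁) (c₂ : ℝ) :
    ∀ᶠ X : ℝ in atTop, c₂ * X ^ a < c₁ * X ^ b := by
  filter_upwards [eventually_gt_atTop 0,
    (tendsto_rpow_atTop (sub_pos.mpr hab)).eventually_gt_atTop (c₂ / c₁)] with X hX hcX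
  rw [div_lt_iff₀' hc₁] at hcX
  calc c₂ * X ^ a < c₁ * X ^ (b - a) * X ^ a := by gcongr
    _ = c₁ * X ^ b := by rw [mul_assoc, ← Real.rpow_add hX, sub_add_cancel]

namespace IsEntireEulerProduct

variable {A : ℕ → ℂ} {L : ℂ → ℂ} {d : ℕ} {θ δ : ℝ}

theorem exists_eventually_integral_norm_shortSum_sq_le_mul_add (hL : IsEntireEulerProduct A L d)
    (hθ : IsSubconvexityExponent L θ) (hδ₀ : 0 < δ) {c₁ : ℝ} (hc₁ : 0 < c₁) (c₂ : ℝ) :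
    ∃ C : ℝ, 0 ≤ C ∧ ∀ᶠ X : ℝ in atTop, ∀ H : ℝ, c₁ * X ^ (6 * δ) ≤ H →
      H ≤ c₂ * X ^ (1 - 6 * δ) → ∫ x in X..2 * X, ‖shortSum A (X ^ δ) H x‖ ^ 2 ≤
        C * (H ^ 2 * X ^ (1 - δ ^ 2) + X ^ (2 * θ * (1 + δ) + 6 * δ) * H ^ (2 - 2 * θ)) := by
  rcases le_or_gt δ (1 / 12) with hδ | hδ
  · obtain ⟨C, hC, integral_le⟩ :=
      hL.exists_eventually_integral_norm_shortSum_sq_le hθ hδ₀ hδ hc₁ c₂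
    refine ⟨C, hC, ?_⟩
    filter_upwards [integral_le, eventually_ge_atTop 1] with X integral_le hX H hH₁ hH₂
    have : 0 < X := by linarith
    have : 0 < H := hH₁.trans_lt' (by positivity)
    refine (integral_le H hH₁ hH₂).trans (mul_le_mul_of_nonneg_left ?_ hC)
    calc _ ≤ 1 * secondMomentBound θ δ X H := by
          refine mul_le_mul_of_nonneg_right ?_ (by rw [secondMomentBound]; positivity)
          exact Real.rpow_le_one_of_one_le_of_nonpos hX (by linarith [sq_nonneg δ])
      _ ≤ _ := by
        rw [one_mul, secondMomentBound]
        gcongr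
        norm_num
  · refine ⟨0, le_rfl, ?_⟩
    filter_upwards [eventually_mul_rpow_lt_mul_rpow
      (by linarith : 1 - 6 * δ < 6 * δ) hc₁ c₂] with X hX H hH₁ hH₂
    exact absurd (hH₁.trans hH₂) hX.not_ge

theorem exists_integral_norm_shortSum_sq_le (hL : IsEntireEulerProduct A L d)
    (hθ : IsSubconvexityExponent L θ) (hδ₀ : 0 < δ) {c₁ : ℝ} (hc₁ : 0 < c₁) (c₂ : ℝ) :
    ∃ C : ℝ, ∀ X H : ℝ, 1 ≤ X → c₁ * X ^ (6 * δ) ≤ H → H ≤ c₂ * X ^ (1 - 6 * δ) →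
      ∫ x in X..2 * X, ‖shortSum A (X ^ δ) H x‖ ^ 2 ≤
        C * (H ^ 2 * X ^ (1 - δ ^ 2) + X ^ (2 * θ * (1 + δ) + 6 * δ) * H ^ (2 - 2 * θ)) := by
  obtain ⟨C₁, hC₁, eventually_le⟩ :=
    hL.exists_eventually_integral_norm_shortSum_sq_le_mul_add hθ hδ₀ hc₁ c₂
  obtain ⟨X₁, large_le⟩ := eventually_atTop.mp eventually_le
  obtain ⟨C₂, bounded_le⟩ := exists_integral_norm_shortSum_sq_le_of_le A hδ₀ hc₁ c₂ X₁
  refine ⟨max C₁ C₂, fun X H hX hH₁ hH₂ => ?_⟩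
  have : 0 < X := by linarith
  have : 0 < H := hH₁.trans_lt' (by positivity)
  rcases le_total X₁ X with h | h
  · refine (large_le X h H hH₁ hH₂).trans ?_
    gcongr
    exact le_max_left _ _
  · calc _ ≤ C₂ * (H ^ 2 * X ^ (1 - δ ^ 2)) := bounded_le X H hX h hH₁ hH₂
      _ ≤ max C₁ C₂ * (H ^ 2 * X ^ (1 - δ ^ 2)) := by
        gcongr
        exact le_max_right _ _
      _ ≤ _ := by
        have : 0 ≤ max C₁ C₂ := hC₁.trans (le_max_left _ _)
        gcongr
        exact le_add_of_nonneg_right (by positivity)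

end IsEntireEulerProduct

end SecondMomentBound

section ExceptionalSet

open MeasureTheory Filter

theorem one_sub_zpow_mul_measureReal_univ_le {α : Type*} [MeasurableSpace α] {μ : Measure α}
    [IsFiniteMeasure μ] {f : α → ℝ} {V C : ℝ} (hf : Measurable f) (hf₀ : ∀ x, 0 ≤ f x)
    (hf₂ : Integrable (fun x => f x ^ 2) μ) (hV : 0 < V) (hC : 0 < C)
    (h : ∫ x, f x ^ 2 ∂μ ≤ V ^ 2 * μ.real Set.univ) :
    (1 - C ^ (-2 : ℤ)) * μ.real Set.univ ≤ μ.real {x | f x < C * V} := by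
  have compl_eq : {x | f x < C * V}ᶜ = {x | (C * V) ^ 2 ≤ f x ^ 2} := by
    ext x
    simp only [Set.mem_compl_iff, Set.mem_ofPred_eq, not_lt]
    exact (pow_le_pow_iff_left₀ (by positivity) (hf₀ x) two_ne_zero).symm
  have chebyshev : (C * V) ^ 2 * μ.real {x | f x < C * V}ᶜ ≤ V ^ 2 * μ.real Set.univ := by
    rw [compl_eq]
    exact (mul_meas_ge_le_integral_of_nonneg (Eventually.of_forall fun x => sq_nonneg (f x)) hf₂
      _).trans h
  have compl_le : μ.real {x | f x < C * V}ᶜ ≤ C ^ (-2 : ℤ) * μ.real Set.univ := by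
    rw [zpow_neg, zpow_ofNat, inv_mul_eq_div, le_div_iff₀ (by positivity)]
    refine le_of_mul_le_mul_left (a := V ^ 2) ?_ (by positivity)
    linarith
  have := measureReal_add_measureReal_compl (μ := μ) (measurableSet_lt hf measurable_const
    : MeasurableSet {x | f x < C * V})
  linarith

theorem six_mul_le_lengthExponent {θ δ : ℝ} (hδ : 0 < δ) (h : lengthExponent θ δ ≤ 1 - 6 * δ) :
    6 * δ ≤ lengthExponent θ δ := by
  rw [lengthExponent] at h ⊢
  split_ifs at h ⊢ with hθ
  · have inv_le_one : 1 / (2 * θ) ≤ 1 := by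
      rw [div_le_one (by linarith)]
      linarith
    have inv_nonneg : 0 ≤ 1 / (2 * θ) := one_div_nonneg.mpr (by linarith)
    have exponent_eq : 1 + δ - 1 / (2 * θ) + (6 * δ + 2 * δ ^ 2) / (2 * θ) =
        1 + δ - (1 - 6 * δ - 2 * δ ^ 2) * (1 / (2 * θ)) := by ring
    rw [exponent_eq] at h ⊢
    rcases le_total 0 (1 - 6 * δ - 2 * δ ^ 2) with h₀ | h₀
    · linarith [mul_le_of_le_one_right h₀ inv_le_one, sq_nonneg δ]
    · linarith [mul_nonpos_of_nonpos_of_nonneg h₀ inv_nonneg]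
  · exact le_rfl

theorem rpow_mul_rpow_lengthExponent_le {θ δ X : ℝ} (hδ₀ : 0 < δ) (hδ : δ ≤ 1 / 12) (hX : 1 ≤ X) :
    X ^ (2 * θ * (1 + δ) + 4 * δ) * (X ^ lengthExponent θ δ) ^ (2 - 2 * θ) ≤
      (X ^ lengthExponent θ δ) ^ 2 * X ^ (1 - δ ^ 2) := by
  have hX₀ : 0 < X := by linarith
  rw [← Real.rpow_natCast, ← Real.rpow_mul hX₀.le, ← Real.rpow_mul hX₀.le, ← Real.rpow_add hX₀,
    ← Real.rpow_add hX₀]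
  refine Real.rpow_le_rpow_of_exponent_le hX ?_
  suffices 2 * θ * (1 + δ) + 4 * δ - 2 * θ * lengthExponent θ δ ≤ 1 - δ ^ 2 by
    push_cast
    linarith
  rw [lengthExponent]
  split_ifs with hθ
  · have two_mul_exponent : 2 * θ * (1 + δ - 1 / (2 * θ) + (6 * δ + 2 * δ ^ 2) / (2 * θ)) =
        2 * θ * (1 + δ) - 1 + (6 * δ + 2 * δ ^ 2) := by
      have : 0 < θ := by linarith
      field_simp
    rw [two_mul_exponent]
    nlinarith
  · nlinarith [not_le.mp hθ]

theorem two_mul_mul_rpow_le {X C a h b : ℝ} (hX : 0 < X) (hC : 2 * C ≤ X ^ a) :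
    C * (X ^ (-a) * (2 * ((X ^ h) ^ 2 * X ^ (1 - b)))) ≤ (X ^ h * X ^ (-(b / 2))) ^ 2 * X := by
  calc _ = 2 * C * X ^ (-a) * ((X ^ h) ^ 2 * X ^ (1 - b)) := by ring
    _ ≤ X ^ a * X ^ (-a) * ((X ^ h) ^ 2 * X ^ (1 - b)) := by gcongr
    _ = (X ^ h) ^ 2 * (X ^ (-b) * X) := by
      rw [← Real.rpow_add hX, add_neg_cancel, Real.rpow_zero, one_mul, ← Real.rpow_add_one hX.ne',
        neg_add_eq_sub]
    _ = _ := by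
      rw [mul_pow, ← Real.rpow_natCast (X ^ (-(b / 2))), ← Real.rpow_mul hX.le, mul_assoc]
      congr 3
      push_cast
      ring

namespace IsEntireEulerProduct

variable {A : ℕ → ℂ} {L : ℂ → ℂ} {d : ℕ}

theorem exists_windowSum_eq (hL : IsEntireEulerProduct A L d) (M H b : ℝ) :
    ∃ (s : Finset (ℕ × ℕ)) (ν : ℕ × ℕ → ℝ) (β : ℕ × ℕ → ℂ),
      ∀ x ≤ b, shortSum A M H x = windowSum s ν β H x := by
  refine ⟨_, _, _, fun x hx => hL.shortSum_eq_windowSum (y := b + H) (K := ⌊b + H⌋₊) (w := 1)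
    (by linarith) fun m hm k _ hmk => ⟨Nat.le_floor (le_trans ?_ hmk), rfl⟩⟩
  refine le_mul_of_one_le_left (Nat.cast_nonneg k) ?_
  exact_mod_cast Nat.one_le_of_lt (Finset.mem_Ioc.mp hm).1

theorem le_volume_norm_shortSum_lt (hL : IsEntireEulerProduct A L d) {M H X V C : ℝ} (hX : 0 < X)
    (hV : 0 < V) (hC : 0 < C) (h : ∫ x in X..2 * X, ‖shortSum A M H x‖ ^ 2 ≤ V ^ 2 * X) :
    (1 - C ^ (-2 : ℤ)) * X ≤
      volume.real {x : ℝ | x ∈ Set.Icc X (2 * X) ∧ ‖shortSum A M H x‖ < C * V} := by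
  obtain ⟨s, ν, β, eq_windowSum⟩ := hL.exists_windowSum_eq M H (2 * X)
  have hX₂ : X ≤ 2 * X := by linarith
  have measurable_norm : Measurable fun x => ‖windowSum s ν β H x‖ :=
    (measurable_windowSum s ν β H).norm
  have integrable_sq := intervalIntegrable_norm_windowSum_sq s ν β H X (2 * X)
  rw [intervalIntegrable_iff_integrableOn_Icc_of_le hX₂] at integrable_sq
  have set_eq : {x : ℝ | x ∈ Set.Icc X (2 * X) ∧ ‖shortSum A M H x‖ < C * V} =
      {x | ‖windowSum s ν β H x‖ < C * V} ∩ Set.Icc X (2 * X) := by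
    ext x
    simp only [Set.mem_ofPred_eq, Set.mem_inter_iff, and_comm]
    exact and_congr_left fun hx => by rw [eq_windowSum x hx.2]
  have volume_univ : (volume.restrict (Set.Icc X (2 * X))).real Set.univ = X := by
    rw [measureReal_restrict_apply .univ, Set.univ_inter, Real.volume_real_Icc_of_le hX₂]
    ring
  have integral_eq : ∫ x in Set.Icc X (2 * X), ‖windowSum s ν β H x‖ ^ 2 =
      ∫ x in X..2 * X, ‖shortSum A M H x‖ ^ 2 := by
    rw [intervalIntegral.integral_of_le hX₂, integral_Icc_eq_integral_Ioc]
    exact setIntegral_congr_fun measurableSet_Ioc fun x hx => by simp only [eq_windowSum x hx.2]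
  have chebyshev := one_sub_zpow_mul_measureReal_univ_le (μ := volume.restrict (Set.Icc X (2 * X)))
    measurable_norm (fun _ => norm_nonneg _) integrable_sq hV hC
    (by rw [integral_eq, volume_univ]; exact h)
  rwa [volume_univ, measureReal_restrict_apply (measurableSet_lt measurable_norm measurable_const),
    ← set_eq] at chebyshev

theorem exists_forall_le_volume_norm_shortSum_lt (hL : IsEntireEulerProduct A L d) {θ δ : ℝ}
    (hθ : IsSubconvexityExponent L θ) (hδ₀ : 0 < δ) (hh : lengthExponent θ δ ≤ 1 - 6 * δ) :
    ∃ X₀ : ℝ, ∀ X : ℝ, X₀ ≤ X → ∀ C : ℝ, 0 < C →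
      (1 - C ^ (-2 : ℤ)) * X ≤
        volume.real {x : ℝ | x ∈ Set.Icc X (2 * X) ∧
          ‖shortSum A (X ^ δ) (X ^ lengthExponent θ δ) x‖ <
            C * X ^ lengthExponent θ δ * X ^ (-(δ ^ 2 / 2))} := by
  have hh' := six_mul_le_lengthExponent hδ₀ hh
  have hδ : δ ≤ 1 / 12 := by linarith
  obtain ⟨C₁, hC₁, integral_le⟩ :=
    hL.exists_eventually_integral_norm_shortSum_sq_le hθ hδ₀ hδ one_pos 1
  refine eventually_atTop.mp ?_
  filter_upwards [integral_le, eventually_ge_atTop 1,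
    eventually_le_rpow (2 * C₁) (b := δ ^ 2 / 100) (by positivity)] with X integral_le hX hC₁X C hC
  have hX₀ : 0 < X := by linarith
  simp_rw [mul_assoc C]
  refine hL.le_volume_norm_shortSum_lt hX₀ (by positivity) hC ?_
  calc _ ≤ C₁ * (X ^ (-(δ ^ 2 / 100)) * secondMomentBound θ δ X (X ^ lengthExponent θ δ)) := by
        refine integral_le _ ?_ ?_
        · exact (one_mul _).trans_le (Real.rpow_le_rpow_of_exponent_le hX hh')
        · exact (Real.rpow_le_rpow_of_exponent_le hX hh).trans_eq (one_mul _).symm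
    _ ≤ C₁ * (X ^ (-(δ ^ 2 / 100)) *
        (2 * ((X ^ lengthExponent θ δ) ^ 2 * X ^ (1 - δ ^ 2)))) := by
      rw [secondMomentBound, two_mul (_ ^ 2 * _)]
      gcongr _ * (_ * (_ + ?_))
      exact rpow_mul_rpow_lengthExponent_le hδ₀ hδ hX
    _ ≤ _ := two_mul_mul_rpow_le hX₀ hC₁X

end IsEntireEulerProduct

end ExceptionalSet

theorem proposition1_general (A : ℕ → ℂ) (L : ℂ → ℂ) (d : ℕ) (hL : IsEntireEulerProduct A L d)
    (θ : ℝ) (hθ : IsSubconvexityExponent L θ) (δ : ℝ) (hδ₀ : 0 < δ) :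
    (∀ c₁ c₂ : ℝ, 0 < c₁ → ∃ K : ℝ, ∀ X H : ℝ, 1 ≤ X →
      c₁ * X ^ (6 * δ) ≤ H → H ≤ c₂ * X ^ (1 - 6 * δ) →
        ∫ x in X..(2 * X), ‖shortSum A (X ^ δ) H x‖ ^ 2 ≤
          K * (H ^ 2 * X ^ (1 - δ ^ 2)
            + X ^ (2 * θ * (1 + δ) + 6 * δ) * H ^ (2 - 2 * θ))) ∧
    (lengthExponent θ δ ≤ 1 - 6 * δ →
      ∃ X₀ : ℝ, ∀ X : ℝ, X₀ ≤ X → ∀ C : ℝ, 0 < C →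
        (1 - C ^ (-2 : ℤ)) * X ≤
          MeasureTheory.volume.real {x : ℝ | x ∈ Set.Icc X (2 * X) ∧
            ‖shortSum A (X ^ δ) (X ^ lengthExponent θ δ) x‖ <
              C * X ^ lengthExponent θ δ * X ^ (-(δ ^ 2 / 2))}) :=
  ⟨fun _ c₂ hc₁ => hL.exists_integral_norm_shortSum_sq_le hθ hδ₀ hc₁ c₂,
    fun hh => hL.exists_forall_le_volume_norm_shortSum_lt hθ hδ₀ hh⟩

theorem proposition1 (A : ℕ → ℂ) (L : ℂ → ℂ) (d : ℕ) (hL : IsLFunction A L d)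
    (θ : ℝ) (hθ : IsSubconvexityExponent L θ) (δ : ℝ) (hδ₀ : 0 < δ) (hδ₁ : δ < 1) :
    (∀ c₁ c₂ : ℝ, 0 < c₁ → 0 < c₂ → ∃ K : ℝ, ∀ X H : ℝ, 1 ≤ X →
      c₁ * X ^ (6 * δ) ≤ H → H ≤ c₂ * X ^ (1 - 6 * δ) →
        ∫ x in X..(2 * X), ‖shortSum A (X ^ δ) H x‖ ^ 2 ≤
          K * (H ^ 2 * X ^ (1 - δ ^ 2)
            + X ^ (2 * θ * (1 + δ) + 6 * δ) * H ^ (2 - 2 * θ))) ∧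
    (lengthExponent θ δ ≤ 1 - 6 * δ →
      ∃ X₀ : ℝ, ∀ X : ℝ, X₀ ≤ X → ∀ C : ℝ, 1 ≤ C →
        (1 - C ^ (-2 : ℤ)) * X ≤
          MeasureTheory.volume.real {x : ℝ | x ∈ Set.Icc X (2 * X) ∧
            ‖shortSum A (X ^ δ) (X ^ lengthExponent θ δ) x‖ <
              C * X ^ lengthExponent θ δ * X ^ (-(δ ^ 2 / 2))}) := by
  have h := proposition1_general A L d hL.isEntireEulerProduct θ hθ δ hδ₀
  exact ⟨fun c₁ c₂ hc₁ _ => h.1 c₁ c₂ hc₁,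
    fun hh => (h.2 hh).imp fun _ le X hX C hC => le X hX C (one_pos.trans_le hC)⟩
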